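/- **Setting.** Consider a hybrid impulsive control system: a finite set $\mathcal Q$ of locations; for each $q\in\mathcal Q$ a state space $\mathcal M_q\subseteq\mathbb R^{n_q}$, which is an embedded submanifold without boundary of class (at least) $C^2$, and a control space $U_q\subseteq\mathbb R^{m_q}$; dynamics $f_q:\mathcal M_q\times U_q\to T\mathcal M_q$ with $f_q(x,u)\in T_x\mathcal M_q$, continuous in $(x,u)$ and differentiable in $x$ with differential $D_xf_q(x,u)$ continuous in $(x,u)$; and, for every pair $(q,q')$ in a given set of possible transitions, a guard $\Phi_{q,q'}\in C^1(\mathcal M_q,\mathbb R)$ and a reset map $\Omega_{q,q'}\in C^1(\mathcal M_q,\mathcal M_{q'})$. A control $u=(u_q)_{q\in\mathcal Q}$ consists of piecewise continuous functions $u_q:\mathbb R\to U_q$ (isolated discontinuities, one-sided limits in $U_q$). A trajectory on $[t_0,t_f]$ with location sequence $q_0,\dots,q_r$, transition times $t_0<t_1<\dots<t_r<t_{r+1}=t_f$ and given initial state consists of continuous segments $x:[t_i,t_{i+1}]\to\mathcal M_{q_i}$ which satisfy $\dot x=f_{q_i}(x,u_{q_i})$ on $(t_i,t_{i+1})$ at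 the points of continuity of $u_{q_i}$, such that no guard $\Phi_{q_i,q'}$ vanishes on $(t_i,t_{i+1})$ and, for $i<r$, $\Phi_{q_i,q_{i+1}}(x(t_{i+1}^-))=0$ and $x(t_{i+1}^+)=\Omega_{q_i,q_{i+1}}(x(t_{i+1}^-))$. Let $x_n$ be a trajectory under a control $u_n$, with initial state $x_{init}$, location sequence $q_0,\dots,q_r$ and transition times $t_1,\dots,t_r$. Let $0\le k\le r$, let $\tau\in(t_k,t_{k+1})$ be a point of continuity of $u_{n,q_k}$, and let $w\in U_{q_k}$ and $a>0$. For $\varepsilon>0$ let $u_w$ be the control that equals $w$ in location $q_k$ at the times $t\in[\tau-\varepsilon a,\tau]$ and equals $u_n$ otherwise. Write $f_{i}^-=f_{q_i}(x_n(t_{i+1}^-),u_{n,q_i}(t_{i+1}))$ and $f_{i+1}^+=f_{q_{i+1}}(x_n(t_{i+1}^+),u_{n,q_{i+1}}(t_{i+1}))$. Assume that for $k\le i<r$ the transition from $q_i$ to $q_{i+1}$ is regular: * $u_{n,q_i}$ and $u_{n,q_{i+1}}$ are continuous at $t_{i+1}$; * $D_x\Phi_{q_i,q_{i+1}}(x_n(t_{i+1}^-))\,f_i^-\ne0$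 (no grazing); * $\Phi_{q_i,q'}(x_n(t_{i+1}^-))\neq0$ for all $q'\ne q_{i+1}$ (a single guard is active); * for every guard $\Phi_{q_{i+1},q'}$ of the new location, either $\Phi_{q_{i+1},q'}(x_n(t_{i+1}^+))\neq0$, or $\Phi_{q_{i+1},q'}\circ\Omega_{q_i,q_{i+1}}=0$ on $\{\Phi_{q_i,q_{i+1}}=0\}$ near $x_n(t_{i+1}^-)$ and $D_x\Phi_{q_{i+1},q'}(x_n(t_{i+1}^+))\,f_{i+1}^+\neq0$. Assume also that no guard of $q_r$ vanishes at $x_n(t_f)$. **Proposition.** For all sufficiently small $\varepsilon>0$ there is a trajectory $x_w(\cdot,\varepsilon)$ on $[t_0,t_f]$ under $u_w$ with the same initial state $x_{init}$ and the same location sequence $q_0,\dots,q_r$. For any such trajectories, and for every $t$ in $[\tau,t_{k+1})$, in one of the intervals $(t_i,t_{i+1})$ with $k<i\le r$, or equal to $t_f$, the perturbed trajectory is at time $t$, for all sufficiently small $\varepsilon$, in the same location (and segment) as $x_n$, and $$x_w(t,\varepsilon)=x_n(t)+\varepsilon\,\Psi(t)+o(\varepsilon)\qquad(\varepsilon\to0^+).$$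 Here $\Psi$ is the solution, which exists and is unique, with values $\Psi(t)\in T_{x_n(t)}\mathcal M_{q_i}$ and continuous on each of $[\tau,t_{k+1}]$ and $[t_i,t_{i+1}]$ ($k<i\le r$; with the one-sided values $\Psi(t_i^{\pm})$ at the ends), of $$\Psi(\tau)=\big(f_{q_k}(x_n(\tau),w)-f_{q_k}(x_n(\tau),u_n(\tau))\big)\,a,$$ $$\dot\Psi(t)=A_{q_i}(t)\Psi(t),\quad A_{q_i}(t)=D_xf_{q_i}(x_n(t),u_{n,q_i}(t)),\quad t\in(\max(\tau,t_i),t_{i+1}),\ k\le i\le r,$$ (at the points of continuity of $u_{n,q_i}$), and $$\Psi(t_{i+1}^+)=\Pi_{q_i,q_{i+1}}\Psi(t_{i+1}^-),\qquad k\le i<r,$$ with the linear variational reset map $$\Pi_{q_i,q_{i+1}}=D_x\Omega_{q_i,q_{i+1}}(x_n(t_{i+1}^-))\left[I-\frac{f_i^-\,D_x\Phi_{q_i,q_{i+1}}(x_n(t_{i+1}^-))}{D_x\Phi_{q_i,q_{i+1}}(x_n(t_{i+1}^-))\,f_i^-}\right]+\frac{f_{i+1}^+\,D_x\Phi_{q_i,q_{i+1}}(x_n(t_{i+1}^-))}{D_x\Phi_{q_i,q_{i+1}}(x_n(t_{i+1}^-))\,f_i^-}.$$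 -/

import Mathlib

open Set Filter Topology Asymptotics

/-- `M` is an embedded submanifold (without boundary, of class `C²`) of the normed space `E`:
near each of its points it is straightened to a linear subspace by a local `C²` diffeomorphism
of `E`. -/
def IsEmbeddedSubmanifold {E : Type*} [NormedAddCommGroup E] [NormedSpace ℝ E]
    (M : Set E) : Prop :=
  ∀ x ∈ M, ∃ (φ : OpenPartialHomeomorph E E) (V : Submodule ℝ E),
    x ∈ φ.source ∧ ContDiffOn ℝ 2 φ φ.source ∧ ContDiffOn ℝ 2 φ.symm φ.target ∧
      ∀ y ∈ φ.source, (y ∈ M ↔ φ y ∈ V)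

/-- A piecewise continuous control signal with values in `U`: its points of discontinuity are
isolated, and at every time it has one-sided limits, which belong to `U`. -/
def IsPiecewiseContinuousInto {F : Type*} [TopologicalSpace F] (U : Set F) (u : ℝ → F) : Prop :=
  ∀ s : ℝ, u s ∈ U ∧ (∃ l ∈ U, Tendsto u (𝓝[<] s) (𝓝 l)) ∧
    (∃ l ∈ U, Tendsto u (𝓝[>] s) (𝓝 l)) ∧ ∀ᶠ t in 𝓝[≠] s, ContinuousAt u t

/-- A hybrid impulsive control system with set of locations `Q`.

A function defined on a submanifold `M` of a Euclidean space is represented by a function on the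
whole space, of which only the values on `M` matter.  It is `C¹` on `M` when it is
`ContDiffOn ℝ 1` there.  The differential at `x ∈ M` is `fderivWithin ℝ _ M x`, which
is determined on the tangent space `tangentConeAt ℝ M x`, and is only applied there. -/
structure HybridSystem (Q : Type*) where
  /-- dimension of the Euclidean space that contains the state space of a location -/
  n : Q → ℕ
  /-- dimension of the Euclidean space that contains the control space of a location -/
  m : Q → ℕ
  /-- the state space manifolds -/
  M : (q : Q) → Set (EuclideanSpace ℝ (Fin (n q)))
  /-- the control spaces -/
  U : (q : Q) → Set (EuclideanSpace ℝ (Fin (m q)))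
  /-- the dynamics -/
  f : (q : Q) → EuclideanSpace ℝ (Fin (n q)) → EuclideanSpace ℝ (Fin (m q)) →
    EuclideanSpace ℝ (Fin (n q))
  /-- the pairs `(q, q')` for which a transition from `q` to `q'` is provided -/
  Edge : Q → Q → Prop
  /-- the guards -/
  Φ : (q q' : Q) → EuclideanSpace ℝ (Fin (n q)) → ℝ
  /-- the reset maps -/
  Ω : (q q' : Q) → EuclideanSpace ℝ (Fin (n q)) → EuclideanSpace ℝ (Fin (n q'))
  isSubmanifold : ∀ q, IsEmbeddedSubmanifold (M q)
  f_tangent : ∀ q, ∀ x ∈ M q, ∀ u ∈ U q, f q x u ∈ tangentConeAt ℝ (M q) x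
  f_continuous : ∀ q, ContinuousOn (fun p : _ × _ => f q p.1 p.2) (M q ×ˢ U q)
  /-- `f q x u` is differentiable in `x`, with a differential that is continuous in `(x, u)` -/
  f_differentiable : ∀ q, ∃ f' : EuclideanSpace ℝ (Fin (n q)) × EuclideanSpace ℝ (Fin (m q)) →
      (EuclideanSpace ℝ (Fin (n q)) →L[ℝ] EuclideanSpace ℝ (Fin (n q))),
    ContinuousOn f' (M q ×ˢ U q) ∧
      ∀ x ∈ M q, ∀ u ∈ U q, HasFDerivWithinAt (fun y => f q y u) (f' (x, u)) (M q) x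
  Φ_contDiffOn : ∀ q q', Edge q q' → ContDiffOn ℝ 1 (Φ q q') (M q)
  Ω_contDiffOn : ∀ q q', Edge q q' → ContDiffOn ℝ 1 (Ω q q') (M q)
  Ω_mapsTo : ∀ q q', Edge q q' → MapsTo (Ω q q') (M q) (M q')

namespace HybridSystem

variable {Q : Type*} (H : HybridSystem Q)

/-- The Euclidean space that contains the state space of the location `q`. -/
abbrev StateSpace (q : Q) : Type := EuclideanSpace ℝ (Fin (H.n q))

/-- The Euclidean space that contains the control space of the location `q`. -/
abbrev ControlSpace (q : Q) : Type := EuclideanSpace ℝ (Fin (H.m q))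

/-- A control: a signal for every location. -/
abbrev Control : Type _ := (q : Q) → ℝ → H.ControlSpace q

/-- A control is admissible when it is piecewise continuous in every location. -/
def IsAdmissible (u : H.Control) : Prop :=
  ∀ q, IsPiecewiseContinuousInto (H.U q) (u q)

/-- The data of a hybrid trajectory through the locations `loc 0, loc 1, …`: its `i`-th
continuous segment is the restriction of `state i` to `[time i, time (i + 1)]`. -/
structure Trajectory (loc : ℕ → Q) where
  time : ℕ → ℝ
  state : (i : ℕ) → ℝ → H.StateSpace (loc i)

/-- `X` is a trajectory of the hybrid system on `[t₀, t_f]` under the control `u`, with the initial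
state `x₀` and the location sequence `loc 0, …, loc r` (the values of `loc` beyond `r` play no
role).  The segment `i ≤ r` is continuous, has its values in the state space of `loc i`, and solves
the differential equation at the times at which the control is continuous.  No guard of
the current location vanishes before the segment ends; at the end of each segment `i < r` the guard
to `loc (i + 1)` vanishes, and the reset map gives the initial state of the next segment. -/
structure IsTrajectory (u : H.Control) (t₀ t_f : ℝ) (loc : ℕ → Q) (r : ℕ)
    (x₀ : H.StateSpace (loc 0)) (X : H.Trajectory loc) : Prop where
  time_zero : X.time 0 = t₀
  time_last : X.time (r + 1) = t_f
  time_lt : ∀ i ≤ r, X.time i < X.time (i + 1)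
  init : X.state 0 t₀ = x₀
  mem : ∀ i ≤ r, ∀ t ∈ Icc (X.time i) (X.time (i + 1)), X.state i t ∈ H.M (loc i)
  continuousOn : ∀ i ≤ r, ContinuousOn (X.state i) (Icc (X.time i) (X.time (i + 1)))
  hasDerivAt : ∀ i ≤ r, ∀ t ∈ Ioo (X.time i) (X.time (i + 1)), ContinuousAt (u (loc i)) t →
    HasDerivAt (X.state i) (H.f (loc i) (X.state i t) (u (loc i) t)) t
  guard_ne_zero : ∀ i ≤ r, ∀ t ∈ Ioo (X.time i) (X.time (i + 1)), ∀ q, H.Edge (loc i) q →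
    H.Φ (loc i) q (X.state i t) ≠ 0
  edge : ∀ i < r, H.Edge (loc i) (loc (i + 1))
  guard_eq_zero : ∀ i < r, H.Φ (loc i) (loc (i + 1)) (X.state i (X.time (i + 1))) = 0
  reset : ∀ i < r, X.state (i + 1) (X.time (i + 1)) =
    H.Ω (loc i) (loc (i + 1)) (X.state i (X.time (i + 1)))

open Classical in
/-- The perturbed control: in the location `q₀` and at the times in `[τ - ε a, τ]` it has the value
`w`, otherwise it is the nominal control `u`. -/
noncomputable def perturbedControl (u : H.Control) (q₀ : Q) (w : H.ControlSpace q₀) (τ a ε : ℝ) :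
    H.Control :=
  Function.update u q₀ (fun t => if t ∈ Icc (τ - ε * a) τ then w else u q₀ t)

section Transition

variable {loc : ℕ → Q} (u : H.Control) (X : H.Trajectory loc) (i : ℕ)

/-- The state just before the transition from segment `i` to segment `i + 1`. -/
def stateBefore : H.StateSpace (loc i) := X.state i (X.time (i + 1))

/-- The state just after the transition from segment `i` to segment `i + 1`. -/
def stateAfter : H.StateSpace (loc (i + 1)) := X.state (i + 1) (X.time (i + 1))

/-- The vector field just before the transition from segment `i` to segment `i + 1`. -/
def fieldBefore : H.StateSpace (loc i) :=
  H.f (loc i) (H.stateBefore X i) (u (loc i) (X.time (i + 1)))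

/-- The vector field just after the transition from segment `i` to segment `i + 1`. -/
def fieldAfter : H.StateSpace (loc (i + 1)) :=
  H.f (loc (i + 1)) (H.stateAfter X i) (u (loc (i + 1)) (X.time (i + 1)))

/-- The differential `D_x Φ_{q,q'}(x)` of a guard, a row vector. -/
noncomputable def guardGradient (q q' : Q) (x : H.StateSpace q) : H.StateSpace q →L[ℝ] ℝ :=
  fderivWithin ℝ (H.Φ q q') (H.M q) x

/-- The differential `D_x Ω_{q,q'}(x)` of a reset map. -/
noncomputable def resetDifferential (q q' : Q) (x : H.StateSpace q) :
    H.StateSpace q →L[ℝ] H.StateSpace q' :=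
  fderivWithin ℝ (H.Ω q q') (H.M q) x

/-- The linearization `A(t) = D_x f(x(t), u(t))` of the dynamics along segment `i`. -/
noncomputable def linearization (t : ℝ) : H.StateSpace (loc i) →L[ℝ] H.StateSpace (loc i) :=
  fderivWithin ℝ (fun y => H.f (loc i) y (u (loc i) t)) (H.M (loc i)) (X.state i t)

/-- The variational reset map of the transition from segment `i` to segment `i + 1`:
`Π = DΩ (I - f⁻ DΦ / (DΦ f⁻)) + f⁺ DΦ / (DΦ f⁻)`. -/
noncomputable def variationalReset :
    H.StateSpace (loc i) →L[ℝ] H.StateSpace (loc (i + 1)) :=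
  let DΩ := H.resetDifferential (loc i) (loc (i + 1)) (H.stateBefore X i)
  let DΦ := H.guardGradient (loc i) (loc (i + 1)) (H.stateBefore X i)
  let fm := H.fieldBefore u X i
  let fp := H.fieldAfter u X i
  DΩ.comp (ContinuousLinearMap.id ℝ _ - (DΦ fm)⁻¹ • DΦ.smulRight fm)
    + (DΦ fm)⁻¹ • DΦ.smulRight fp

/-- The transition from segment `i` to segment `i + 1` is regular: the nominal controls of the two
locations are continuous at the transition time; the trajectory does not graze the guard;
only one guard is active; and every guard of the new location is inactive after
the reset, except that it may vanish identically on the states just reset if the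
trajectory then leaves its zero set at nonzero speed (as when the same impact surface is the guard
for several consecutive transitions). -/
structure IsRegularTransition : Prop where
  continuousAt_before : ContinuousAt (u (loc i)) (X.time (i + 1))
  continuousAt_after : ContinuousAt (u (loc (i + 1))) (X.time (i + 1))
  transversal :
    H.guardGradient (loc i) (loc (i + 1)) (H.stateBefore X i) (H.fieldBefore u X i) ≠ 0
  single : ∀ q, H.Edge (loc i) q → q ≠ loc (i + 1) → H.Φ (loc i) q (H.stateBefore X i) ≠ 0
  after : ∀ q, H.Edge (loc (i + 1)) q →
    H.Φ (loc (i + 1)) q (H.stateAfter X i) ≠ 0 ∨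
      ((∀ᶠ y in 𝓝[H.M (loc i)] (H.stateBefore X i), H.Φ (loc i) (loc (i + 1)) y = 0 →
          H.Φ (loc (i + 1)) q (H.Ω (loc i) (loc (i + 1)) y) = 0) ∧
        H.guardGradient (loc (i + 1)) q (H.stateAfter X i) (H.fieldAfter u X i) ≠ 0)

end Transition

/-- `Ψ` solves the variational equations along the trajectory `X` under the control `u`, for
the needle perturbation with value `w` and direction `a` at the time `τ` of segment `k`.  The piece
`Ψ i` is defined on `[max τ (time i), time (i + 1)]`, that is, from `τ` on for `i = k` and on all of
segment `i` for `k < i ≤ r`; it consists of tangent vectors along `X`. -/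
structure IsVariation {loc : ℕ → Q} (u : H.Control) (X : H.Trajectory loc) (r k : ℕ)
    (w : H.ControlSpace (loc k)) (τ a : ℝ) (Ψ : (i : ℕ) → ℝ → H.StateSpace (loc i)) : Prop where
  init : Ψ k τ = a • (H.f (loc k) (X.state k τ) w - H.f (loc k) (X.state k τ) (u (loc k) τ))
  tangent : ∀ i, k ≤ i → i ≤ r → ∀ t ∈ Icc (max τ (X.time i)) (X.time (i + 1)),
    Ψ i t ∈ tangentConeAt ℝ (H.M (loc i)) (X.state i t)
  continuousOn : ∀ i, k ≤ i → i ≤ r →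
    ContinuousOn (Ψ i) (Icc (max τ (X.time i)) (X.time (i + 1)))
  hasDerivAt : ∀ i, k ≤ i → i ≤ r → ∀ t ∈ Ioo (max τ (X.time i)) (X.time (i + 1)),
    ContinuousAt (u (loc i)) t → HasDerivAt (Ψ i) (H.linearization u X i t (Ψ i t)) t
  reset : ∀ i, k ≤ i → i < r →
    Ψ (i + 1) (X.time (i + 1)) = H.variationalReset u X i (Ψ i (X.time (i + 1)))

/-- The times at which the location of the perturbed trajectory is eventually (for small
perturbations) that of segment `i` of the nominal trajectory `X`, from `τ` on: `[τ, time (k + 1))`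
for `i = k`, `(time i, time (i + 1))` for later segments; the final time, at which the
last segment `r` ends, is included. -/
def variationTimes {loc : ℕ → Q} (X : H.Trajectory loc) (r k : ℕ) (τ : ℝ) (i : ℕ) : Set ℝ :=
  {t | (if i = k then τ ≤ t else X.time i < t) ∧
    (if i = r then t ≤ X.time (i + 1) else t < X.time (i + 1))}

end HybridSystem

/-! The perturbed states are expanded to first order segment by segment, and the expansion is
carried through needle, flow and reset in one fixed form: at a time `s ε` with `s ε - b = O(ε)` the
state is `p ε = x(b) + (s ε - b) f(x(b), u(b)) + ε Ψ(b) + o(ε)`. This form allows the moment of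
entry to depend on `ε`. It says that the perturbed solution, continued to the fixed time `b`, has
first variation `Ψ(b)` there.

Flow. Since `f` matters only on the manifold, it is replaced near a compact piece of the trajectory
by a bounded field `F` on the ambient space with bounded continuous derivative
(`IsControlField.exists_isExtension`). Solutions of the new equation are global, and those that
start on the manifold stay on it (`IsExtension.mapsTo_of_isSol`), so they solve the original
equation. Gronwall's inequality compares them with `x + ε Ψ`, an approximate solution with defect
`o(ε)` (`IsExtension.exists_isPerturbedFlow`).

Needle. With the constant control `w`, the state `x(τ - ε a)` at the time `τ - ε a` is an entry of
the above form, with variation `a (f(x, w) - f(x, u))` (`exists_needle`).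

Reset. Transversality gives a zero `σ ε` of the guard with `σ ε - e = O(ε)`, by the intermediate
value theorem (`exists_exit_time`). Linearizing `Φ(y(σ ε)) = 0` yields `σ ε - e = -ε DΦ Ψ / (DΦ f⁻)
+ o(ε)`. Inserted into the expansion of `Ω(y(σ ε))`, this gives an entry of the same form for the
next segment, with variation `Π Ψ` (`isLittleO_reset`). No guard vanishes strictly between entry and
exit: away from its zeros this is continuity and compactness, and near a zero at an end the guard is
injective in time (`eventually_forall_guard_ne_zero`).

The family so constructed represents all perturbed trajectories, because control, initial state and
location sequence determine the trajectory (`IsTrajectory.unique`). -/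

/-- A relation between the end points of intervals that is transitive and holds for all short
intervals with a given left or right end point holds for the whole interval. -/
theorem rel_of_local_of_trans {R : ℝ → ℝ → Prop} {a b : ℝ} (hab : a < b)
    (trans : ∀ r s t, a ≤ r → r < s → s < t → t ≤ b → R r s → R s t → R r t)
    (right : ∀ s ∈ Ico a b, ∀ᶠ t in 𝓝[>] s, R s t)
    (left : ∀ t ∈ Ioc a b, ∀ᶠ s in 𝓝[<] t, R s t) : R a b := by
  -- Continuous induction: `left` and `trans` give the relation up to the supremum of `S`, and
  -- `right` would carry it further if the supremum were less than `b`.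
  set S : Set ℝ := {t | t ∈ Ioc a b ∧ R a t}
  have hne : S.Nonempty := by
    obtain ⟨t, ht, ht'⟩ := ((right a ⟨le_rfl, hab⟩).and (Ioc_mem_nhdsGT hab)).exists
    exact ⟨t, ht', ht⟩
  have hbdd : BddAbove S := ⟨b, fun t ht => ht.1.2⟩
  set c := sSup S
  obtain ⟨t₁, ht₁⟩ := hne
  have hac : a < c := ht₁.1.1.trans_le (le_csSup hbdd ht₁)
  have hcb : c ≤ b := csSup_le ⟨t₁, ht₁⟩ fun t ht => ht.1.2
  have hRc : R a c := by
    obtain ⟨d, hd, hd'⟩ := mem_nhdsLT_iff_exists_Ioo_subset.1 (left c ⟨hac, hcb⟩)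
    obtain ⟨t, ht, hdt⟩ := exists_lt_of_lt_csSup ⟨t₁, ht₁⟩ (show d < c from hd)
    rcases (le_csSup hbdd ht).eq_or_lt with h | h
    · rw [← show t = c from h]; exact ht.2
    · exact trans a t c le_rfl ht.1.1 h hcb ht.2 (hd' ⟨hdt, h⟩)
  rcases hcb.eq_or_lt with h | h
  · exact h ▸ hRc
  · obtain ⟨t, ht, ht'⟩ := ((right c ⟨hac.le, h⟩).and (Ioc_mem_nhdsGT h)).exists
    have : t ∈ S := ⟨⟨hac.trans ht'.1, ht'.2⟩, trans a c t le_rfl hac ht'.1 ht'.2 hRc ht⟩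
    exact absurd (le_csSup hbdd this) (not_le.2 ht'.1)

/-! ### Differential equations with piecewise continuous inputs -/

section ODE

variable {E G : Type*} [NormedAddCommGroup E] [NormedSpace ℝ E] [TopologicalSpace G]

/-- `y` is a solution on `[a, b]` of the differential equation `y' = f(y, g(t))` with input
signal `g`: it is continuous, and solves the equation where `g` is continuous. -/
structure IsSol (f : E → G → E) (g : ℝ → G) (y : ℝ → E) (a b : ℝ) : Prop where
  continuousOn : ContinuousOn y (Icc a b)
  hasDerivAt : ∀ t ∈ Ioo a b, ContinuousAt g t → HasDerivAt y (f (y t) (g t)) t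

/-- `g` is piecewise continuous on `[a, b]`, with values and one-sided limits in `C`. -/
structure PiecewiseContinuousOn (C : Set G) (g : ℝ → G) (a b : ℝ) : Prop where
  mem : ∀ t ∈ Ioo a b, g t ∈ C
  right : ∀ t ∈ Ico a b, (∃ l ∈ C, Tendsto g (𝓝[>] t) (𝓝 l)) ∧ ∀ᶠ s in 𝓝[>] t, ContinuousAt g s
  left : ∀ t ∈ Ioc a b, (∃ l ∈ C, Tendsto g (𝓝[<] t) (𝓝 l)) ∧ ∀ᶠ s in 𝓝[<] t, ContinuousAt g s

variable {f f' : E → G → E} {g g' : ℝ → G} {y z : ℝ → E} {a b c d t : ℝ} {C C' : Set G} {D : Set E}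

namespace PiecewiseContinuousOn

theorem mono (hg : PiecewiseContinuousOn C g a b) (hac : a ≤ c) (hdb : d ≤ b) :
    PiecewiseContinuousOn C g c d where
  mem t ht := hg.mem t ⟨hac.trans_lt ht.1, ht.2.trans_le hdb⟩
  right t ht := hg.right t ⟨hac.trans ht.1, ht.2.trans_le hdb⟩
  left t ht := hg.left t ⟨hac.trans_lt ht.1, ht.2.trans hdb⟩

theorem mono_set (hg : PiecewiseContinuousOn C g a b) (h : C ⊆ C') :
    PiecewiseContinuousOn C' g a b where
  mem t ht := h (hg.mem t ht)
  right t ht := let ⟨⟨l, hl, hl'⟩, h'⟩ := hg.right t ht; ⟨⟨l, h hl, hl'⟩, h'⟩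
  left t ht := let ⟨⟨l, hl, hl'⟩, h'⟩ := hg.left t ht; ⟨⟨l, h hl, hl'⟩, h'⟩

theorem tendsto_rightLim [T2Space G] (hg : PiecewiseContinuousOn C g a b) (ht : t ∈ Ico a b) :
    Tendsto g (𝓝[>] t) (𝓝 (Function.rightLim g t)) ∧ Function.rightLim g t ∈ C := by
  obtain ⟨⟨l, hl, hl'⟩, -⟩ := hg.right t ht
  rw [rightLim_eq_of_tendsto hl']
  exact ⟨hl', hl⟩

/-- The signal that consists of a piecewise continuous signal and a continuous curve. -/
theorem prodMk {Y : Type*} [TopologicalSpace Y] {y : ℝ → Y} {D : Set Y}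
    (hg : PiecewiseContinuousOn C g a b) (hy : ContinuousOn y (Icc a b))
    (hD : MapsTo y (Icc a b) D) :
    PiecewiseContinuousOn (D ×ˢ C) (fun t => (y t, g t)) a b where
  mem t ht := ⟨hD (Ioo_subset_Icc_self ht), hg.mem t ht⟩
  right t ht := by
    obtain ⟨⟨l, hl, hl'⟩, h⟩ := hg.right t ht
    refine ⟨⟨(y t, l), ⟨hD (Ico_subset_Icc_self ht), hl⟩, ?_⟩, ?_⟩
    · refine Tendsto.prodMk_nhds ?_ hl'
      exact (hy t (Ico_subset_Icc_self ht)).mono_of_mem_nhdsWithin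
        (mem_of_superset (Ioo_mem_nhdsGT ht.2) fun s hs => ⟨ht.1.trans hs.1.le, hs.2.le⟩)
    · filter_upwards [h, Ioo_mem_nhdsGT ht.2] with s hs hs'
      exact (hy.continuousAt (Icc_mem_nhds (ht.1.trans_lt hs'.1) hs'.2)).prodMk hs
  left t ht := by
    obtain ⟨⟨l, hl, hl'⟩, h⟩ := hg.left t ht
    refine ⟨⟨(y t, l), ⟨hD (Ioc_subset_Icc_self ht), hl⟩, ?_⟩, ?_⟩
    · refine Tendsto.prodMk_nhds ?_ hl'
      exact (hy t (Ioc_subset_Icc_self ht)).mono_of_mem_nhdsWithin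
        (mem_of_superset (Ioo_mem_nhdsLT ht.1) fun s hs => ⟨hs.1.le, hs.2.le.trans ht.2⟩)
    · filter_upwards [h, Ioo_mem_nhdsLT ht.1] with s hs hs'
      exact (hy.continuousAt (Icc_mem_nhds hs'.1 (hs'.2.trans_le ht.2))).prodMk hs

end PiecewiseContinuousOn

namespace IsSol

theorem mono (hy : IsSol f g y a b) (hac : a ≤ c) (hdb : d ≤ b) : IsSol f g y c d where
  continuousOn := hy.continuousOn.mono (Icc_subset_Icc hac hdb)
  hasDerivAt t ht := hy.hasDerivAt t ⟨hac.trans_lt ht.1, ht.2.trans_le hdb⟩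

theorem congr_signal (hy : IsSol f g y a b) (h : EqOn g g' (Ioo a b)) : IsSol f g' y a b where
  continuousOn := hy.continuousOn
  hasDerivAt t ht hgt := by
    rw [← h ht]
    exact hy.hasDerivAt t ht (hgt.congr (mem_of_superset (Ioo_mem_nhds ht.1 ht.2)
      fun s hs => (h hs).symm))

theorem congr_field (hy : IsSol f g y a b) (h : ∀ t ∈ Ioo a b, f (y t) (g t) = f' (y t) (g t)) :
    IsSol f' g y a b where
  continuousOn := hy.continuousOn
  hasDerivAt t ht hgt := h t ht ▸ hy.hasDerivAt t ht hgt

/-- As `s` decreases to `t` the derivatives `f (y s) (g s)` converge to `f (y t) l`, and a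
continuous function whose derivative has a one-sided limit has that limit as one-sided derivative.
-/
theorem hasDerivWithinAt_Ici (hy : IsSol f g y a b) (hg : PiecewiseContinuousOn C g a b)
    (hf : ContinuousOn (fun p : E × G => f p.1 p.2) (D ×ˢ C)) (hD : MapsTo y (Icc a b) D)
    (ht : t ∈ Ico a b) {l : G} (hl : Tendsto g (𝓝[>] t) (𝓝 l)) (hlC : l ∈ C) :
    HasDerivWithinAt y (f (y t) l) (Ici t) t := by
  have hs : {s | s ∈ Ioo t b ∧ ContinuousAt g s} ∈ 𝓝[>] t :=
    inter_mem (Ioo_mem_nhdsGT ht.2) (hg.right t ht).2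
  have hd : ∀ s ∈ {s | s ∈ Ioo t b ∧ ContinuousAt g s}, HasDerivAt y (f (y s) (g s)) s :=
    fun s hs => hy.hasDerivAt s ⟨ht.1.trans_lt hs.1.1, hs.1.2⟩ hs.2
  have hsub : ∀ s ∈ {s | s ∈ Ioo t b ∧ ContinuousAt g s}, s ∈ Icc a b := fun s hs =>
    ⟨ht.1.trans hs.1.1.le, hs.1.2.le⟩
  refine hasDerivWithinAt_Ici_of_tendsto_deriv
    (fun s hs => (hd s hs).differentiableAt.differentiableWithinAt)
    ((hy.continuousOn t (Ico_subset_Icc_self ht)).mono hsub) hs ?_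
  have h1 : Tendsto (fun s => (y s, g s)) (𝓝[>] t) (𝓝[D ×ˢ C] (y t, l)) := by
    refine tendsto_nhdsWithin_iff.2 ⟨Tendsto.prodMk_nhds ?_ hl, ?_⟩
    · exact (hy.continuousOn t (Ico_subset_Icc_self ht)).mono_of_mem_nhdsWithin
        (mem_of_superset (Ioo_mem_nhdsGT ht.2) fun s hs => ⟨ht.1.trans hs.1.le, hs.2.le⟩)
    · filter_upwards [Ioo_mem_nhdsGT ht.2] with s hs
      exact ⟨hD ⟨ht.1.trans hs.1.le, hs.2.le⟩, hg.mem s ⟨ht.1.trans_lt hs.1, hs.2⟩⟩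
  refine (Tendsto.comp (hf (y t, l) ⟨hD (Ico_subset_Icc_self ht), hlC⟩) h1).congr' ?_
  filter_upwards [hs] with s hs
  exact (hd s hs).deriv.symm

theorem hasDerivWithinAt_Iic (hy : IsSol f g y a b) (hg : PiecewiseContinuousOn C g a b)
    (hf : ContinuousOn (fun p : E × G => f p.1 p.2) (D ×ˢ C)) (hD : MapsTo y (Icc a b) D)
    (ht : t ∈ Ioc a b) {l : G} (hl : Tendsto g (𝓝[<] t) (𝓝 l)) (hlC : l ∈ C) :
    HasDerivWithinAt y (f (y t) l) (Iic t) t := by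
  have hs : {s | s ∈ Ioo a t ∧ ContinuousAt g s} ∈ 𝓝[<] t :=
    inter_mem (Ioo_mem_nhdsLT ht.1) (hg.left t ht).2
  have hd : ∀ s ∈ {s | s ∈ Ioo a t ∧ ContinuousAt g s}, HasDerivAt y (f (y s) (g s)) s :=
    fun s hs => hy.hasDerivAt s ⟨hs.1.1, hs.1.2.trans_le ht.2⟩ hs.2
  have hsub : ∀ s ∈ {s | s ∈ Ioo a t ∧ ContinuousAt g s}, s ∈ Icc a b := fun s hs =>
    ⟨hs.1.1.le, hs.1.2.le.trans ht.2⟩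
  refine hasDerivWithinAt_Iic_of_tendsto_deriv
    (fun s hs => (hd s hs).differentiableAt.differentiableWithinAt)
    ((hy.continuousOn t (Ioc_subset_Icc_self ht)).mono hsub) hs ?_
  have h1 : Tendsto (fun s => (y s, g s)) (𝓝[<] t) (𝓝[D ×ˢ C] (y t, l)) := by
    refine tendsto_nhdsWithin_iff.2 ⟨Tendsto.prodMk_nhds ?_ hl, ?_⟩
    · exact (hy.continuousOn t (Ioc_subset_Icc_self ht)).mono_of_mem_nhdsWithin
        (mem_of_superset (Ioo_mem_nhdsLT ht.1) fun s hs => ⟨hs.1.le, hs.2.le.trans ht.2⟩)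
    · filter_upwards [Ioo_mem_nhdsLT ht.1] with s hs
      exact ⟨hD ⟨hs.1.le, hs.2.le.trans ht.2⟩, hg.mem s ⟨hs.1, hs.2.trans_le ht.2⟩⟩
  refine (Tendsto.comp (hf (y t, l) ⟨hD (Ioc_subset_Icc_self ht), hlC⟩) h1).congr' ?_
  filter_upwards [hs] with s hs
  exact (hd s hs).deriv.symm

/-- With `Function.rightLim g` in place of `g` the equation holds at every time, as an equation for
right derivatives. This is the form in which mean value, Gronwall and uniqueness theorems are
applied, without a case distinction at the discontinuities of `g`. -/
theorem hasDerivWithinAt_rightLim [T2Space G] (hy : IsSol f g y a b)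
    (hg : PiecewiseContinuousOn C g a b)
    (hf : ContinuousOn (fun p : E × G => f p.1 p.2) (D ×ˢ C)) (hD : MapsTo y (Icc a b) D)
    (ht : t ∈ Ico a b) :
    HasDerivWithinAt y (f (y t) (Function.rightLim g t)) (Ici t) t :=
  hy.hasDerivWithinAt_Ici hg hf hD ht (hg.tendsto_rightLim ht).1 (hg.tendsto_rightLim ht).2

/-- Solutions on adjacent intervals can be joined. -/
theorem glue [T2Space G] (hy : IsSol f g y a b) (hz : IsSol f g z b c) (hab : a < b) (hbc : b < c)
    (hyz : y b = z b)
    (hg : PiecewiseContinuousOn C g a c)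
    (hf : ContinuousOn (fun p : E × G => f p.1 p.2) (D ×ˢ C)) (hyD : MapsTo y (Icc a b) D)
    (hzD : MapsTo z (Icc b c) D) :
    IsSol f g (fun t => if t ≤ b then y t else z t) a c := by
  have h1 : EqOn y (fun t => if t ≤ b then y t else z t) (Iic b) := fun t ht => (if_pos ht).symm
  have h2 : EqOn z (fun t => if t ≤ b then y t else z t) (Ici b) := fun t ht => by
    rcases (mem_Ici.1 ht).eq_or_lt with rfl | h
    · simp [hyz]
    · simp [not_le.2 h]
  constructor
  · rw [← Icc_union_Icc_eq_Icc hab.le hbc.le]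
    exact (hy.continuousOn.congr (h1.mono Icc_subset_Iic_self).symm).union_of_isClosed
      (hz.continuousOn.congr (h2.mono Icc_subset_Ici_self).symm) isClosed_Icc isClosed_Icc
  · intro t ht hgt
    rcases lt_trichotomy t b with h | rfl | h
    · rw [if_pos h.le]
      exact (hy.hasDerivAt t ⟨ht.1, h⟩ hgt).congr_of_eventuallyEq
        (mem_of_superset (Iic_mem_nhds h) h1.symm)
    -- At the joint there is something to prove only if `g` is continuous; then both one-sided
    -- limits of `g` are `g t`, and the two one-sided derivatives agree.
    · have hgC : g t ∈ C := hg.mem t ht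
      have hl := (hy.hasDerivWithinAt_Iic (hg.mono le_rfl hbc.le) hf hyD ⟨hab, le_rfl⟩
        (hgt.tendsto.mono_left nhdsWithin_le_nhds) hgC).congr h1.symm (h1 self_mem_Iic).symm
      have hr := (hz.hasDerivWithinAt_Ici (hg.mono hab.le le_rfl) hf hzD ⟨le_rfl, hbc⟩
        (hgt.tendsto.mono_left nhdsWithin_le_nhds) hgC).congr h2.symm (h2 self_mem_Ici).symm
      rw [← hyz] at hr
      have := hl.union hr
      rw [Iic_union_Ici, hasDerivWithinAt_univ] at this
      simpa using this
    · rw [if_neg (not_le.2 h)]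
      exact (hz.hasDerivAt t ⟨h, ht.2⟩ hgt).congr_of_eventuallyEq
        (mem_of_superset (Ici_mem_nhds h) h2.symm)

end IsSol

/-- Local existence for globally Lipschitz equations with continuous inputs, on intervals the
length of which does not depend on the initial value. -/
theorem exists_hasDerivWithinAt_of_lipschitzWith [CompleteSpace E] {K B : NNReal}
    (hf : ContinuousOn (fun p : E × G => f p.1 p.2) (univ ×ˢ C))
    (hK : ∀ c ∈ C, LipschitzWith K (f · c)) (hB : ∀ c ∈ C, ‖f 0 c‖ ≤ B)
    (hg : ContinuousOn g (Icc a b)) (hgC : MapsTo g (Icc a b) C)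
    (hab : (b - a) * (B + 2 * K + 1) ≤ 1) {t₀ : ℝ} (ht₀ : t₀ ∈ Icc a b) (y₀ : E) :
    ∃ y : ℝ → E, y t₀ = y₀ ∧ ∀ t ∈ Icc a b, HasDerivWithinAt y (f (y t) (g t)) (Icc a b) t := by
  -- On the ball of radius `‖y₀‖ + 1` about `y₀` the field is bounded by `B + K (2‖y₀‖ + 1)`, which
  -- is at most `(B + 2K + 1)(‖y₀‖ + 1)`. The ratio of radius to bound is therefore bounded below
  -- independently of `y₀`.
  have hP : IsPicardLindelof (fun t y => f y (g t)) (⟨t₀, ht₀⟩ : Icc a b) y₀ (‖y₀‖₊ + 1) 0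
      (B + K * (2 * ‖y₀‖₊ + 1)) K := by
    refine ⟨fun t ht => (hK _ (hgC ht)).lipschitzOnWith, fun x _ => ?_, fun t ht x hx => ?_, ?_⟩
    · exact hf.comp (continuousOn_const.prodMk hg) fun t ht => ⟨trivial, hgC ht⟩
    · have h1 : ‖f x (g t)‖ ≤ ‖f 0 (g t)‖ + K * ‖x‖ := by
        have := (hK _ (hgC ht)).dist_le_mul x 0
        rw [dist_zero_right, dist_eq_norm] at this
        linarith [norm_le_insert' (f x (g t)) (f 0 (g t))]
      have h2 : ‖x‖ ≤ 2 * ‖y₀‖ + 1 := by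
        rw [mem_closedBall_iff_norm] at hx
        push_cast at hx
        linarith [norm_le_insert' x y₀]
      push_cast
      have := mul_le_mul_of_nonneg_left h2 K.coe_nonneg
      linarith [hB _ (hgC ht)]
    · have h1 : max (b - t₀) (t₀ - a) ≤ b - a := max_le (by linarith [ht₀.1]) (by linarith [ht₀.2])
      push_cast
      have hKK := K.coe_nonneg
      have hBB := B.coe_nonneg
      have hy := norm_nonneg y₀
      have h0 : 0 ≤ b - a := by linarith [ht₀.1, ht₀.2]
      calc _ ≤ ((B : ℝ) + K * (2 * ‖y₀‖ + 1)) * (b - a) := by gcongr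
        _ ≤ ((B + 2 * K + 1) * (‖y₀‖ + 1)) * (b - a) := by
          gcongr
          nlinarith [mul_nonneg hBB hy]
        _ = ((b - a) * (B + 2 * K + 1)) * (‖y₀‖ + 1) := by ring
        _ ≤ 1 * (‖y₀‖ + 1) := by gcongr
        _ = _ := by simp
  obtain ⟨y, hy, hy'⟩ := hP.exists_eq_forall_mem_Icc_hasDerivWithinAt₀
  exact ⟨y, hy, hy'⟩

/-- Global existence for globally Lipschitz equations with piecewise continuous inputs. -/
theorem exists_isSol_of_lipschitzWith [CompleteSpace E] [T2Space G] {K B : NNReal}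
    (hf : ContinuousOn (fun p : E × G => f p.1 p.2) (univ ×ˢ C))
    (hK : ∀ c ∈ C, LipschitzWith K (f · c)) (hB : ∀ c ∈ C, ‖f 0 c‖ ≤ B)
    (hg : PiecewiseContinuousOn C g a b) (hab : a < b) {t₀ : ℝ} (ht₀ : t₀ ∈ Icc a b) (y₀ : E) :
    ∃ y : ℝ → E, y t₀ = y₀ ∧ IsSol f g y a b := by
  classical
  have hδ : 0 < 1 / ((B : ℝ) + 2 * K + 1) := by positivity
  have hlen : ∀ s t : ℝ, t - s < 1 / ((B : ℝ) + 2 * K + 1) → (t - s) * (B + 2 * K + 1) ≤ 1 :=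
    fun s t h => ((lt_div_iff₀ (by positivity)).1 h).le
  have piece : ∀ (s t : ℝ) (ĝ : ℝ → G), EqOn ĝ g (Ioo s t) → ContinuousOn ĝ (Icc s t) →
      MapsTo ĝ (Icc s t) C → t - s < 1 / ((B : ℝ) + 2 * K + 1) →
      ∀ t₀ ∈ Icc s t, ∀ y₀, ∃ y : ℝ → E, y t₀ = y₀ ∧ IsSol f g y s t := by
    intro s t ĝ h1 h2 h3 h4 t₀ ht₀ y₀
    obtain ⟨y, hy, hy'⟩ :=
      exists_hasDerivWithinAt_of_lipschitzWith hf hK hB h2 h3 (hlen s t h4) ht₀ y₀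
    refine ⟨y, hy, fun r hr => (hy' r hr).continuousWithinAt, fun r hr _ => ?_⟩
    rw [← h1 hr]
    exact (hy' r (Ioo_subset_Icc_self hr)).hasDerivAt (Icc_mem_nhds hr.1 hr.2)
  -- Admitting every initial time in the interval, not only an end point, makes the relation
  -- transitive: solve first on the part that contains `t₀`, then on the other part from the joint.
  refine rel_of_local_of_trans
    (R := fun s t => ∀ t₀ ∈ Icc s t, ∀ y₀, ∃ y : ℝ → E, y t₀ = y₀ ∧ IsSol f g y s t)
    hab ?_ ?_ ?_ t₀ ht₀ y₀
  · intro r s t har hrs hst htb h1 h2 t₀ ht₀ y₀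
    rcases le_total t₀ s with h | h
    · obtain ⟨y, hy, hys⟩ := h1 t₀ ⟨ht₀.1, h⟩ y₀
      obtain ⟨z, hz, hzs⟩ := h2 s ⟨le_rfl, hst.le⟩ (y s)
      exact ⟨_, by rw [if_pos h, hy], hys.glue hzs hrs hst hz.symm (hg.mono har htb) hf
        (mapsTo_univ _ _) (mapsTo_univ _ _)⟩
    · obtain ⟨z, hz, hzs⟩ := h2 t₀ ⟨h, ht₀.2⟩ y₀
      obtain ⟨y, hy, hys⟩ := h1 s ⟨hrs.le, le_rfl⟩ (z s)
      refine ⟨_, ?_, hys.glue hzs hrs hst hy (hg.mono har htb) hf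
        (mapsTo_univ _ _) (mapsTo_univ _ _)⟩
      rcases h.eq_or_lt with rfl | h
      · simp [hy, hz]
      · simp [not_le.2 h, hz]
  · intro s hs
    obtain ⟨⟨l, hl, hl'⟩, hc⟩ := hg.right s hs
    obtain ⟨d, hd, hd'⟩ := mem_nhdsGT_iff_exists_Ioo_subset.1 hc
    have hsδ : s < s + 1 / ((B : ℝ) + 2 * K + 1) := by linarith
    filter_upwards [Ioo_mem_nhdsGT hs.2, Ioo_mem_nhdsGT hd, Ioo_mem_nhdsGT hsδ] with t ht1 ht2 ht3
    -- Replacing the value at the end point by the one-sided limit makes the signal continuous on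
    -- the closed interval and leaves the equation inside unchanged.
    refine piece s t (Function.update g s l)
      (fun r hr => Function.update_of_ne hr.1.ne' _ _) ?_ ?_ (by linarith [ht3.2])
    · refine continuousOn_update_iff.2 ⟨fun r hr => ?_, fun _ => hl'.mono_left ?_⟩
      · exact (hd' ⟨lt_of_le_of_ne hr.1.1 (Ne.symm hr.2),
          hr.1.2.trans_lt ht2.2⟩).continuousWithinAt
      · exact nhdsWithin_mono _ fun r hr => lt_of_le_of_ne hr.1.1 (Ne.symm hr.2)
    · intro r hr
      rcases hr.1.eq_or_lt with rfl | h
      · simpa using hl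
      · rw [Function.update_of_ne h.ne']
        exact hg.mem r ⟨hs.1.trans_lt h, hr.2.trans_lt ht1.2⟩
  · intro t ht
    obtain ⟨⟨l, hl, hl'⟩, hc⟩ := hg.left t ht
    obtain ⟨d, hd, hd'⟩ := mem_nhdsLT_iff_exists_Ioo_subset.1 hc
    have htδ : t - 1 / ((B : ℝ) + 2 * K + 1) < t := by linarith
    filter_upwards [Ioo_mem_nhdsLT ht.1, Ioo_mem_nhdsLT hd, Ioo_mem_nhdsLT htδ] with s hs1 hs2 hs3
    refine piece s t (Function.update g t l)
      (fun r hr => Function.update_of_ne hr.2.ne _ _) ?_ ?_ (by linarith [hs3.1])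
    · refine continuousOn_update_iff.2 ⟨fun r hr => ?_, fun _ => hl'.mono_left ?_⟩
      · exact (hd' ⟨hs2.1.trans_le hr.1.1, lt_of_le_of_ne hr.1.2 hr.2⟩).continuousWithinAt
      · exact nhdsWithin_mono _ fun r hr => lt_of_le_of_ne hr.1.2 hr.2
    · intro r hr
      rcases hr.2.eq_or_lt with rfl | h
      · simpa using hl
      · rw [Function.update_of_ne h.ne]
        exact hg.mem r ⟨hs1.1.trans_le hr.1, h.trans_le ht.2⟩

/-- A solution with derivative close to a constant vector is close to an affine curve. -/
theorem IsSol.norm_sub_sub_smul_le [T2Space G] (hy : IsSol f g y a b)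
    (hg : PiecewiseContinuousOn C g a b)
    (hf : ContinuousOn (fun p : E × G => f p.1 p.2) (D ×ˢ C)) (hD : MapsTo y (Icc a b) D)
    (hab : a ≤ b) {v : E} {κ : ℝ}
    (h : ∀ t ∈ Ico a b, ‖f (y t) (Function.rightLim g t) - v‖ ≤ κ) :
    ‖y b - y a - (b - a) • v‖ ≤ κ * (b - a) := by
  have h1 := norm_image_sub_le_of_norm_deriv_right_le_segment (f := fun t => y t - (t - a) • v)
    (f' := fun t => f (y t) (Function.rightLim g t) - v) (a := a) (b := b) (C := κ)
    (hy.continuousOn.sub (by fun_prop)) (fun t ht => ?_) h b ⟨hab, le_rfl⟩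
  · simpa [sub_right_comm] using h1
  · refine (hy.hasDerivWithinAt_rightLim hg hf hD ht).fun_sub ?_
    simpa using (((hasDerivAt_id t).sub_const a).smul_const v).hasDerivWithinAt

/-! ### Piecewise continuous signals -/

section Signal

variable {F : Type*} [TopologicalSpace F] {U : Set F} {u : ℝ → F}

/-- On a bounded interval, a piecewise continuous signal stays in a compact set. -/
theorem IsPiecewiseContinuousInto.exists_isCompact_forall_mem
    (hu : IsPiecewiseContinuousInto U u) (a b : ℝ) :
    ∃ C ⊆ U, IsCompact C ∧ ∀ t ∈ Icc a b, u t ∈ C := by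
  classical
  -- The claim is local. Near `s` the values lie in the images of two compact intervals under the
  -- signal completed by its one-sided limits, together with the value `u s`.
  refine isCompact_Icc.induction_on (p := fun S => ∃ C ⊆ U, IsCompact C ∧ ∀ t ∈ S, u t ∈ C)
    ⟨∅, empty_subset _, isCompact_empty, by simp⟩ ?_ ?_ ?_
  · rintro S T hST ⟨C, hCU, hC, h⟩
    exact ⟨C, hCU, hC, fun t ht => h t (hST ht)⟩
  · rintro S T ⟨C, hCU, hC, h⟩ ⟨C', hCU', hC', h'⟩
    exact ⟨C ∪ C', union_subset hCU hCU', hC.union hC',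
      fun t ht => ht.imp (h t) (h' t)⟩
  · intro s _
    obtain ⟨hs, ⟨l, hl, hl'⟩, ⟨r, hr, hr'⟩, hc⟩ := hu s
    rw [← nhdsLT_sup_nhdsGT, eventually_sup] at hc
    obtain ⟨c, hcs, hc1⟩ := mem_nhdsLT_iff_exists_Ioo_subset.1 hc.1
    obtain ⟨d, hsd, hd1⟩ := mem_nhdsGT_iff_exists_Ioo_subset.1 hc.2
    obtain ⟨c', hc'⟩ := exists_between (mem_Iio.1 hcs)
    obtain ⟨d', hd'⟩ := exists_between (mem_Ioi.1 hsd)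
    have hL : ContinuousOn (Function.update u s l) (Icc c' s) := by
      refine continuousOn_update_iff.2 ⟨fun t ht => ?_, fun _ => hl'.mono_left ?_⟩
      · exact (hc1 ⟨hc'.1.trans_le ht.1.1, lt_of_le_of_ne ht.1.2 ht.2⟩).continuousWithinAt
      · exact nhdsWithin_mono _ fun t ht => lt_of_le_of_ne ht.1.2 ht.2
    have hR : ContinuousOn (Function.update u s r) (Icc s d') := by
      refine continuousOn_update_iff.2 ⟨fun t ht => ?_, fun _ => hr'.mono_left ?_⟩
      · exact (hd1 ⟨lt_of_le_of_ne ht.1.1 (Ne.symm ht.2),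
          ht.1.2.trans_lt hd'.2⟩).continuousWithinAt
      · exact nhdsWithin_mono _ fun t ht => lt_of_le_of_ne ht.1.1 (Ne.symm ht.2)
    have hU : ∀ v ∈ U, ∀ S, Function.update u s v '' S ⊆ U := by
      rintro v hv S _ ⟨t, -, rfl⟩
      rcases eq_or_ne t s with rfl | h
      · simpa using hv
      · simpa [h] using (hu t).1
    refine ⟨Icc c' d', mem_nhdsWithin_of_mem_nhds (Icc_mem_nhds hc'.2 hd'.1),
      Function.update u s l '' Icc c' s ∪ {u s} ∪ Function.update u s r '' Icc s d',
      union_subset (union_subset (hU l hl _) (singleton_subset_iff.2 hs)) (hU r hr _),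
      ((isCompact_Icc.image_of_continuousOn hL).union isCompact_singleton).union
        (isCompact_Icc.image_of_continuousOn hR), fun t ht => ?_⟩
    rcases lt_trichotomy t s with h | rfl | h
    · exact Or.inl (Or.inl ⟨t, ⟨ht.1, h.le⟩, by simp [h.ne]⟩)
    · exact Or.inl (Or.inr rfl)
    · exact Or.inr ⟨t, ⟨h.le, ht.2⟩, by simp [h.ne']⟩

theorem IsPiecewiseContinuousInto.exists_isCompact [T2Space F]
    (hu : IsPiecewiseContinuousInto U u) (a b : ℝ) :
    ∃ C ⊆ U, IsCompact C ∧ (∀ t ∈ Icc a b, u t ∈ C) ∧ PiecewiseContinuousOn C u a b := by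
  -- The margin of length one puts all nearby values in `C`, so that the one-sided limits, also at
  -- `a` and `b`, lie in `C` because it is closed.
  obtain ⟨C, hCU, hC, h⟩ := hu.exists_isCompact_forall_mem (a - 1) (b + 1)
  have h' : ∀ t ∈ Icc a b, ∀ᶠ s in 𝓝 t, u s ∈ C := fun t ht => by
    filter_upwards [Ioo_mem_nhds (show a - 1 < t by linarith [ht.1])
      (show t < b + 1 by linarith [ht.2])] with s hs
    exact h s (Ioo_subset_Icc_self hs)
  refine ⟨C, hCU, hC, fun t ht => (h' t ht).self_of_nhds,
    fun t ht => (h' t (Ioo_subset_Icc_self ht)).self_of_nhds, fun t ht => ?_, fun t ht => ?_⟩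
  all_goals
    obtain ⟨-, ⟨l, -, hl'⟩, ⟨r, -, hr'⟩, hc⟩ := hu t
    rw [← nhdsLT_sup_nhdsGT, eventually_sup] at hc
  · exact ⟨⟨r, hC.isClosed.mem_of_tendsto hr'
      ((h' t (Ico_subset_Icc_self ht)).filter_mono nhdsWithin_le_nhds), hr'⟩, hc.2⟩
  · exact ⟨⟨l, hC.isClosed.mem_of_tendsto hl'
      ((h' t (Ioc_subset_Icc_self ht)).filter_mono nhdsWithin_le_nhds), hl'⟩, hc.1⟩

theorem IsPiecewiseContinuousInto.piecewiseContinuousOn [T2Space F]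
    (hu : IsPiecewiseContinuousInto U u) (a b : ℝ) : PiecewiseContinuousOn U u a b :=
  let ⟨_, hCU, _, _, h⟩ := hu.exists_isCompact a b
  h.mono_set hCU

open Classical in
/-- Replacing a piecewise continuous signal by a constant on an interval leaves it
piecewise continuous. -/
theorem IsPiecewiseContinuousInto.ite_mem_Icc (hu : IsPiecewiseContinuousInto U u) {w : F}
    (hw : w ∈ U) (α β : ℝ) :
    IsPiecewiseContinuousInto U (fun t => if t ∈ Icc α β then w else u t) := by
  -- On each side of a time one is eventually inside the open interval or outside the closed one, so
  -- each one-sided property reduces to the constant `w` or to `u`.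
  have key : ∀ l : Filter ℝ, (∀ᶠ t in l, t ∈ interior (Icc α β)) ∨ (∀ᶠ t in l, t ∈ (Icc α β)ᶜ) →
      ((∃ v ∈ U, Tendsto u l (𝓝 v)) →
        ∃ v ∈ U, Tendsto (fun t => if t ∈ Icc α β then w else u t) l (𝓝 v)) ∧
      ((∀ᶠ t in l, ContinuousAt u t) →
        ∀ᶠ t in l, ContinuousAt (fun t => if t ∈ Icc α β then w else u t) t) := by
    rintro l (h | h)
    · refine ⟨fun _ => ⟨w, hw, tendsto_const_nhds.congr' ?_⟩, fun _ => ?_⟩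
      · filter_upwards [h] with t ht
        rw [if_pos (interior_subset ht)]
      · filter_upwards [h] with t ht
        refine ContinuousAt.congr (f := fun _ => w) continuousAt_const ?_
        filter_upwards [mem_interior_iff_mem_nhds.1 ht] with s hs
        rw [if_pos hs]
    · refine ⟨fun ⟨v, hv, hv'⟩ => ⟨v, hv, hv'.congr' ?_⟩, fun h' => ?_⟩
      · filter_upwards [h] with t ht
        rw [if_neg ht]
      · filter_upwards [h, h'] with t ht ht'
        refine ht'.congr ?_
        filter_upwards [isClosed_Icc.isOpen_compl.mem_nhds ht] with s hs
        rw [if_neg hs]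
  intro s
  have hL : (∀ᶠ t in 𝓝[<] s, t ∈ interior (Icc α β)) ∨ (∀ᶠ t in 𝓝[<] s, t ∈ (Icc α β)ᶜ) := by
    rw [interior_Icc]
    rcases le_or_gt s α with h | h
    · right
      filter_upwards [self_mem_nhdsWithin] with t ht ht'
      exact absurd (ht'.1.trans_lt ht) (not_lt.2 h)
    rcases le_or_gt s β with h' | h'
    · left
      filter_upwards [Ioo_mem_nhdsLT h] with t ht using ⟨ht.1, ht.2.trans_le h'⟩
    · right
      filter_upwards [Ioo_mem_nhdsLT h'] with t ht ht' using absurd ht'.2 (not_le.2 ht.1)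
  have hR : (∀ᶠ t in 𝓝[>] s, t ∈ interior (Icc α β)) ∨ (∀ᶠ t in 𝓝[>] s, t ∈ (Icc α β)ᶜ) := by
    rw [interior_Icc]
    rcases le_or_gt β s with h | h
    · right
      filter_upwards [self_mem_nhdsWithin] with t ht ht'
      exact absurd ht'.2 (not_le.2 (h.trans_lt ht))
    rcases le_or_gt α s with h' | h'
    · left
      filter_upwards [Ioo_mem_nhdsGT h] with t ht using ⟨h'.trans_lt ht.1, ht.2⟩
    · right
      filter_upwards [Ioo_mem_nhdsGT h'] with t ht ht' using absurd ht'.1 (not_le.2 ht.2)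
  obtain ⟨hs, hl, hr, hc⟩ := hu s
  rw [← nhdsLT_sup_nhdsGT, eventually_sup] at hc ⊢
  refine ⟨?_, (key _ hL).1 hl, (key _ hR).1 hr, (key _ hL).2 hc.1, (key _ hR).2 hc.2⟩
  beta_reduce
  split_ifs
  exacts [hw, hs]

theorem isPiecewiseContinuousInto_const {w : F} (hw : w ∈ U) :
    IsPiecewiseContinuousInto U (fun _ => w) := fun _ =>
  ⟨hw, ⟨w, hw, tendsto_const_nhds⟩, ⟨w, hw, tendsto_const_nhds⟩,
    Eventually.of_forall fun _ => continuousAt_const⟩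

end Signal

end ODE

/-! ### Tangent cones and retractions of embedded submanifolds -/

section Submanifold

variable {E : Type*} [NormedAddCommGroup E] [NormedSpace ℝ E] {M : Set E} {x : E}
  {E' : Type*} [NormedAddCommGroup E'] [NormedSpace ℝ E']

/-- Two derivatives within a set agree on the tangent cone. -/
theorem HasFDerivWithinAt.eqOn_tangentConeAt {f : E → E'} {f₁ f₂ : E →L[ℝ] E'}
    (h₁ : HasFDerivWithinAt f f₁ M x) (h₂ : HasFDerivWithinAt f f₂ M x) :
    EqOn f₁ f₂ (tangentConeAt ℝ M x) := by
  intro v hv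
  obtain ⟨α, l, hl, c, d, hd, hdM, hcd⟩ := exists_fun_of_mem_tangentConeAt hv
  exact tendsto_nhds_unique (h₁.lim hd hdM hcd) (h₂.lim hd hdM hcd)

/-- The tangent vectors of a closed linear subspace belong to the subspace. -/
theorem Submodule.tangentConeAt_subset {V : Submodule ℝ E} (hV : IsClosed (V : Set E))
    (hx : x ∈ V) : tangentConeAt ℝ (V : Set E) x ⊆ V := by
  intro v hv
  obtain ⟨α, l, hl, c, d, hd, hdM, hcd⟩ := exists_fun_of_mem_tangentConeAt hv
  refine hV.mem_of_tendsto hcd (hdM.mono fun n hn => V.smul_mem _ ?_)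
  simpa using V.sub_mem hn hx

variable [FiniteDimensional ℝ E]

/-- A chart describes the tangent spaces. -/
theorem tangentConeAt_eq_preimage_of_chart (φ : OpenPartialHomeomorph E E) (V : Submodule ℝ E)
    (hφ : ContDiffOn ℝ 2 φ φ.source) (hφ' : ContDiffOn ℝ 2 φ.symm φ.target)
    (hφM : ∀ y ∈ φ.source, (y ∈ M ↔ φ y ∈ V)) (hx : x ∈ φ.source) (hxM : x ∈ M) :
    tangentConeAt ℝ M x = fderiv ℝ φ x ⁻¹' V := by
  have hV : IsClosed (V : Set E) := V.closed_of_finiteDimensional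
  have hs := φ.open_source.mem_nhds hx
  have hd : HasFDerivAt φ (fderiv ℝ φ x) x :=
    ((hφ.contDiffAt hs).differentiableAt two_ne_zero).hasFDerivAt
  have ht := φ.open_target.mem_nhds (φ.map_source hx)
  have hd' : HasFDerivAt φ.symm (fderiv ℝ φ.symm (φ x)) (φ x) :=
    ((hφ'.contDiffAt ht).differentiableAt two_ne_zero).hasFDerivAt
  have hinv : (fderiv ℝ φ.symm (φ x)).comp (fderiv ℝ φ x) = ContinuousLinearMap.id ℝ E := by
    refine (hd'.comp x hd).unique ((hasFDerivAt_id x).congr_of_eventuallyEq ?_)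
    filter_upwards [hs] with y hy using φ.left_inv hy
  refine Subset.antisymm (fun v hv => ?_) fun v hv => ?_
  · rw [← tangentConeAt_inter_nhds hs] at hv
    refine Submodule.tangentConeAt_subset hV ((hφM x hx).1 hxM)
      (tangentConeAt_mono ?_ ((hd.hasFDerivWithinAt (s := M ∩ φ.source)).mapsTo_tangent_cone hv))
    rintro _ ⟨y, hy, rfl⟩
    exact (hφM y hy.2).1 hy.1
  -- The image vector is tangent to `V` because the line through `φ x` in its direction lies in `V`;
  -- the differential of `φ.symm` carries it back to `v`.
  · have h1 : fderiv ℝ φ x v ∈ tangentConeAt ℝ ((V : Set E) ∩ φ.target) (φ x) := by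
      rw [tangentConeAt_inter_nhds ht]
      refine mem_tangentConeAt_of_add_smul_mem (l := 𝓝[≠] (0 : ℝ)) tendsto_id
        (Eventually.of_forall fun c => ?_)
      exact V.add_mem ((hφM x hx).1 hxM) (V.smul_mem _ hv)
    have h2 := (hd'.hasFDerivWithinAt (s := (V : Set E) ∩ φ.target)).mapsTo_tangent_cone h1
    rw [φ.left_inv hx, ← ContinuousLinearMap.comp_apply, hinv] at h2
    refine tangentConeAt_mono ?_ h2
    rintro _ ⟨y, hy, rfl⟩
    rw [hφM _ (φ.map_target hy.2), φ.right_inv hy.2]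
    exact hy.1

/-- The tangent cones of an embedded submanifold are linear subspaces. -/
theorem IsEmbeddedSubmanifold.exists_submodule_eq_tangentConeAt (hM : IsEmbeddedSubmanifold M)
    (hx : x ∈ M) : ∃ T : Submodule ℝ E, (T : Set E) = tangentConeAt ℝ M x := by
  obtain ⟨φ, V, hxs, hφ, hφ', hφM⟩ := hM x hx
  exact ⟨V.comap (fderiv ℝ φ x).toLinearMap,
    (tangentConeAt_eq_preimage_of_chart φ V hφ hφ' hφM hxs hx).symm⟩

/-- A linear subspace of a finite-dimensional space is the range of a continuous projection. -/
theorem Submodule.exists_projection (V : Submodule ℝ E) :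
    ∃ P : E →L[ℝ] E, (∀ v, P v ∈ V) ∧ ∀ v ∈ V, P v = v := by
  obtain ⟨p, hp⟩ := V.exists_isCompl
  let P : E →ₗ[ℝ] E := V.subtype ∘ₗ V.projectionOnto p hp
  refine ⟨LinearMap.toContinuousLinearMap P, fun v => by simp [P], fun v hv => ?_⟩
  simpa [P] using congrArg Subtype.val (V.projectionOnto_apply_left hp ⟨v, hv⟩)

/-- Near each of its points, an embedded submanifold is a `C¹` retract. -/
theorem IsEmbeddedSubmanifold.exists_retraction (hM : IsEmbeddedSubmanifold M) (hx : x ∈ M) :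
    ∃ (W : Set E) (ρ : E → E), IsOpen W ∧ x ∈ W ∧ ContDiffOn ℝ 1 ρ W ∧ MapsTo ρ W M ∧
      ∀ y ∈ W, (y ∈ M ↔ ρ y = y) := by
  obtain ⟨φ, V, hxs, hφ, hφ', hφM⟩ := hM x hx
  obtain ⟨P, hPV, hP⟩ := V.exists_projection
  -- In the chart the retraction is the linear projection `P` onto `V`. The domain has to ensure
  -- that `P (φ y)` is still in the target of the chart.
  have hW : IsOpen (φ.source ∩ (P ∘ φ) ⁻¹' φ.target) :=
    (P.continuous.comp_continuousOn φ.continuousOn).isOpen_inter_preimage φ.open_source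
      φ.open_target
  have hρM : ∀ y ∈ φ.source ∩ (P ∘ φ) ⁻¹' φ.target, φ.symm (P (φ y)) ∈ M := fun y hy => by
    have hy' : P (φ y) ∈ φ.target := hy.2
    rw [hφM _ (φ.map_target hy'), φ.right_inv hy']
    exact hPV _
  refine ⟨φ.source ∩ (P ∘ φ) ⁻¹' φ.target, fun y => φ.symm (P (φ y)), hW, ⟨hxs, ?_⟩, ?_, hρM,
    fun y hy => ⟨fun h => ?_, fun h => h ▸ hρM y hy⟩⟩
  · simpa [hP _ ((hφM x hxs).1 hx)] using φ.map_source hxs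
  · exact ((hφ'.of_le one_le_two).comp (P.contDiff.comp_contDiffOn
      ((hφ.of_le one_le_two).mono inter_subset_left)) fun y hy => hy.2)
  · simp only [hP _ ((hφM y hy.1).1 h), φ.left_inv hy.1]

end Submanifold

/-! ### Extension of control fields to the ambient space -/

section Extension

theorem continuousOn_of_eqOn_zero {E G Z : Type*} [TopologicalSpace E] [TopologicalSpace G]
    [TopologicalSpace Z] [Zero Z] {C : Set G} {S W : Set E}
    (hS : IsClosed S) (hW : IsOpen W) (hSW : S ⊆ W) {Φ : E × G → Z}
    (h : ContinuousOn Φ (W ×ˢ C)) (h0 : ∀ p ∈ Sᶜ ×ˢ C, Φ p = 0) :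
    ContinuousOn Φ (univ ×ˢ C) := by
  rintro ⟨y, c⟩ ⟨-, hc⟩
  by_cases hy : y ∈ W
  · refine (h (y, c) ⟨hy, hc⟩).mono_of_mem_nhdsWithin ?_
    rw [nhdsWithin_prod_eq, nhdsWithin_univ]
    exact prod_mem_prod (hW.mem_nhds hy) self_mem_nhdsWithin
  · have hy' : y ∈ Sᶜ := fun h => hy (hSW h)
    refine (continuousWithinAt_const (b := (0 : Z))).congr_of_eventuallyEq ?_ (h0 _ ⟨hy', hc⟩)
    have : Sᶜ ×ˢ C ∈ 𝓝[univ ×ˢ C] (y, c) := by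
      rw [nhdsWithin_prod_eq, nhdsWithin_univ]
      exact prod_mem_prod (hS.isOpen_compl.mem_nhds hy') self_mem_nhdsWithin
    exact mem_of_superset this h0

/-- Compact support in the state and compactness of the set of control values turn continuity into a
global bound; this makes the extended field bounded and globally Lipschitz. -/
theorem exists_norm_le_of_eqOn_zero {E G Z : Type*} [TopologicalSpace E]
    [TopologicalSpace G] [NormedAddCommGroup Z] {C : Set G} {S : Set E}
    (hS : IsCompact S) (hC : IsCompact C) {Φ : E → G → Z}
    (h : ContinuousOn (fun p : E × G => Φ p.1 p.2) (univ ×ˢ C))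
    (h0 : ∀ y ∉ S, ∀ c ∈ C, Φ y c = 0) :
    ∃ B : NNReal, ∀ c ∈ C, ∀ y, ‖Φ y c‖ ≤ B := by
  obtain ⟨B, hB⟩ := (hS.prod hC).exists_bound_of_continuousOn
    (h.mono (prod_mono (subset_univ _) Subset.rfl))
  refine ⟨B.toNNReal, fun c hc y => ?_⟩
  by_cases hy : y ∈ S
  · exact (hB (y, c) ⟨hy, hc⟩).trans (Real.le_coe_toNNReal B)
  · simp [h0 y hy c hc]

variable {E G : Type*} [NormedAddCommGroup E] [NormedSpace ℝ E] [NormedAddCommGroup G]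
  {M : Set E} {U C : Set G} {f : E → G → E}

/-- `f` is a control vector field on the embedded submanifold `M`, with control space `U`: it is
tangent to `M`, continuous, and continuously differentiable in the state. -/
structure IsControlField (M : Set E) (U : Set G) (f : E → G → E) : Prop where
  isSubmanifold : IsEmbeddedSubmanifold M
  tangent : ∀ x ∈ M, ∀ u ∈ U, f x u ∈ tangentConeAt ℝ M x
  continuousOn : ContinuousOn (fun p : E × G => f p.1 p.2) (M ×ˢ U)
  differentiable : ∃ f' : E × G → E →L[ℝ] E, ContinuousOn f' (M ×ˢ U) ∧
    ∀ x ∈ M, ∀ u ∈ U, HasFDerivWithinAt (fun y => f y u) (f' (x, u)) M x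

/-- `F` is a vector field on the ambient space, bounded and with bounded continuous derivative
`F'`, that agrees with `f` on `M ∩ N`, for controls in `C`. -/
structure IsExtension (M : Set E) (f : E → G → E) (C : Set G) (F : E → G → E)
    (F' : E → G → E →L[ℝ] E) (N : Set E) (B K : NNReal) : Prop where
  isOpen : IsOpen N
  eventually_notMem : ∀ z ∈ N, z ∉ M → ∀ᶠ y in 𝓝 z, y ∉ M
  eq : ∀ y ∈ M ∩ N, ∀ c ∈ C, F y c = f y c
  hasFDerivAt : ∀ c ∈ C, ∀ y, HasFDerivAt (F · c) (F' y c) y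
  continuousOn : ContinuousOn (fun p : E × G => F p.1 p.2) (univ ×ˢ C)
  continuousOn_fderiv : ContinuousOn (fun p : E × G => F' p.1 p.2) (univ ×ˢ C)
  norm_le : ∀ c ∈ C, ∀ y, ‖F y c‖ ≤ B
  norm_fderiv_le : ∀ c ∈ C, ∀ y, ‖F' y c‖ ≤ K

theorem IsExtension.lipschitzWith {F : E → G → E} {F' : E → G → E →L[ℝ] E} {N : Set E}
    {B K : NNReal} (h : IsExtension M f C F F' N B K) {c : G} (hc : c ∈ C) :
    LipschitzWith K (F · c) := by
  refine lipschitzWith_of_nnnorm_fderiv_le (𝕜 := ℝ)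
    (fun y => (h.hasFDerivAt c hc y).differentiableAt) fun y => ?_
  rw [(h.hasFDerivAt c hc y).fderiv]
  exact h.norm_fderiv_le c hc y

/-- Extending a control field from a submanifold with a local retraction and a cutoff function. -/
theorem IsControlField.exists_local_extension (hf : IsControlField M U f) (hCU : C ⊆ U)
    {W : Set E} {ρ : E → E} (hW : IsOpen W) (hρ : ContDiffOn ℝ 1 ρ W) (hρM : MapsTo ρ W M)
    {χ : E → ℝ} (hχ : ContDiff ℝ 1 χ) (hχW : tsupport χ ⊆ W) :
    ∃ F' : E → G → E →L[ℝ] E,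
      (∀ c ∈ C, ∀ y, HasFDerivAt (fun y => χ y • f (ρ y) c) (F' y c) y) ∧
      ContinuousOn (fun p : E × G => χ p.1 • f (ρ p.1) p.2) (univ ×ˢ C) ∧
      ContinuousOn (fun p : E × G => F' p.1 p.2) (univ ×ˢ C) ∧
      ∀ y ∉ tsupport χ, ∀ c ∈ C, F' y c = 0 := by
  obtain ⟨f', hf'c, hf'⟩ := hf.differentiable
  have hzero : ∀ y ∉ tsupport χ, χ =ᶠ[𝓝 y] 0 := fun y hy => notMem_tsupport_iff_eventuallyEq.1 hy
  have hzero' : ∀ y ∉ tsupport χ, fderiv ℝ χ y = 0 := fun y hy => by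
    rw [(hzero y hy).fderiv_eq]; simp
  have hmaps : MapsTo (fun p : E × G => (ρ p.1, p.2)) (W ×ˢ C) (M ×ˢ U) :=
    fun p hp => ⟨hρM hp.1, hCU hp.2⟩
  have hρc : ContinuousOn (fun p : E × G => (ρ p.1, p.2)) (W ×ˢ C) :=
    (hρ.continuousOn.comp continuousOn_fst fun p hp => hp.1).prodMk continuousOn_snd
  have hfρ : ContinuousOn (fun p : E × G => f (ρ p.1) p.2) (W ×ˢ C) :=
    hf.continuousOn.comp hρc hmaps
  have hχc : ContinuousOn (fun p : E × G => χ p.1) (W ×ˢ C) :=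
    (hχ.continuous.comp continuous_fst).continuousOn
  -- Product and chain rule inside `W`. Off the support of `χ`, where nothing is known about `ρ`,
  -- both terms vanish.
  refine ⟨fun y c => χ y • (f' (ρ y, c)).comp (fderiv ℝ ρ y)
    + (fderiv ℝ χ y).smulRight (f (ρ y) c), fun c hc y => ?_, ?_, ?_, fun y hy c _ => ?_⟩
  · by_cases hy : y ∈ W
    · have h1 : HasFDerivAt ρ (fderiv ℝ ρ y) y :=
        ((hρ.contDiffAt (hW.mem_nhds hy)).differentiableAt one_ne_zero).hasFDerivAt
      have h2 : HasFDerivAt (fun y => f (ρ y) c) ((f' (ρ y, c)).comp (fderiv ℝ ρ y)) y :=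
        (hf' (ρ y) (hρM hy) c (hCU hc)).comp_hasFDerivAt y h1
          (mem_of_superset (hW.mem_nhds hy) hρM)
      exact (hχ.differentiable one_ne_zero y).hasFDerivAt.fun_smul h2
    · have hy' : y ∉ tsupport χ := fun h => hy (hχW h)
      have : χ y • (f' (ρ y, c)).comp (fderiv ℝ ρ y)
          + (fderiv ℝ χ y).smulRight (f (ρ y) c) = 0 := by
        rw [(hzero y hy').self_of_nhds, hzero' y hy']; ext; simp
      beta_reduce
      rw [this]
      refine (hasFDerivAt_const (0 : E) y).congr_of_eventuallyEq ?_
      filter_upwards [hzero y hy'] with z hz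
      simp [hz]
  · exact continuousOn_of_eqOn_zero (isClosed_tsupport χ) hW hχW (hχc.smul hfρ)
      fun p hp => by simp [(hzero p.1 hp.1).self_of_nhds]
  · refine continuousOn_of_eqOn_zero (isClosed_tsupport χ) hW hχW ?_ fun p hp => ?_
    · have h1 : ContinuousOn (fun p : E × G => fderiv ℝ ρ p.1) (W ×ˢ C) :=
        (hρ.continuousOn_fderiv_of_isOpen hW le_rfl).comp continuousOn_fst fun p hp => hp.1
      have h2 : ContinuousOn (fun p : E × G => fderiv ℝ χ p.1) (W ×ˢ C) :=
        ((hχ.continuous_fderiv one_ne_zero).comp continuous_fst).continuousOn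
      refine (hχc.smul ((hf'c.comp hρc hmaps).clm_comp h1)).add ?_
      exact ((ContinuousLinearMap.smulRightL ℝ E E).continuous₂.comp_continuousOn (h2.prodMk hfρ))
    · beta_reduce
      rw [(hzero p.1 hp.1).self_of_nhds, hzero' p.1 hp.1]; ext; simp
  · beta_reduce
    rw [(hzero y hy).self_of_nhds, hzero' y hy]; ext; simp

open scoped Manifold ContDiff in
/-- A control field on a submanifold can be extended from a neighbourhood of a compact subset. -/
theorem IsControlField.exists_isExtension [FiniteDimensional ℝ E] (hf : IsControlField M U f)
    {k : Set E} (hk : IsCompact k) (hkM : k ⊆ M) (hC : IsCompact C) (hCU : C ⊆ U) :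
    ∃ (F : E → G → E) (F' : E → G → E →L[ℝ] E) (N : Set E) (B K : NNReal),
      k ⊆ N ∧ IsExtension M f C F F' N B K := by
  classical
  choose! W ρ hW hxW hρ hρM hρ' using fun x (hx : x ∈ M) => hf.isSubmanifold.exists_retraction hx
  -- The unit balls make the supports of the cutoff functions bounded, hence compact.
  obtain ⟨t, htk, ht⟩ := hk.elim_nhds_subcover (fun x => W x ∩ Metric.ball x 1)
    fun x hx => ((hW x (hkM hx)).inter Metric.isOpen_ball).mem_nhds
      ⟨hxW x (hkM hx), Metric.mem_ball_self one_pos⟩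
  have htM : ∀ i : t, (i : E) ∈ M := fun i => hkM (htk i i.2)
  have hWi : ∀ i : t, IsOpen (W i ∩ Metric.ball (i : E) 1) := fun i =>
    (hW i (htM i)).inter Metric.isOpen_ball
  -- The partition of unity is taken over a compact neighbourhood `L` of `k`, so that it sums to one
  -- on the open set `interior L`, which serves as `N`.
  obtain ⟨L, hL, hkL, hLW⟩ := exists_compact_between hk
    (isOpen_iUnion hWi) (ht.trans (by rw [iUnion_subtype]))
  obtain ⟨χ, hχ⟩ := SmoothPartitionOfUnity.exists_isSubordinate 𝓘(ℝ, E) hL.isClosed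
    (fun i : t => W i ∩ Metric.ball (i : E) 1) hWi hLW
  have hχ1 : ∀ i, ContDiff ℝ 1 (χ i) := fun i =>
    (χ i).contMDiff.contDiff.of_le (by exact_mod_cast le_top)
  have hχc : ∀ i, IsCompact (tsupport (χ i)) := fun i =>
    Metric.isCompact_of_isClosed_isBounded (isClosed_tsupport _)
      (Metric.isBounded_ball.subset ((hχ i).trans inter_subset_right))
  choose F' hF' hFc hF'c hF'0 using fun i : t => hf.exists_local_extension hCU (hW i (htM i))
    (hρ i (htM i)) (hρM i (htM i)) (hχ1 i) ((hχ i).trans inter_subset_left)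
  have hS : IsCompact (⋃ i : t, tsupport (χ i)) := isCompact_iUnion hχc
  have hS' : ∀ y ∉ ⋃ i : t, tsupport (χ i), ∀ i : t, y ∉ tsupport (χ i) :=
    fun y hy i h => hy (mem_iUnion.2 ⟨i, h⟩)
  have hc : ContinuousOn (fun p : E × G => ∑ i : t, χ i p.1 • f (ρ i p.1) p.2) (univ ×ˢ C) :=
    continuousOn_finsetSum _ fun i _ => hFc i
  have hc' : ContinuousOn (fun p : E × G => ∑ i : t, F' i p.1 p.2) (univ ×ˢ C) :=
    continuousOn_finsetSum _ fun i _ => hF'c i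
  obtain ⟨B, hB⟩ := exists_norm_le_of_eqOn_zero (Φ := fun y c => ∑ i : t, χ i y • f (ρ i y) c)
    hS hC hc fun y hy c _ => Finset.sum_eq_zero fun i _ => by
      rw [image_eq_zero_of_notMem_tsupport (hS' y hy i), zero_smul]
  obtain ⟨K, hK⟩ := exists_norm_le_of_eqOn_zero (Φ := fun y c => ∑ i : t, F' i y c)
    hS hC hc' fun y hy c hc => Finset.sum_eq_zero fun i _ => hF'0 i y (hS' y hy i) c hc
  refine ⟨fun y c => ∑ i : t, χ i y • f (ρ i y) c, fun y c => ∑ i : t, F' i y c, interior L, B, K,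
    hkL, isOpen_interior, fun z hz hzM => ?_, fun y hy c _ => ?_,
    fun c hc y => HasFDerivAt.fun_sum fun i _ => hF' i c hc y, hc, hc', hB, hK⟩
  -- `M` is relatively closed in `N`: a local retraction moves a point off `M`, and by continuity it
  -- moves the nearby points as well.
  · obtain ⟨i, hi⟩ := mem_iUnion.1 (hLW (interior_subset hz))
    have hcont : ContinuousAt (ρ i) z :=
      ((hρ i (htM i)).continuousOn).continuousAt ((hW i (htM i)).mem_nhds hi.1)
    have hne : ρ i z ≠ z := fun h => hzM ((hρ' i (htM i) z hi.1).2 h)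
    filter_upwards [(hcont.prodMk continuousAt_id).eventually
        (isClosed_diagonal.isOpen_compl.mem_nhds (x := (ρ i z, z)) hne),
      (hW i (htM i)).mem_nhds hi.1] with y hy hyW hyM
    exact hy ((hρ' i (htM i) y hyW).1 hyM)
  · have h1 : ∑ i : t, χ i y = 1 := by
      rw [← finsum_eq_sum_of_fintype]
      exact χ.sum_eq_one (interior_subset hy.2)
    -- At a point of `M`, each retraction whose cutoff function matters fixes the point, so the sum
    -- is a convex combination of equal vectors.
    calc ∑ i : t, χ i y • f (ρ i y) c = ∑ i : t, χ i y • f y c := by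
          refine Finset.sum_congr rfl fun i _ => ?_
          by_cases hi : y ∈ tsupport (χ i)
          · rw [(hρ' i (htM i) y (hχ i hi).1).1 hy.1]
          · rw [image_eq_zero_of_notMem_tsupport hi, zero_smul, zero_smul]
      _ = f y c := by rw [← Finset.sum_smul, h1, one_smul]

end Extension

/-! ### Invariance of the submanifold and uniqueness -/

section Invariance

variable {E G : Type*} [NormedAddCommGroup E] [NormedSpace ℝ E] [FiniteDimensional ℝ E]
  [NormedAddCommGroup G] {M N : Set E} {U C : Set G} {f F : E → G → E} {F' : E → G → E →L[ℝ] E}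
  {B K : NNReal} {g : ℝ → G} {a b : ℝ} {x y z : ℝ → E}

/-- Solutions of an extension that start in the submanifold stay in it for a short time. -/
theorem IsExtension.exists_nhds_invariant (hF : IsExtension M f C F F' N B K)
    (hf : IsControlField M U f) (hCU : C ⊆ U) {p : E} (hp : p ∈ M) (hpN : p ∈ N) :
    ∃ W ∈ 𝓝 p, ∀ (g : ℝ → G) (y : ℝ → E) (a b : ℝ), PiecewiseContinuousOn C g a b →
      IsSol F g y a b → MapsTo y (Icc a b) W → y a ∈ M → MapsTo y (Icc a b) M := by
  obtain ⟨φ, V, hps, hφ, hφ', hφM⟩ := hf.isSubmanifold p hp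
  obtain ⟨P, hPV, hP⟩ := V.exists_projection
  -- `Q (φ y)` is the component of `y` transversal to `M` in the chart; it vanishes exactly on `M`.
  set Q : E →L[ℝ] E := ContinuousLinearMap.id ℝ E - P with hQ
  have hQV : ∀ v, Q v = 0 ↔ v ∈ V := fun v =>
    ⟨fun h => by
      have h' : v = P v := by simpa [hQ, sub_eq_zero] using h
      rw [h']; exact hPV v, fun h => by simp [hQ, hP v h]⟩
  have hs := φ.open_source.mem_nhds hps
  have hφp := hφ.contDiffAt hs
  obtain ⟨K₁, S, hS, hK₁⟩ := (hφp.fderiv_right (m := 1) (by norm_num)).exists_lipschitzOnWith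
  have ht := φ.open_target.mem_nhds (φ.map_source hps)
  obtain ⟨K₂, T, hT, hK₂⟩ := ((hφ'.contDiffAt ht).of_le one_le_two).exists_lipschitzOnWith
  set ρ : E → E := fun y => φ.symm (P (φ y)) with hρ
  have hPp : P (φ p) = φ p := hP _ ((hφM p hps).1 hp)
  have hρp : ρ p = p := by simp only [hρ, hPp, φ.left_inv hps]
  have hφc : Tendsto φ (𝓝 p) (𝓝 (φ p)) := φ.continuousAt hps
  have hPφ : Tendsto (fun y => P (φ y)) (𝓝 p) (𝓝 (φ p)) := by
    simpa [hPp, Function.comp_def] using (P.continuous.tendsto (φ p)).comp hφc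
  have hρc : Tendsto ρ (𝓝 p) (𝓝 p) := by
    simpa [φ.left_inv hps, hρ, Function.comp_def] using (φ.symm.continuousAt (φ.map_source hps)).tendsto.comp hPφ
  have hDφ : ∀ᶠ y in 𝓝 p, ‖fderiv ℝ φ y‖ ≤ ‖fderiv ℝ φ p‖ + 1 :=
    ((hφp.fderiv_right (m := 1) (by norm_num)).continuousAt.norm.eventually_le_const
      (lt_add_one _))
  -- The rate of change of `Q (φ y)` vanishes at the point `ρ y` of `M`, where the field is tangent.
  -- At `y` it is therefore bounded by a multiple of `‖y - ρ y‖ ≤ K₂ ‖Q (φ y)‖`; the multiple uses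
  -- the Lipschitz constants `K` of `F` and `K₁` of the differential of `φ`. The latter exists
  -- because the chart is `C²`.
  set L : ℝ := ‖Q‖ * ((((‖fderiv ℝ φ p‖ + 1) * K) + K₁ * B) * K₂) with hL
  have hW : ∀ᶠ y in 𝓝 p, y ∈ φ.source ∧ ∀ c ∈ C, ‖Q (fderiv ℝ φ y (F y c))‖ ≤ L * ‖Q (φ y)‖ := by
    filter_upwards [hs, hS, hρc hS, hφc hT, hPφ hT, hPφ ht, hDφ,
      hρc (hF.isOpen.mem_nhds hpN)] with y hys hyS hρS hyT hPT hPt hyD hρN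
    refine ⟨hys, fun c hc => ?_⟩
    have hρs : ρ y ∈ φ.source := φ.map_target hPt
    have hφρ : φ (ρ y) = P (φ y) := φ.right_inv hPt
    have hρM : ρ y ∈ M := by rw [hφM _ hρs, hφρ]; exact hPV _
    have h0 : Q (fderiv ℝ φ (ρ y) (F (ρ y) c)) = 0 := by
      have := hf.tangent _ hρM c (hCU hc)
      rw [tangentConeAt_eq_preimage_of_chart φ V hφ hφ' hφM hρs hρM] at this
      rw [hF.eq _ ⟨hρM, hρN⟩ c hc]
      exact (hQV _).2 this
    have h1 : ‖y - ρ y‖ ≤ K₂ * ‖Q (φ y)‖ := by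
      have := hK₂.dist_le_mul _ hyT _ hPT
      rw [φ.left_inv hys, dist_eq_norm, dist_eq_norm] at this
      simpa [hQ, hρ] using this
    have h2 : ‖F y c - F (ρ y) c‖ ≤ K * ‖y - ρ y‖ := by
      simpa [dist_eq_norm] using (hF.lipschitzWith hc).dist_le_mul y (ρ y)
    have h3 : ‖fderiv ℝ φ y - fderiv ℝ φ (ρ y)‖ ≤ K₁ * ‖y - ρ y‖ := by
      simpa [dist_eq_norm] using hK₁.dist_le_mul _ hyS _ hρS
    have h4 : fderiv ℝ φ y (F y c) - fderiv ℝ φ (ρ y) (F (ρ y) c) =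
        fderiv ℝ φ y (F y c - F (ρ y) c) + (fderiv ℝ φ y - fderiv ℝ φ (ρ y)) (F (ρ y) c) := by
      simp
    calc ‖Q (fderiv ℝ φ y (F y c))‖
        = ‖Q (fderiv ℝ φ y (F y c - F (ρ y) c)
            + (fderiv ℝ φ y - fderiv ℝ φ (ρ y)) (F (ρ y) c))‖ := by
          rw [← h4, map_sub, h0, sub_zero]
      _ ≤ ‖Q‖ * (‖fderiv ℝ φ y‖ * ‖F y c - F (ρ y) c‖
            + ‖fderiv ℝ φ y - fderiv ℝ φ (ρ y)‖ * ‖F (ρ y) c‖) := by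
          refine (Q.le_opNorm _).trans ?_
          gcongr
          refine (norm_add_le _ _).trans (add_le_add ?_ ?_) <;> exact ContinuousLinearMap.le_opNorm _ _
      _ ≤ ‖Q‖ * ((‖fderiv ℝ φ p‖ + 1) * (K * ‖y - ρ y‖) + (K₁ * ‖y - ρ y‖) * B) := by
          gcongr
          exact hF.norm_le c hc _
      _ = ‖Q‖ * (((‖fderiv ℝ φ p‖ + 1) * K + K₁ * B) * ‖y - ρ y‖) := by ring
      _ ≤ ‖Q‖ * (((‖fderiv ℝ φ p‖ + 1) * K + K₁ * B) * (K₂ * ‖Q (φ y)‖)) := by gcongr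
      _ = L * ‖Q (φ y)‖ := by rw [hL]; ring
  refine ⟨_, hW, fun g y a b hg hy hyW hya t ht => ?_⟩
  -- Gronwall: a function that starts at zero with growth rate at most `L` times its own norm stays
  -- zero.
  have hQ0 : Q (φ (y t)) = 0 := by
    refine eq_zero_of_abs_deriv_le_mul_abs_self_of_eq_zero_right (f := fun t => Q (φ (y t)))
      (f' := fun t => Q (fderiv ℝ φ (y t) (F (y t) (Function.rightLim g t)))) (K := L)
      (a := a) (b := b) ?_ ?_ ?_ ?_ t ht
    · exact Q.continuous.comp_continuousOn
        (φ.continuousOn.comp hy.continuousOn fun t ht => (hyW ht).1)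
    · intro t ht
      have hyt := hyW (Ico_subset_Icc_self ht)
      have h1 : HasFDerivAt φ (fderiv ℝ φ (y t)) (y t) :=
        ((hφ.contDiffAt (φ.open_source.mem_nhds hyt.1)).differentiableAt two_ne_zero).hasFDerivAt
      exact Q.hasFDerivAt.comp_hasDerivWithinAt t (h1.comp_hasDerivWithinAt t
        (hy.hasDerivWithinAt_rightLim hg hF.continuousOn (mapsTo_univ _ _) ht))
    · exact (hQV _).2 ((hφM _ (hyW ⟨le_rfl, ht.1.trans ht.2⟩).1).1 hya)
    · intro t ht
      exact (hyW (Ico_subset_Icc_self ht)).2 _ (hg.tendsto_rightLim ht).2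
  exact (hφM _ (hyW ht).1).2 ((hQV _).1 hQ0)

/-- Solutions of an extension that start in the submanifold stay in it. -/
theorem IsExtension.mapsTo_of_isSol (hF : IsExtension M f C F F' N B K)
    (hf : IsControlField M U f) (hCU : C ⊆ U) (hg : PiecewiseContinuousOn C g a b)
    (hy : IsSol F g y a b) (hab : a < b) (hyN : MapsTo y (Icc a b) N) (hya : y a ∈ M) :
    MapsTo y (Icc a b) M := by
  have hloc : ∀ t ∈ Icc a b, ∃ W ∈ 𝓝 (y t), ∀ c d, a ≤ c → d ≤ b → c ≤ d →
      MapsTo y (Icc c d) W → y c ∈ M → MapsTo y (Icc c d) M := by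
    intro t ht
    by_cases h : y t ∈ M
    · obtain ⟨W, hW, hW'⟩ := hF.exists_nhds_invariant hf hCU h (hyN ht)
      exact ⟨W, hW, fun c d hac hdb _ => hW' g y c d (hg.mono hac hdb) (hy.mono hac hdb)⟩
    -- A point of `N` off `M` has a neighbourhood disjoint from `M`; an interval whose image lies in
    -- it cannot start in `M`, so the claim is void.
    · exact ⟨_, hF.eventually_notMem _ (hyN ht) h, fun c d _ _ hcd hm hc =>
        absurd hc (hm ⟨le_rfl, hcd⟩)⟩
  refine rel_of_local_of_trans (R := fun c d => y c ∈ M → MapsTo y (Icc c d) M) hab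
    ?_ ?_ ?_ hya
  · intro r s t _ hrs hst _ h1 h2 hr
    rw [← Icc_union_Icc_eq_Icc hrs.le hst.le]
    exact (h1 hr).union_union (h2 (h1 hr ⟨hrs.le, le_rfl⟩)) |>.mono_right (union_self M).subset
  · intro s hs
    obtain ⟨W, hW, hW'⟩ := hloc s (Ico_subset_Icc_self hs)
    obtain ⟨d, hd, hd'⟩ := (mem_nhdsGE_iff_exists_Ico_subset' hs.2).1
      (((hy.continuousOn s (Ico_subset_Icc_self hs)).mono_of_mem_nhdsWithin
        (s := Ici s) (mem_of_superset (Ico_mem_nhdsGE hs.2)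
          fun r hr => ⟨hs.1.trans hr.1, hr.2.le⟩)) hW)
    filter_upwards [Ioo_mem_nhdsGT hs.2, Ioo_mem_nhdsGT hd] with t ht ht'
    exact hW' s t hs.1 ht.2.le ht.1.le fun r hr => hd' ⟨hr.1, hr.2.trans_lt ht'.2⟩
  · intro t ht
    obtain ⟨W, hW, hW'⟩ := hloc t (Ioc_subset_Icc_self ht)
    obtain ⟨d, hd, hd'⟩ := (mem_nhdsLE_iff_exists_Ioc_subset' ht.1).1
      (((hy.continuousOn t (Ioc_subset_Icc_self ht)).mono_of_mem_nhdsWithin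
        (s := Iic t) (mem_of_superset (Ioc_mem_nhdsLE ht.1)
          fun r hr => ⟨hr.1.le, hr.2.trans ht.2⟩)) hW)
    filter_upwards [Ioo_mem_nhdsLT ht.1, Ioo_mem_nhdsLT hd] with s hs hs'
    exact hW' s t hs.1.le ht.2 hs.2.le fun r hr => hd' ⟨hs'.1.trans_le hr.1, hr.2⟩

/-- Two solutions on the submanifold with the same initial value agree. -/
theorem IsControlField.eqOn_of_isSol (hf : IsControlField M U f)
    (hg : IsPiecewiseContinuousInto U g) (hy : IsSol f g y a b) (hz : IsSol f g z a b)
    (hyM : MapsTo y (Icc a b) M) (hzM : MapsTo z (Icc a b) M) (hyz : y a = z a) :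
    EqOn y z (Icc a b) := by
  obtain ⟨C, hCU, hC, -, hgC⟩ := hg.exists_isCompact a b
  -- Extending from the union of both images makes the two curves solutions of one globally
  -- Lipschitz equation.
  obtain ⟨F, F', N, B, K, hkN, hF⟩ := hf.exists_isExtension
    ((isCompact_Icc.image_of_continuousOn hy.continuousOn).union
      (isCompact_Icc.image_of_continuousOn hz.continuousOn))
    (union_subset hyM.image_subset hzM.image_subset) hC hCU
  have hy' : IsSol F g y a b := hy.congr_field fun t ht =>
    (hF.eq _ ⟨hyM (Ioo_subset_Icc_self ht),
      hkN (Or.inl (mem_image_of_mem y (Ioo_subset_Icc_self ht)))⟩ _ (hgC.mem t ht)).symm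
  have hz' : IsSol F g z a b := hz.congr_field fun t ht =>
    (hF.eq _ ⟨hzM (Ioo_subset_Icc_self ht),
      hkN (Or.inr (mem_image_of_mem z (Ioo_subset_Icc_self ht)))⟩ _ (hgC.mem t ht)).symm
  refine ODE_solution_unique_of_mem_Icc_right (v := fun t y => F y (Function.rightLim g t))
    (s := fun _ => univ) (K := K)
    (fun t ht => (hF.lipschitzWith (hgC.tendsto_rightLim ht).2).lipschitzOnWith)
    hy.continuousOn (fun t ht => hy'.hasDerivWithinAt_rightLim hgC hF.continuousOn
      (mapsTo_univ _ _) ht) (fun _ _ => trivial)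
    hz.continuousOn (fun t ht => hz'.hasDerivWithinAt_rightLim hgC hF.continuousOn
      (mapsTo_univ _ _) ht) (fun _ _ => trivial) hyz

end Invariance

/-! ### First-order expansion of perturbed solutions -/

section PerturbedFlow

variable {E G : Type*} [NormedAddCommGroup E] [NormedSpace ℝ E] [NormedAddCommGroup G]
  {M N : Set E} {U C : Set G} {f F : E → G → E} {F' : E → G → E →L[ℝ] E}
  {B K : NNReal} {u : ℝ → G} {b e : ℝ} {x Ψ : ℝ → E} {s : ℝ → ℝ} {p : ℝ → E} {y : ℝ → ℝ → E}

/-- For small `ε > 0`, `y ε` is a solution on the submanifold `M` of the control field `f`, on an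
interval `[s ε, e + η]`, with initial value `p ε`.  For `ε → 0` it tends to the solution `x` on
`[b, e]` with first variation `Ψ`. -/
structure IsPerturbedFlow (M : Set E) (f : E → G → E) (u : ℝ → G) (x Ψ : ℝ → E) (b e : ℝ)
    (s : ℝ → ℝ) (p : ℝ → E) (η : ℝ) (y : ℝ → ℝ → E) : Prop where
  pos : 0 < η
  start : ∀ᶠ ε in 𝓝[>] (0 : ℝ), y ε (s ε) = p ε
  isSol : ∀ᶠ ε in 𝓝[>] (0 : ℝ), IsSol f u (y ε) (s ε) (e + η)
  mapsTo : ∀ᶠ ε in 𝓝[>] (0 : ℝ), MapsTo (y ε) (Icc (s ε) (e + η)) M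
  tendsto : ∀ t ∈ Icc b e, Tendsto (fun q : ℝ × ℝ => y q.1 q.2) (𝓝[>] 0 ×ˢ 𝓝 t) (𝓝 (x t))
  velocity : ∀ t ∈ Icc b e, ContinuousAt u t →
    (fun q : ℝ × ℝ × ℝ => y q.1 q.2.1 - y q.1 q.2.2 - (q.2.1 - q.2.2) • f (x t) (u t))
      =o[𝓝[>] 0 ×ˢ 𝓝 t ×ˢ 𝓝 t] fun q => q.2.1 - q.2.2
  variation : ∀ t ∈ Icc b e, (fun ε => y ε t - x t - ε • Ψ t) =o[𝓝[>] 0] fun ε => ε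

theorem exists_Icc_subset_of_mem_nhdsSet_Icc {V : Set ℝ} (hbe : b ≤ e) (hV : V ∈ 𝓝ˢ (Icc b e)) :
    ∃ δ > 0, Icc (b - δ) (e + δ) ⊆ V := by
  obtain ⟨V', hV', hbeV', hV'V⟩ := mem_nhdsSet_iff_exists.1 hV
  obtain ⟨δ, hδ, hδV⟩ := isCompact_Icc.exists_cthickening_subset_open hV' hbeV'
  refine ⟨δ, hδ, fun r hr => hV'V (hδV (Metric.mem_cthickening_of_dist_le r (max b (min r e)) δ _
    ⟨le_max_left _ _, max_le hbe (min_le_right _ _)⟩ ?_))⟩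
  obtain ⟨h1, h2⟩ := hr
  rw [Real.dist_eq, abs_le]
  rcases le_total r e with h | h
  · rw [min_eq_left h]
    rcases le_total b r with h' | h'
    · rw [max_eq_right h']; constructor <;> linarith
    · rw [max_eq_left h']; constructor <;> linarith
  · rw [min_eq_right h, max_eq_right hbe]; constructor <;> linarith

/-- The bound is homogeneous in initial error and defect: if both are `ε` times a small constant, so
is the resulting error, up to a factor independent of `ε`. -/
theorem gronwallBound_smul (c δ K ε x : ℝ) :
    gronwallBound (c * δ) K (c * ε) x = c * gronwallBound δ K ε x := by
  unfold gronwallBound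
  split_ifs <;> ring

/-- The field `(ψ, (x, u)) ↦ F'(x, u) ψ` of the variational equation is continuous. -/
theorem IsExtension.continuousOn_variational (hF : IsExtension M f C F F' N B K) :
    ContinuousOn (fun q : E × E × G => F' q.2.1 q.2.2 q.1) (univ ×ˢ (univ ×ˢ C)) :=
  (hF.continuousOn_fderiv.comp continuousOn_snd fun _ hq => hq.2).clm_apply continuousOn_fst

/-- The first-order Taylor expansion of an extension is uniform on compact sets. -/
theorem IsExtension.exists_taylor [FiniteDimensional ℝ E] (hF : IsExtension M f C F F' N B K)
    (hC : IsCompact C) {k : Set E} (hk : IsCompact k) {κ : ℝ} (hκ : 0 < κ) :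
    ∃ δ > 0, ∀ p ∈ k, ∀ c ∈ C, ∀ v : E, ‖v‖ ≤ δ →
      ‖F (p + v) c - F p c - F' p c v‖ ≤ κ * ‖v‖ := by
  obtain ⟨R, hR⟩ := hk.isBounded.subset_closedBall (0 : E)
  -- Uniform continuity of the derivative on a ball enlarged by one, which contains `p + v` for all
  -- `p ∈ k` and `‖v‖ ≤ 1`; the mean value inequality does the rest.
  have huc := ((isCompact_closedBall (0 : E) (R + 1)).prod hC).uniformContinuousOn_of_continuous
    (hF.continuousOn_fderiv.mono (prod_mono (subset_univ _) Subset.rfl))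
  obtain ⟨δ, hδ, h⟩ := Metric.uniformContinuousOn_iff.1 huc κ hκ
  refine ⟨min (δ / 2) 1, by positivity, fun p hp c hc v hv => ?_⟩
  have hpR : ‖p‖ ≤ R := by simpa using hR hp
  have h1 : ∀ z ∈ Metric.closedBall p ‖v‖, ‖F' z c - F' p c‖ ≤ κ := fun z hz => by
    rw [mem_closedBall_iff_norm] at hz
    rw [← dist_eq_norm]
    refine (h (z, c) ⟨?_, hc⟩ (p, c) ⟨?_, hc⟩ ?_).le
    · rw [mem_closedBall_zero_iff]
      linarith [norm_le_insert' z p, hv.trans (min_le_right _ _)]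
    · rw [mem_closedBall_zero_iff]
      linarith
    · rw [Prod.dist_eq, dist_self, max_eq_left dist_nonneg, dist_eq_norm]
      linarith [hv.trans (min_le_left _ _)]
  have h2 := (convex_closedBall p ‖v‖).norm_image_sub_le_of_norm_hasFDerivWithin_le'
    (f := (F · c)) (f' := (F' · c)) (φ := F' p c) (C := κ) (x := p) (y := p + v)
    (fun z _ => (hF.hasFDerivAt c hc z).hasFDerivWithinAt) h1 (by simp) (by simp)
  simpa using h2

/-- Perturbed solutions of an extension: existence, convergence, and first-order variation. -/
theorem IsExtension.exists_isPerturbedFlow [FiniteDimensional ℝ E]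
    (hF : IsExtension M f C F F' N B K)
    (hf : IsControlField M U f) (hC : IsCompact C) (hCU : C ⊆ U) (hbe : b ≤ e)
    (huC : PiecewiseContinuousOn C u (b - 1) (e + 1)) (hub : ContinuousAt u b)
    (hx : IsSol F u x b e) (hxM : MapsTo x (Icc b e) M) (hxN : MapsTo x (Icc b e) N)
    (hΨ : IsSol (fun ψ (q : E × G) => F' q.1 q.2 ψ) (fun t => (x t, u t)) Ψ b e)
    (hs : (fun ε => s ε - b) =O[𝓝[>] 0] fun ε => ε)
    (hp : (fun ε => p ε - x b - (s ε - b) • f (x b) (u b) - ε • Ψ b) =o[𝓝[>] 0] fun ε => ε)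
    (hpM : ∀ᶠ ε in 𝓝[>] (0 : ℝ), p ε ∈ M) :
    ∃ η y, IsPerturbedFlow M f u x Ψ b e s p η y := by
  have hε0 : Tendsto (fun ε : ℝ => ε) (𝓝[>] 0) (𝓝 0) := nhdsWithin_le_nhds
  have hsb : Tendsto s (𝓝[>] 0) (𝓝 b) := by
    simpa using (hs.trans_tendsto hε0).add_const b
  -- The solutions live on `[b - 1, e + 1]`, which contains `s ε` for small `ε`; for other `ε` the
  -- function is irrelevant and is set to zero.
  have hex : ∀ ε, ∃ y : ℝ → E, s ε ∈ Icc (b - 1) (e + 1) →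
      y (s ε) = p ε ∧ IsSol F u y (b - 1) (e + 1) := by
    intro ε
    by_cases h : s ε ∈ Icc (b - 1) (e + 1)
    · obtain ⟨y, hy⟩ := exists_isSol_of_lipschitzWith hF.continuousOn
        (fun c hc => hF.lipschitzWith hc) (fun c hc => hF.norm_le c hc 0) huC
        (by linarith) h (p ε)
      exact ⟨y, fun _ => hy⟩
    · exact ⟨0, fun h' => absurd h' h⟩
  choose y hy using hex
  have hsI : ∀ᶠ ε in 𝓝[>] (0 : ℝ), s ε ∈ Icc (b - 1) (e + 1) :=
    hsb (Icc_mem_nhds (by linarith) (by linarith))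
  have hsol : ∀ᶠ ε in 𝓝[>] (0 : ℝ), IsSol F u (y ε) (b - 1) (e + 1) :=
    hsI.mono fun ε h => (hy ε h).2
  -- Used twice: with `v = 0` and `κ = B` it makes the perturbed solutions equicontinuous in time,
  -- and with `v = f (x t) (u t)` and small `κ` it gives `velocity`.
  have hlin : ∀ᶠ ε in 𝓝[>] (0 : ℝ), ∀ r₁ ∈ Icc (b - 1) (e + 1), ∀ r₂ ∈ Icc (b - 1) (e + 1),
      ∀ (v : E) (κ : ℝ),
      (∀ r ∈ uIcc r₁ r₂, ‖F (y ε r) (Function.rightLim u r) - v‖ ≤ κ) →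
      ‖y ε r₁ - y ε r₂ - (r₁ - r₂) • v‖ ≤ κ * |r₁ - r₂| := by
    filter_upwards [hsol] with ε hε
    have key : ∀ r₁ ∈ Icc (b - 1) (e + 1), ∀ r₂ ∈ Icc (b - 1) (e + 1),
        ∀ (v : E) (κ : ℝ), r₁ ≤ r₂ →
        (∀ r ∈ uIcc r₁ r₂, ‖F (y ε r) (Function.rightLim u r) - v‖ ≤ κ) →
        ‖y ε r₂ - y ε r₁ - (r₂ - r₁) • v‖ ≤ κ * |r₂ - r₁| := by
      intro r₁ h₁ r₂ h₂ v κ h hκ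
      rw [abs_of_nonneg (sub_nonneg.2 h)]
      refine (hε.mono h₁.1 h₂.2).norm_sub_sub_smul_le (huC.mono h₁.1 h₂.2) hF.continuousOn
        (mapsTo_univ _ _) h fun r hr => hκ r ?_
      rw [uIcc_of_le h]
      exact Ico_subset_Icc_self hr
    intro r₁ h₁ r₂ h₂ v κ hκ
    rcases le_total r₁ r₂ with h | h
    · have := key r₁ h₁ r₂ h₂ v κ h hκ
      have e1 : -(y ε r₁ - y ε r₂ - (r₁ - r₂) • v) = y ε r₂ - y ε r₁ - (r₂ - r₁) • v := by
        rw [← neg_sub r₂ r₁, neg_smul]; abel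
      rwa [← norm_neg, e1, abs_sub_comm]
    · exact key r₂ h₂ r₁ h₁ v κ h (by rwa [uIcc_comm])
  have hrl : ∀ r ∈ Icc b e, Function.rightLim u r ∈ C := fun r hr =>
    (huC.tendsto_rightLim ⟨by linarith [hr.1], by linarith [hr.2]⟩).2
  have hnear : ∀ t ∈ Icc b e, ∀ᶠ r in 𝓝 t, r ∈ Ioo (b - 1) (e + 1) := fun t ht =>
    Ioo_mem_nhds (by linarith [ht.1]) (by linarith [ht.2])
  have hLip : ∀ᶠ ε in 𝓝[>] (0 : ℝ), ∀ r₁ ∈ Ioo (b - 1) (e + 1), ∀ r₂ ∈ Ioo (b - 1) (e + 1),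
      ‖y ε r₁ - y ε r₂‖ ≤ B * |r₁ - r₂| := by
    filter_upwards [hlin] with ε hε r₁ h₁ r₂ h₂
    simpa using hε r₁ (Ioo_subset_Icc_self h₁) r₂ (Ioo_subset_Icc_self h₂) 0 B fun r hr => by
      rw [sub_zero]
      have hr' : r ∈ Ioo (b - 1) (e + 1) := ordConnected_Ioo.uIcc_subset h₁ h₂ hr
      exact hF.norm_le _ (huC.tendsto_rightLim (Ioo_subset_Ico_self hr')).2 _
  have htend : ∀ t ∈ Icc b e, Tendsto (fun ε => y ε t) (𝓝[>] 0) (𝓝 (x t)) →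
      Tendsto (fun q : ℝ × ℝ => y q.1 q.2) (𝓝[>] 0 ×ˢ 𝓝 t) (𝓝 (x t)) := by
    intro t ht h
    have h1 : Tendsto (fun q : ℝ × ℝ => y q.1 q.2 - y q.1 t) (𝓝[>] 0 ×ˢ 𝓝 t) (𝓝 0) := by
      refine squeeze_zero_norm' (a := fun q : ℝ × ℝ => B * |q.2 - t|) ?_ ?_
      · filter_upwards [tendsto_fst.eventually hLip, tendsto_snd.eventually (hnear t ht)]
          with q hq hq'
        exact hq _ hq' _ (hnear t ht).self_of_nhds
      · have : Tendsto (fun r : ℝ => B * |r - t|) (𝓝 t) (𝓝 0) :=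
          Continuous.tendsto' (by fun_prop) _ _ (by simp)
        exact this.comp tendsto_snd
    simpa using h1.add (h.comp tendsto_fst)
  -- Strict differentiability in time, uniform in small `ε`. It permits comparing values of `y ε` at
  -- two nearby times that both depend on `ε`, as needed at entries and exits.
  have hvel : ∀ t ∈ Icc b e, ContinuousAt u t → Tendsto (fun ε => y ε t) (𝓝[>] 0) (𝓝 (x t)) →
      (fun q : ℝ × ℝ × ℝ => y q.1 q.2.1 - y q.1 q.2.2 - (q.2.1 - q.2.2) • f (x t) (u t))
        =o[𝓝[>] 0 ×ˢ 𝓝 t ×ˢ 𝓝 t] fun q => q.2.1 - q.2.2 := by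
    intro t ht hut h
    have htC : u t ∈ C := huC.mem t (hnear t ht).self_of_nhds
    -- The discontinuities are isolated, so near a point of continuity the right limit is the value.
    have hev : ∀ᶠ r in 𝓝 t, Function.rightLim u r = u r := by
      have h1 : ∀ᶠ r in 𝓝[≠] t, ContinuousAt u r := by
        rw [← nhdsLT_sup_nhdsGT, eventually_sup]
        exact ⟨(huC.left t (Ioo_subset_Ioc_self (hnear t ht).self_of_nhds)).2,
          (huC.right t (Ioo_subset_Ico_self (hnear t ht).self_of_nhds)).2⟩
      rw [eventually_nhdsWithin_iff] at h1
      filter_upwards [h1] with r hr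
      rcases eq_or_ne r t with rfl | hne
      · exact hut.continuousWithinAt.rightLim_eq
      · exact (hr hne).continuousWithinAt.rightLim_eq
    have h1 : Tendsto (fun q : ℝ × ℝ => (y q.1 q.2, Function.rightLim u q.2)) (𝓝[>] 0 ×ˢ 𝓝 t)
        (𝓝[univ ×ˢ C] (x t, u t)) := by
      refine tendsto_nhdsWithin_iff.2 ⟨(htend t ht h).prodMk_nhds ?_, ?_⟩
      · exact (hut.tendsto.congr' (hev.mono fun r hr => hr.symm)).comp tendsto_snd
      · filter_upwards [tendsto_snd.eventually (hnear t ht)] with q hq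
        exact ⟨trivial, (huC.tendsto_rightLim (Ioo_subset_Ico_self hq)).2⟩
    have h2 := (hF.continuousOn (x t, u t) ⟨trivial, htC⟩).tendsto.comp h1
    rw [hF.eq (x t) ⟨hxM ht, hxN ht⟩ _ htC] at h2
    refine isLittleO_iff.2 fun κ hκ => ?_
    have h3 := h2.eventually (Metric.closedBall_mem_nhds _ hκ)
    obtain ⟨pa, hpa, pb, hpb, hab⟩ := eventually_prod_iff.1 h3
    obtain ⟨δ, hδ, hball⟩ := Metric.eventually_nhds_iff_ball.1 (hpb.and (hnear t ht))
    have hb : ∀ᶠ r in 𝓝 t, r ∈ Metric.ball t δ := Metric.ball_mem_nhds t hδ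
    filter_upwards [(hpa.and hlin).prod_mk (hb.prod_mk hb)] with q hq
    refine hq.1.2 _ (Ioo_subset_Icc_self (hball _ hq.2.1).2) _
      (Ioo_subset_Icc_self (hball _ hq.2.2).2) _ κ fun r hr => ?_
    have hr' : r ∈ Metric.ball t δ := by
      rw [Real.ball_eq_Ioo] at hq ⊢
      exact ordConnected_Ioo.uIcc_subset hq.2.1 hq.2.2 hr
    simpa [dist_eq_norm] using hab hq.1.1 (hball r hr').1
  have hbI : b ∈ Icc b e := ⟨le_rfl, hbe⟩
  have hyb : Tendsto (fun ε => y ε b) (𝓝[>] 0) (𝓝 (x b)) := by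
    have h1 : Tendsto p (𝓝[>] 0) (𝓝 (x b)) := by
      have := (((hp.trans_tendsto hε0).add (hε0.smul_const (Ψ b))).add
        (((hs.trans_tendsto hε0)).smul_const (f (x b) (u b)))).add_const (x b)
      simp only [zero_smul, zero_add] at this
      refine this.congr fun ε => by abel
    have h2 : Tendsto (fun ε => y ε b - p ε) (𝓝[>] 0) (𝓝 0) := by
      refine squeeze_zero_norm' (a := fun ε => B * |b - s ε|) ?_ ?_
      · filter_upwards [hLip, hsI, hsb.eventually (hnear b hbI)] with ε h h' h''
        rw [← (hy ε h').1]
        exact h _ (hnear b hbI).self_of_nhds _ h''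
      · have : Tendsto (fun r : ℝ => B * |b - r|) (𝓝 b) (𝓝 0) :=
          Continuous.tendsto' (by fun_prop) _ _ (by simp)
        exact this.comp hsb
    simpa using h2.add h1
  -- Moving the initial data from `s ε` to `b` costs `(s ε - b) f(x(b), u(b))` up to `o(ε)`, the
  -- very term that the hypothesis on `p` contains.
  have hyb' : (fun ε => y ε b - x b - ε • Ψ b) =o[𝓝[>] 0] fun ε => ε := by
    have h1 := ((hvel b hbI hub hyb).comp_tendsto
      (tendsto_id.prodMk (hsb.prodMk (tendsto_const_nhds (x := b))))).trans_isBigO hs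
    refine (hp.sub h1).congr' ?_ EventuallyEq.rfl
    filter_upwards [hsI] with ε hε
    simp only [Function.comp_apply, id, (hy ε hε).1]
    abel
  have hvar : ∀ t ∈ Icc b e, (fun ε => y ε t - x t - ε • Ψ t) =o[𝓝[>] 0] fun ε => ε := by
    intro t ht
    obtain ⟨R, hR⟩ := isCompact_Icc.exists_bound_of_continuousOn hΨ.continuousOn
    have hk := isCompact_Icc.image_of_continuousOn hx.continuousOn
    -- Gronwall's amplification of a unit initial error with a unit defect. Allowing each of them
    -- only `ε κ / (g₀ + 1)` leaves a final error of at most `κ ε`.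
    set g₀ := gronwallBound 1 K 1 (t - b)
    have hg₀ : 0 ≤ g₀ := by
      have := gronwallBound_mono zero_le_one zero_le_one K.coe_nonneg (sub_nonneg.2 ht.1)
      rw [gronwallBound_x0] at this
      exact zero_le_one.trans this
    have hR0 : 0 ≤ R := (norm_nonneg _).trans (hR b hbI)
    refine isLittleO_iff.2 fun κ hκ => ?_
    have hκ' : 0 < κ / (g₀ + 1) := by positivity
    obtain ⟨δ, hδ, htaylor⟩ := hF.exists_taylor hC hk (κ := κ / (g₀ + 1) / (R + 1)) (by positivity)
    have hε2 : ∀ᶠ ε : ℝ in 𝓝[>] 0, ε * (R + 1) ≤ δ := by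
      have : Tendsto (fun ε : ℝ => ε * (R + 1)) (𝓝[>] 0) (𝓝 0) := by
        simpa using hε0.mul_const (R + 1)
      exact this.eventually (ge_mem_nhds hδ)
    filter_upwards [hsol, hε2, hyb'.bound hκ', self_mem_nhdsWithin] with ε hε hεδ hεb hεpos
    have hεpos : 0 < ε := hεpos
    rw [Real.norm_of_nonneg hεpos.le] at hεb ⊢
    have hgC := huC.mono (c := b) (d := e) (by linarith) (by linarith)
    have hsubI : Icc b e ⊆ Icc (b - 1) (e + 1) := Icc_subset_Icc (by linarith) (by linarith)
    -- The comparison curve is `x + ε Ψ`; its defect is the Taylor remainder of `F` at `x` in the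
    -- direction `ε Ψ`, and `R` bounds `Ψ`.
    have hgr := dist_le_of_approx_trajectories_ODE_of_mem (a := b) (b := e)
      (v := fun r z => F z (Function.rightLim u r)) (s := fun _ => univ) (K := K)
      (f := y ε) (f' := fun r => F (y ε r) (Function.rightLim u r)) (εf := 0)
      (g := fun r => x r + ε • Ψ r) (g' := fun r => F (x r) (Function.rightLim u r)
        + ε • F' (x r) (Function.rightLim u r) (Ψ r)) (εg := ε * (κ / (g₀ + 1)))
      (δ := ε * (κ / (g₀ + 1)))
      (fun r hr => (hF.lipschitzWith (hrl r (Ico_subset_Icc_self hr))).lipschitzOnWith)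
      (hε.continuousOn.mono hsubI)
      (fun r hr => hε.hasDerivWithinAt_rightLim huC hF.continuousOn (mapsTo_univ _ _)
        ⟨by linarith [hr.1], by linarith [hr.2]⟩)
      (fun r hr => by simp) (fun _ _ => trivial)
      (hx.continuousOn.add (hΨ.continuousOn.const_smul ε)) ?_ ?_ (fun _ _ => trivial) ?_ t ht
    · rw [zero_add, show ε * (κ / (g₀ + 1)) = ε * (κ / (g₀ + 1)) * 1 by ring,
        gronwallBound_smul, dist_eq_norm, ← sub_sub] at hgr
      refine hgr.trans ?_
      have : κ / (g₀ + 1) * g₀ ≤ κ := by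
        rw [div_mul_eq_mul_div, div_le_iff₀ (by positivity)]
        nlinarith
      nlinarith
    · intro r hr
      refine (hx.hasDerivWithinAt_rightLim hgC hF.continuousOn (mapsTo_univ _ _) hr).fun_add
        (HasDerivWithinAt.fun_const_smul ε ?_)
      have h1 : Tendsto (fun t => (x t, u t)) (𝓝[>] r) (𝓝 (x r, Function.rightLim u r)) := by
        refine Tendsto.prodMk_nhds ?_ (hgC.tendsto_rightLim hr).1
        exact (hx.continuousOn r (Ico_subset_Icc_self hr)).mono_of_mem_nhdsWithin
          (mem_of_superset (Ioo_mem_nhdsGT hr.2) fun s hs => ⟨hr.1.trans hs.1.le, hs.2.le⟩)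
      exact hΨ.hasDerivWithinAt_Ici (hgC.prodMk hx.continuousOn (mapsTo_univ x (Icc b e)))
        hF.continuousOn_variational (mapsTo_univ _ _) hr h1
        ⟨trivial, hrl r (Ico_subset_Icc_self hr)⟩
    · intro r hr
      have hr' := Ico_subset_Icc_self hr
      have hΨr : ‖ε • Ψ r‖ ≤ ε * (R + 1) := by
        rw [norm_smul, Real.norm_of_nonneg hεpos.le]
        gcongr
        linarith [hR r hr']
      have := htaylor (x r) (mem_image_of_mem x hr') _ (hrl r hr') (ε • Ψ r) (hΨr.trans hεδ)
      rw [dist_comm, dist_eq_norm, ← sub_sub, ← map_smul]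
      refine this.trans ?_
      calc κ / (g₀ + 1) / (R + 1) * ‖ε • Ψ r‖ ≤ κ / (g₀ + 1) / (R + 1) * (ε * (R + 1)) := by
            gcongr
        _ = ε * (κ / (g₀ + 1)) := by field_simp
    · rw [dist_eq_norm, ← sub_sub, mul_comm]
      exact hεb
  have hpt : ∀ t ∈ Icc b e, Tendsto (fun ε => y ε t) (𝓝[>] 0) (𝓝 (x t)) := fun t ht => by
    have := (((hvar t ht).trans_tendsto hε0).add (hε0.smul_const (Ψ t))).add_const (x t)
    simp only [zero_smul, zero_add] at this
    exact this.congr fun ε => by abel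
  -- Compactness makes the convergence uniform on a neighbourhood of `[b, e]`. There the perturbed
  -- solutions stay in `N`, hence by invariance in `M`, where `F` agrees with `f`; the margin `η`
  -- comes from this neighbourhood.
  have hN : {q : ℝ × ℝ | y q.1 q.2 ∈ N} ∈ 𝓝[>] (0 : ℝ) ×ˢ 𝓝ˢ (Icc b e) :=
    isCompact_Icc.mem_prod_nhdsSet_of_forall fun t ht =>
      htend t ht (hpt t ht) (hF.isOpen.mem_nhds (hxN ht))
  obtain ⟨A, hA, V, hV, hAV⟩ := mem_prod_iff.1 hN
  obtain ⟨δ, hδ, hδV⟩ := exists_Icc_subset_of_mem_nhdsSet_Icc hbe hV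
  have hη1 : min δ (1 / 2) ≤ δ := min_le_left _ _
  have hη2 : min δ (1 / 2) ≤ 1 / 2 := min_le_right _ _
  have hη0 : 0 < min δ (1 / 2) := lt_min hδ (by norm_num)
  have hmem : ∀ᶠ ε in 𝓝[>] (0 : ℝ), MapsTo (y ε) (Icc (s ε) (e + min δ (1 / 2))) (M ∩ N) := by
    filter_upwards [hsol, hsI, hA, hpM, hsb.eventually
      (Ioo_mem_nhds (show b - min δ (1 / 2) < b by linarith)
        (show b < e + min δ (1 / 2) by linarith))] with ε hε hεI hεA hεM hεs
    have hεN : MapsTo (y ε) (Icc (s ε) (e + min δ (1 / 2))) N := fun r hr => by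
      have hεr : (ε, r) ∈ A ×ˢ V :=
        ⟨hεA, hδV ⟨by linarith [hr.1, hεs.1], by linarith [hr.2]⟩⟩
      exact hAV hεr
    have h1 := hF.mapsTo_of_isSol hf hCU (huC.mono hεI.1 (by linarith))
      (hε.mono hεI.1 (by linarith)) hεs.2 hεN (by rw [(hy ε hεI).1]; exact hεM)
    exact fun r hr => ⟨h1 hr, hεN hr⟩
  refine ⟨min δ (1 / 2), y, hη0, hsI.mono fun ε h => (hy ε h).1, ?_,
    hmem.mono fun ε h r hr => (h hr).1, fun t ht => htend t ht (hpt t ht),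
    fun t ht hut => hvel t ht hut (hpt t ht), hvar⟩
  filter_upwards [hsol, hsI, hmem] with ε hε hεI hεm
  refine (hε.mono hεI.1 (by linarith)).congr_field fun r hr => ?_
  exact hF.eq _ (hεm (Ioo_subset_Icc_self hr)) _
    (huC.mem r ⟨hεI.1.trans_lt hr.1, by linarith [hr.2]⟩)

end PerturbedFlow

/-! ### Variational equation and tangency -/

section Variation

variable {E G : Type*} [NormedAddCommGroup E] [NormedSpace ℝ E]
  [NormedAddCommGroup G] {M N : Set E} {U C : Set G} {f F : E → G → E} {F' : E → G → E →L[ℝ] E}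
  {B K : NNReal} {u : ℝ → G} {b e : ℝ} {x Ψ : ℝ → E} {s : ℝ → ℝ} {p : ℝ → E} {y : ℝ → ℝ → E}

theorem mem_tangentConeAt_of_isLittleO {p : E} {v : E} {q : ℝ → E}
    (hq : ∀ᶠ ε in 𝓝[>] (0 : ℝ), q ε ∈ M)
    (h : (fun ε => q ε - p - ε • v) =o[𝓝[>] 0] fun ε => ε) : v ∈ tangentConeAt ℝ M p := by
  have hε0 : Tendsto (fun ε : ℝ => ε) (𝓝[>] 0) (𝓝 0) := nhdsWithin_le_nhds
  refine mem_tangentConeAt_of_seq (𝓝[>] (0 : ℝ)) (fun ε => ε⁻¹) (fun ε => q ε - p) ?_ ?_ ?_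
  · have := (h.trans_tendsto hε0).add (hε0.smul_const v)
    simpa using this
  · simpa using hq
  · have h1 : Tendsto (fun ε => ε⁻¹ • (q ε - p - ε • v)) (𝓝[>] 0) (𝓝 0) :=
      h.tendsto_inv_smul_nhds_zero
    have h2 := h1.add_const v
    rw [zero_add] at h2
    refine h2.congr' ?_
    filter_upwards [self_mem_nhdsWithin] with ε hε
    rw [smul_sub _ (q ε - p), inv_smul_smul₀ (ne_of_gt hε), sub_add_cancel]

/-- The derivative within `M` is determined only on tangent vectors. This is why tangency of `Ψ` has
to be known before the equation with `F'` can be read as the equation with `fderivWithin`. -/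
theorem IsExtension.fderivWithin_apply (hF : IsExtension M f C F F' N B K) {p : E} (hp : p ∈ M)
    (hpN : p ∈ N) {c : G} (hc : c ∈ C) {v : E} (hv : v ∈ tangentConeAt ℝ M p) :
    fderivWithin ℝ (fun y => f y c) M p v = F' p c v := by
  have h : HasFDerivWithinAt (fun y => f y c) (F' p c) M p := by
    refine (hF.hasFDerivAt c hc p).hasFDerivWithinAt.congr_of_eventuallyEq ?_
      (hF.eq p ⟨hp, hpN⟩ c hc).symm
    filter_upwards [self_mem_nhdsWithin, mem_nhdsWithin_of_mem_nhds (hF.isOpen.mem_nhds hpN)]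
      with y hy hyN
    exact (hF.eq y ⟨hy, hyN⟩ c hc).symm
  exact h.differentiableWithinAt.hasFDerivWithinAt.eqOn_tangentConeAt h hv

variable [FiniteDimensional ℝ E]

/-- Perturbed solutions of a control system on a submanifold: existence, convergence, and
first-order variation. -/
theorem IsControlField.exists_isPerturbedFlow (hf : IsControlField M U f)
    (hu : IsPiecewiseContinuousInto U u) (hbe : b ≤ e) (hub : ContinuousAt u b)
    (hx : IsSol f u x b e) (hxM : MapsTo x (Icc b e) M)
    (hΨc : ContinuousOn Ψ (Icc b e))
    (hΨT : ∀ t ∈ Icc b e, Ψ t ∈ tangentConeAt ℝ M (x t))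
    (hΨ : ∀ t ∈ Ioo b e, ContinuousAt u t →
      HasDerivAt Ψ (fderivWithin ℝ (fun y => f y (u t)) M (x t) (Ψ t)) t)
    (hs : (fun ε => s ε - b) =O[𝓝[>] 0] fun ε => ε)
    (hp : (fun ε => p ε - x b - (s ε - b) • f (x b) (u b) - ε • Ψ b) =o[𝓝[>] 0] fun ε => ε)
    (hpM : ∀ᶠ ε in 𝓝[>] (0 : ℝ), p ε ∈ M) :
    ∃ η y, IsPerturbedFlow M f u x Ψ b e s p η y := by
  obtain ⟨C, hCU, hC, hCu, huC⟩ := hu.exists_isCompact (b - 1) (e + 1)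
  obtain ⟨F, F', N, B, K, hkN, hF⟩ := hf.exists_isExtension
    (isCompact_Icc.image_of_continuousOn hx.continuousOn) hxM.image_subset hC hCU
  have hxN : MapsTo x (Icc b e) N := fun t ht => hkN (mem_image_of_mem x ht)
  have hCu' : ∀ t ∈ Icc b e, u t ∈ C := fun t ht =>
    hCu t ⟨by linarith [ht.1], by linarith [ht.2]⟩
  refine hF.exists_isPerturbedFlow hf hC hCU hbe huC hub (hx.congr_field fun t ht => ?_) hxM hxN
    ⟨hΨc, fun t ht htc => ?_⟩ hs hp hpM
  · have ht := Ioo_subset_Icc_self ht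
    exact (hF.eq _ ⟨hxM ht, hxN ht⟩ _ (hCu' t ht)).symm
  · have ht' := Ioo_subset_Icc_self ht
    have := hΨ t ht (continuous_snd.continuousAt.comp htc)
    rwa [hF.fderivWithin_apply (hxM ht') (hxN ht') (hCu' t ht') (hΨT t ht')] at this

/-- Existence of solutions of the variational equation that consist of tangent vectors. -/
theorem IsControlField.exists_variation (hf : IsControlField M U f)
    (hu : IsPiecewiseContinuousInto U u) (hbe : b < e) (hub : ContinuousAt u b)
    (hx : IsSol f u x b e) (hxM : MapsTo x (Icc b e) M) {ξ : E}
    (hξ : ξ ∈ tangentConeAt ℝ M (x b)) :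
    ∃ Ψ : ℝ → E, Ψ b = ξ ∧ ContinuousOn Ψ (Icc b e) ∧
      (∀ t ∈ Icc b e, Ψ t ∈ tangentConeAt ℝ M (x t)) ∧
      ∀ t ∈ Ioo b e, ContinuousAt u t →
        HasDerivAt Ψ (fderivWithin ℝ (fun y => f y (u t)) M (x t) (Ψ t)) t := by
  obtain ⟨C, hCU, hC, hCu, huC⟩ := hu.exists_isCompact (b - 1) (e + 1)
  obtain ⟨F, F', N, B, K, hkN, hF⟩ := hf.exists_isExtension
    (isCompact_Icc.image_of_continuousOn hx.continuousOn) hxM.image_subset hC hCU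
  have hbI : b ∈ Icc b e := ⟨le_rfl, hbe.le⟩
  have hxN : MapsTo x (Icc b e) N := fun t ht => hkN (mem_image_of_mem x ht)
  have hCu' : ∀ t ∈ Icc b e, u t ∈ C := fun t ht =>
    hCu t ⟨by linarith [ht.1], by linarith [ht.2]⟩
  -- The linear equation is solved in the ambient space first. Tangency follows by realizing `Ψ` as
  -- the first variation of solutions on `M` that start at `ρ (x b + ε • ξ)`.
  obtain ⟨Ψ, hΨb, hΨ⟩ := exists_isSol_of_lipschitzWith (K := K) (B := 0)
    hF.continuousOn_variational
    (fun q hq => (F' q.1 q.2).lipschitz.weaken (hF.norm_fderiv_le q.2 hq.2 q.1))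
    (fun q _ => by simp) ((huC.mono (by linarith) (by linarith)).prodMk hx.continuousOn
      (mapsTo_univ x (Icc b e))) hbe hbI ξ
  obtain ⟨W, ρ, hW, hbW, hρ, hρM, hρ'⟩ := hf.isSubmanifold.exists_retraction (hxM hbI)
  have hρb : ρ (x b) = x b := (hρ' _ hbW).1 (hxM hbI)
  have hdρ : HasFDerivAt ρ (fderiv ℝ ρ (x b)) (x b) :=
    ((hρ.contDiffAt (hW.mem_nhds hbW)).differentiableAt one_ne_zero).hasFDerivAt
  -- `ρ` is the identity on `M`, so its differential fixes tangent vectors and the retracted line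
  -- has velocity `ξ`.
  have hρξ : fderiv ℝ ρ (x b) ξ = ξ := by
    have h1 : HasFDerivWithinAt ρ (ContinuousLinearMap.id ℝ E) M (x b) := by
      refine (hasFDerivWithinAt_id (x b) M).congr_of_eventuallyEq ?_ hρb
      filter_upwards [self_mem_nhdsWithin, mem_nhdsWithin_of_mem_nhds (hW.mem_nhds hbW)]
        with y hy hyW using (hρ' y hyW).1 hy
    exact hdρ.hasFDerivWithinAt.eqOn_tangentConeAt h1 hξ
  have hline : HasDerivAt (fun ε : ℝ => x b + ε • ξ) ξ 0 := by
    simpa using ((hasDerivAt_id (0 : ℝ)).smul_const ξ).const_add (x b)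
  have hcurve : HasDerivAt (fun ε : ℝ => ρ (x b + ε • ξ)) ξ 0 := by
    have := HasFDerivAt.comp_hasDerivAt_of_eq (0 : ℝ) hdρ hline (by simp)
    rwa [hρξ] at this
  obtain ⟨η, y, hy⟩ := hF.exists_isPerturbedFlow hf hC hCU hbe.le huC hub
    (hx.congr_field fun t ht => (hF.eq _ ⟨hxM (Ioo_subset_Icc_self ht),
      hxN (Ioo_subset_Icc_self ht)⟩ _ (hCu' t (Ioo_subset_Icc_self ht))).symm) hxM hxN hΨ
    (s := fun _ => b) (p := fun ε => ρ (x b + ε • ξ))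
    (by simpa using isBigO_zero _ _)
    (by
      have := hcurve.hasFDerivAt.isLittleO.mono (nhdsWithin_le_nhds (s := Ioi 0))
      simpa [hρb, hΨb] using this)
    (by
      have : ∀ᶠ ε in 𝓝 (0 : ℝ), x b + ε • ξ ∈ W :=
        hline.continuousAt.eventually (hW.mem_nhds (by simpa using hbW))
      exact (this.filter_mono nhdsWithin_le_nhds).mono fun ε h => hρM h)
  have hT : ∀ t ∈ Icc b e, Ψ t ∈ tangentConeAt ℝ M (x t) := fun t ht =>
    mem_tangentConeAt_of_isLittleO
      (hy.mapsTo.mono fun ε h => h ⟨ht.1, ht.2.trans (by linarith [hy.pos])⟩) (hy.variation t ht)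
  refine ⟨Ψ, hΨb, hΨ.continuousOn, hT, fun t ht htu => ?_⟩
  have ht' := Ioo_subset_Icc_self ht
  rw [hF.fderivWithin_apply (hxM ht') (hxN ht') (hCu' t ht') (hT t ht')]
  exact hΨ.hasDerivAt t ht
    ((hx.continuousOn.continuousAt (Icc_mem_nhds ht.1 ht.2)).prodMk htu)

/-- Local existence of solutions on the submanifold. -/
theorem IsControlField.exists_isSol (hf : IsControlField M U f)
    (hu : IsPiecewiseContinuousInto U u) {p : E} (hp : p ∈ M) (b : ℝ) :
    ∃ e > b, ∃ y : ℝ → E, y b = p ∧ IsSol f u y b e ∧ MapsTo y (Icc b e) M := by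
  obtain ⟨C, hCU, hC, hCu, huC⟩ := hu.exists_isCompact b (b + 1)
  obtain ⟨F, F', N, B, K, hkN, hF⟩ := hf.exists_isExtension
    (isCompact_singleton (x := p)) (singleton_subset_iff.2 hp) hC hCU
  obtain ⟨y, hyb, hy⟩ := exists_isSol_of_lipschitzWith hF.continuousOn
    (fun c hc => hF.lipschitzWith hc) (fun c hc => hF.norm_le c hc 0) huC
    (by linarith) (left_mem_Icc.2 (by linarith)) p
  have hbN : y ⁻¹' N ∈ 𝓝[≥] b := by
    refine ((hy.continuousOn b ⟨le_rfl, by linarith⟩).mono_of_mem_nhdsWithin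
      (Icc_mem_nhdsGE (by linarith))) (hF.isOpen.mem_nhds ?_)
    rw [hyb]; exact hkN rfl
  obtain ⟨d, hd, hdN⟩ := mem_nhdsGE_iff_exists_Icc_subset.1 hbN
  have hbe : b < min d (b + 1) := lt_min hd (by linarith)
  have hyN : MapsTo y (Icc b (min d (b + 1))) N := fun t ht =>
    hdN ⟨ht.1, ht.2.trans (min_le_left _ _)⟩
  have hyM := hF.mapsTo_of_isSol hf hCU (huC.mono le_rfl (min_le_right _ _))
    (hy.mono le_rfl (min_le_right _ _)) hbe hyN (hyb ▸ hp)
  refine ⟨_, hbe, y, hyb, (hy.mono le_rfl (min_le_right _ _)).congr_field fun t ht => ?_, hyM⟩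
  exact hF.eq _ ⟨hyM (Ioo_subset_Icc_self ht), hyN (Ioo_subset_Icc_self ht)⟩ _
    (hCu t ⟨ht.1.le, ht.2.le.trans (min_le_right _ _)⟩)

end Variation

/-! ### Guards, exit times and resets -/

section Guard

variable {E E' G : Type*} [NormedAddCommGroup E] [NormedSpace ℝ E]
  [NormedAddCommGroup E'] [NormedSpace ℝ E']
  [NormedAddCommGroup G] {M : Set E} {U : Set G} {f : E → G → E}
  {u : ℝ → G} {b e η t : ℝ} {x Ψ : ℝ → E} {s σ : ℝ → ℝ} {p : ℝ → E} {y : ℝ → ℝ → E} {Φ : E → ℝ}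

/-- A `C¹` function on a submanifold is strictly differentiable along the submanifold. -/
theorem IsEmbeddedSubmanifold.exists_strict_fderiv [FiniteDimensional ℝ E]
    (hM : IsEmbeddedSubmanifold M) {Φ : E → E'}
    (hΦ : ContDiffOn ℝ 1 Φ M) {p : E} (hp : p ∈ M) :
    ∃ Φ' : E →L[ℝ] E', HasFDerivWithinAt Φ Φ' M p ∧
      (fun q : E × E => Φ q.1 - Φ q.2 - Φ' (q.1 - q.2)) =o[𝓝[M] p ×ˢ 𝓝[M] p]
        fun q => q.1 - q.2 := by
  -- `Φ ∘ ρ` is `C¹` on an open set, hence strictly differentiable at `p`, and it agrees with `Φ` on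
  -- `M`.
  obtain ⟨W, ρ, hW, hpW, hρ, hρM, hρ'⟩ := hM.exists_retraction hp
  have hρp : ρ p = p := (hρ' _ hpW).1 hp
  have h1 : ContDiffAt ℝ 1 (Φ ∘ ρ) p := (hΦ.comp hρ hρM).contDiffAt (hW.mem_nhds hpW)
  have h2 := h1.hasStrictFDerivAt one_ne_zero
  have hev : ∀ᶠ q in 𝓝[M] p, ρ q = q := by
    filter_upwards [self_mem_nhdsWithin, mem_nhdsWithin_of_mem_nhds (hW.mem_nhds hpW)]
      with q hq hqW using (hρ' q hqW).1 hq
  refine ⟨fderiv ℝ (Φ ∘ ρ) p, ?_, ?_⟩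
  · refine h2.hasFDerivAt.hasFDerivWithinAt.congr_of_eventuallyEq ?_ (by simp [hρp])
    filter_upwards [hev] with q hq
    simp [hq]
  · have h3 := h2.isLittleO
    rw [nhds_prod_eq] at h3
    refine (h3.mono (prod_mono nhdsWithin_le_nhds nhdsWithin_le_nhds)).congr' ?_ EventuallyEq.rfl
    filter_upwards [hev.prod_mk hev] with q hq
    simp [hq.1, hq.2]

/-- First-order expansion of a function along a curve in a set. -/
theorem DifferentiableWithinAt.isLittleO_comp {Θ : E → E'} {z : E}
    (hΘ : DifferentiableWithinAt ℝ Θ M z) {l : Filter ℝ} {c v : ℝ → E}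
    (hc : Tendsto c l (𝓝[M] z)) (hO : (fun ε => c ε - z) =O[l] fun ε => ε)
    (ho : (fun ε => c ε - z - v ε) =o[l] fun ε => ε) :
    (fun ε => Θ (c ε) - Θ z - fderivWithin ℝ Θ M z (v ε)) =o[l] fun ε => ε := by
  have h1 := (hΘ.hasFDerivWithinAt.isLittleO.comp_tendsto hc).trans_isBigO hO
  have h2 := ((fderivWithin ℝ Θ M z).isBigO_comp _ l).trans_isLittleO ho
  refine (h1.add h2).congr_left fun ε => ?_
  simp only [Function.comp_apply, map_sub]
  abel

namespace IsPerturbedFlow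

theorem eventually_mem (h : IsPerturbedFlow M f u x Ψ b e s p η y) (ht : t ∈ Icc b e) :
    ∀ᶠ q : ℝ × ℝ in 𝓝[>] 0 ×ˢ 𝓝 t, s q.1 ≤ q.2 → y q.1 q.2 ∈ M := by
  filter_upwards [h.mapsTo.prod_mk (Iio_mem_nhds (show t < e + η by linarith [ht.2, h.pos]))]
    with q hq hsq
  exact hq.1 ⟨hsq, (mem_Iio.1 hq.2).le⟩

theorem eventually_guard_ne_zero (h : IsPerturbedFlow M f u x Ψ b e s p η y) (ht : t ∈ Icc b e)
    (hxt : x t ∈ M) (hΦ : ContinuousOn Φ M) (h0 : Φ (x t) ≠ 0) :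
    ∀ᶠ q : ℝ × ℝ in 𝓝[>] 0 ×ˢ 𝓝 t, s q.1 ≤ q.2 → Φ (y q.1 q.2) ≠ 0 := by
  have h1 : ∀ᶠ z in 𝓝 (x t), z ∈ M → Φ z ≠ 0 :=
    eventually_nhdsWithin_iff.1 ((hΦ (x t) hxt).eventually_ne h0)
  filter_upwards [h.eventually_mem ht, (h.tendsto t ht).eventually h1] with q hq hq' hs
  exact hq' (hq hs)

/-- The perturbed states after a reset. -/
theorem isLittleO_reset (h : IsPerturbedFlow M f u x Ψ b e s p η y) (hbe : b < e)
    (hxM : MapsTo x (Icc b e) M) (hs : Tendsto s (𝓝[>] 0) (𝓝 b)) (hue : ContinuousAt u e)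
    (hΦ : ContDiffOn ℝ 1 Φ M) (h0 : Φ (x e) = 0)
    (hD : fderivWithin ℝ Φ M (x e) (f (x e) (u e)) ≠ 0)
    (hσ : (fun ε => σ ε - e) =O[𝓝[>] 0] fun ε => ε)
    (hσ0 : ∀ᶠ ε in 𝓝[>] (0 : ℝ), Φ (y ε (σ ε)) = 0)
    {Ω : E → E'} (hΩ : ContDiffOn ℝ 1 Ω M) (v : E') :
    (fun ε => Ω (y ε (σ ε)) - Ω (x e) - (σ ε - e) • v
      - ε • (fderivWithin ℝ Ω M (x e) (Ψ e
          - ((fderivWithin ℝ Φ M (x e) (f (x e) (u e)))⁻¹ * fderivWithin ℝ Φ M (x e) (Ψ e))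
            • f (x e) (u e))
        + ((fderivWithin ℝ Φ M (x e) (f (x e) (u e)))⁻¹ * fderivWithin ℝ Φ M (x e) (Ψ e)) • v))
      =o[𝓝[>] 0] fun ε => ε := by
  set D := fderivWithin ℝ Φ M (x e) (f (x e) (u e)) with hDdef
  have heI : e ∈ Icc b e := ⟨hbe.le, le_rfl⟩
  have hε0 : Tendsto (fun ε : ℝ => ε) (𝓝[>] 0) (𝓝 0) := nhdsWithin_le_nhds
  have hσe : Tendsto σ (𝓝[>] 0) (𝓝 e) := by
    simpa using (hσ.trans_tendsto hε0).add_const e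
  have hvO : ∀ w : E, (fun ε : ℝ => ε • w) =O[𝓝[>] 0] fun ε => ε := fun w => by
    refine IsBigO.of_bound ‖w‖ (Eventually.of_forall fun ε => ?_)
    rw [norm_smul, mul_comm]
  have hy : (fun ε => y ε (σ ε) - x e - (σ ε - e) • f (x e) (u e) - ε • Ψ e)
      =o[𝓝[>] 0] fun ε => ε := by
    have h1 := ((h.velocity e heI hue).comp_tendsto
      (tendsto_id.prodMk (hσe.prodMk (tendsto_const_nhds (x := e))))).trans_isBigO hσ
    refine (h1.add (h.variation e heI)).congr_left fun ε => ?_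
    simp only [Function.comp_apply, id]
    abel
  have hyO : (fun ε => y ε (σ ε) - x e) =O[𝓝[>] 0] fun ε : ℝ => ε := by
    have h1 : (fun ε => (σ ε - e) • f (x e) (u e)) =O[𝓝[>] 0] fun ε => ε := by
      refine IsBigO.trans (IsBigO.of_bound ‖f (x e) (u e)‖ (Eventually.of_forall fun ε => ?_)) hσ
      rw [norm_smul, mul_comm]
    refine ((hy.isBigO.add h1).add (hvO (Ψ e))).congr_left fun ε => ?_
    abel
  have hyM : Tendsto (fun ε => y ε (σ ε)) (𝓝[>] 0) (𝓝[M] (x e)) := by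
    refine tendsto_nhdsWithin_iff.2 ⟨?_, ?_⟩
    · simpa using (hyO.trans_tendsto hε0).add_const (x e)
    · filter_upwards [h.mapsTo, hs.eventually (Iio_mem_nhds (show b < (b + e) / 2 by linarith)),
        hσe.eventually (Ioo_mem_nhds (show (b + e) / 2 < e by linarith)
          (show e < e + η by linarith [h.pos]))] with ε h1 h2 h3
      exact h1 ⟨(lt_trans h2 h3.1).le, h3.2.le⟩
  have hdiff : DifferentiableWithinAt ℝ Φ M (x e) := hΦ.differentiableOn one_ne_zero _ (hxM heI)
  have hdiff' : DifferentiableWithinAt ℝ Ω M (x e) := hΩ.differentiableOn one_ne_zero _ (hxM heI)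
  have hy' : (fun ε => y ε (σ ε) - x e - ((σ ε - e) • f (x e) (u e) + ε • Ψ e))
      =o[𝓝[>] 0] fun ε => ε := hy.congr_left fun ε => by abel
  -- Linearizing `Φ (y ε (σ ε)) = 0` determines the shift of the exit time to first order.
  have hσD : (fun ε => (σ ε - e) + ε * (D⁻¹ * fderivWithin ℝ Φ M (x e) (Ψ e)))
      =o[𝓝[>] 0] fun ε => ε := by
    refine ((hdiff.isLittleO_comp hyM hyO hy').const_mul_left (-D⁻¹)).congr' ?_ EventuallyEq.rfl
    filter_upwards [hσ0] with ε hε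
    rw [hε, h0, map_add, map_smul, map_smul, ← hDdef]
    simp only [smul_eq_mul]
    field_simp
    ring
  -- The expansion of `Ω` and the claimed one differ exactly by this multiple of `DΩ f⁻ - v`, whose
  -- coefficient is the remainder in the exit time. The vector `v` is arbitrary here; the choice `v
  -- = f⁺` produces the variational reset.
  have h3 : (fun ε => ((σ ε - e) + ε * (D⁻¹ * fderivWithin ℝ Φ M (x e) (Ψ e))) •
      (fderivWithin ℝ Ω M (x e) (f (x e) (u e)) - v)) =o[𝓝[>] 0] fun ε => ε := by
    refine IsBigO.trans_isLittleO (IsBigO.of_bound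
      ‖fderivWithin ℝ Ω M (x e) (f (x e) (u e)) - v‖ (Eventually.of_forall fun ε => ?_)) hσD
    rw [norm_smul, mul_comm]
  refine ((hdiff'.isLittleO_comp hyM hyO hy').add h3).congr_left fun ε => ?_
  simp only [map_sub, map_add, map_smul]
  module

variable [FiniteDimensional ℝ E]

/-- Strict differentiability of `Φ` along `M` composed with `velocity`. The principal filter
restricts to times from `s ε` on, since only there the perturbed solution is known to lie in `M`. -/
theorem isLittleO_guard (h : IsPerturbedFlow M f u x Ψ b e s p η y)
    (hM : IsEmbeddedSubmanifold M) (ht : t ∈ Icc b e)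
    (hxt : x t ∈ M) (hut : ContinuousAt u t) (hft : f (x t) (u t) ∈ tangentConeAt ℝ M (x t))
    (hΦ : ContDiffOn ℝ 1 Φ M) :
    (fun q : ℝ × ℝ × ℝ => Φ (y q.1 q.2.1) - Φ (y q.1 q.2.2)
        - (q.2.1 - q.2.2) * fderivWithin ℝ Φ M (x t) (f (x t) (u t)))
      =o[(𝓝[>] 0 ×ˢ 𝓝 t ×ˢ 𝓝 t) ⊓ 𝓟 {q | s q.1 ≤ q.2.1 ∧ s q.1 ≤ q.2.2}]
        fun q => q.2.1 - q.2.2 := by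
  obtain ⟨Φ', hΦ', hstrict⟩ := hM.exists_strict_fderiv hΦ hxt
  rw [hΦ'.differentiableWithinAt.hasFDerivWithinAt.eqOn_tangentConeAt hΦ' hft]
  set l : Filter (ℝ × ℝ × ℝ) :=
    (𝓝[>] 0 ×ˢ 𝓝 t ×ˢ 𝓝 t) ⊓ 𝓟 {q | s q.1 ≤ q.2.1 ∧ s q.1 ≤ q.2.2}
  have hl : l ≤ 𝓝[>] 0 ×ˢ 𝓝 t ×ˢ 𝓝 t := inf_le_left
  have hl1 : Tendsto (fun q : ℝ × ℝ × ℝ => (q.1, q.2.1)) l (𝓝[>] 0 ×ˢ 𝓝 t) :=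
    (tendsto_fst.prodMk (tendsto_fst.comp tendsto_snd)).mono_left hl
  have hl2 : Tendsto (fun q : ℝ × ℝ × ℝ => (q.1, q.2.2)) l (𝓝[>] 0 ×ˢ 𝓝 t) :=
    (tendsto_fst.prodMk (tendsto_snd.comp tendsto_snd)).mono_left hl
  have hle : ∀ᶠ q in l, s q.1 ≤ q.2.1 ∧ s q.1 ≤ q.2.2 := mem_inf_of_right (mem_principal_self _)
  have hy1 : Tendsto (fun q : ℝ × ℝ × ℝ => y q.1 q.2.1) l (𝓝[M] (x t)) :=
    tendsto_nhdsWithin_iff.2 ⟨(h.tendsto t ht).comp hl1, by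
      filter_upwards [hl1.eventually (h.eventually_mem ht), hle] with q h1 h2 using h1 h2.1⟩
  have hy2 : Tendsto (fun q : ℝ × ℝ × ℝ => y q.1 q.2.2) l (𝓝[M] (x t)) :=
    tendsto_nhdsWithin_iff.2 ⟨(h.tendsto t ht).comp hl2, by
      filter_upwards [hl2.eventually (h.eventually_mem ht), hle] with q h1 h2 using h1 h2.2⟩
  have hv := (h.velocity t ht hut).mono hl
  have hO : (fun q : ℝ × ℝ × ℝ => y q.1 q.2.1 - y q.1 q.2.2) =O[l] fun q => q.2.1 - q.2.2 := by
    have h1 : (fun q : ℝ × ℝ × ℝ => (q.2.1 - q.2.2) • f (x t) (u t)) =O[l]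
        fun q => q.2.1 - q.2.2 := by
      refine IsBigO.of_bound ‖f (x t) (u t)‖ (Eventually.of_forall fun q => ?_)
      rw [norm_smul, mul_comm]
    simpa using hv.isBigO.add h1
  have h1 := (hstrict.comp_tendsto (hy1.prodMk hy2)).trans_isBigO hO
  have h2 := (Φ'.isBigO_comp _ l).trans_isLittleO hv
  refine (h1.add h2).congr_left fun q => ?_
  simp only [Function.comp_apply, map_sub, map_smul, smul_eq_mul]
  ring

/-- A guard that the trajectory crosses with nonzero speed takes distinct values at distinct
times. -/
theorem eventually_guard_ne (h : IsPerturbedFlow M f u x Ψ b e s p η y)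
    (hM : IsEmbeddedSubmanifold M) (ht : t ∈ Icc b e)
    (hxt : x t ∈ M) (hut : ContinuousAt u t) (hft : f (x t) (u t) ∈ tangentConeAt ℝ M (x t))
    (hΦ : ContDiffOn ℝ 1 Φ M) (hD : fderivWithin ℝ Φ M (x t) (f (x t) (u t)) ≠ 0) :
    ∀ᶠ q : ℝ × ℝ × ℝ in 𝓝[>] 0 ×ˢ 𝓝 t ×ˢ 𝓝 t, s q.1 ≤ q.2.1 → s q.1 ≤ q.2.2 →
      q.2.1 ≠ q.2.2 → Φ (y q.1 q.2.1) ≠ Φ (y q.1 q.2.2) := by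
  have h1 := (h.isLittleO_guard hM ht hxt hut hft hΦ).bound (half_pos (abs_pos.2 hD))
  rw [eventually_inf_principal] at h1
  filter_upwards [h1] with q hq hq1 hq2 hne heq
  have h2 := hq ⟨hq1, hq2⟩
  rw [heq, sub_self, zero_sub, norm_neg, norm_mul, Real.norm_eq_abs, Real.norm_eq_abs] at h2
  have h3 : 0 < |q.2.1 - q.2.2| := abs_pos.2 (sub_ne_zero.2 hne)
  nlinarith [mul_pos h3 (abs_pos.2 hD)]

/-- A guard that is nonzero along a trajectory stays nonzero along perturbed trajectories; it may
vanish at the initial or final point provided that it is crossed there with nonzero speed. -/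
theorem eventually_forall_guard_ne_zero (h : IsPerturbedFlow M f u x Ψ b e s p η y)
    (hf : IsControlField M U f) (hu : IsPiecewiseContinuousInto U u) (hbe : b ≤ e)
    (hxM : MapsTo x (Icc b e) M) (hub : ContinuousAt u b) (hs : Tendsto s (𝓝[>] 0) (𝓝 b))
    (hσ : Tendsto σ (𝓝[>] 0) (𝓝 e)) (hΦ : ContDiffOn ℝ 1 Φ M)
    (hmid : ∀ t ∈ Ioo b e, Φ (x t) ≠ 0)
    (hb : Φ (x b) ≠ 0 ∨ ((∀ᶠ ε in 𝓝[>] (0 : ℝ), Φ (p ε) = 0) ∧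
      fderivWithin ℝ Φ M (x b) (f (x b) (u b)) ≠ 0))
    (he : Φ (x e) ≠ 0 ∨ (ContinuousAt u e ∧ (∀ᶠ ε in 𝓝[>] (0 : ℝ), Φ (y ε (σ ε)) = 0) ∧
      fderivWithin ℝ Φ M (x e) (f (x e) (u e)) ≠ 0)) :
    ∀ᶠ ε in 𝓝[>] (0 : ℝ), ∀ r ∈ Ioo (s ε) (σ ε), Φ (y ε r) ≠ 0 := by
  have hft : ∀ t ∈ Icc b e, f (x t) (u t) ∈ tangentConeAt ℝ M (x t) := fun t ht =>
    hf.tangent _ (hxM ht) _ (hu t).1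
  have hnz : ∀ t ∈ Icc b e, Φ (x t) ≠ 0 →
      {q : ℝ × ℝ | q.2 ∈ Ioo (s q.1) (σ q.1) → Φ (y q.1 q.2) ≠ 0} ∈ 𝓝[>] 0 ×ˢ 𝓝 t :=
    fun t ht h0 => (h.eventually_guard_ne_zero ht (hxM ht) hΦ.continuousOn h0).mono
      fun q hq hq' => hq hq'.1.le
  -- If the nominal guard vanishes, this happens at an end of the interval. There the perturbed
  -- guard is zero at `s ε` or `σ ε` itself, and injectivity in time excludes other zeros nearby.
  have hloc : ∀ t ∈ Icc b e,
      {q : ℝ × ℝ | q.2 ∈ Ioo (s q.1) (σ q.1) → Φ (y q.1 q.2) ≠ 0} ∈ 𝓝[>] 0 ×ˢ 𝓝 t := by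
    intro t ht
    rcases eq_or_ne (Φ (x t)) 0 with h0 | h0
    swap
    · exact hnz t ht h0
    rcases ht.1.eq_or_lt with rfl | hbt
    · obtain ⟨hp, hD⟩ := hb.resolve_left (not_not.2 h0)
      have h1 := h.eventually_guard_ne hf.isSubmanifold ht (hxM ht) hub (hft _ ht) hΦ hD
      have h2 : Tendsto (fun q : ℝ × ℝ => (q.1, q.2, s q.1)) (𝓝[>] 0 ×ˢ 𝓝 b)
          (𝓝[>] 0 ×ˢ 𝓝 b ×ˢ 𝓝 b) :=
        tendsto_fst.prodMk (tendsto_snd.prodMk (hs.comp tendsto_fst))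
      filter_upwards [h2.eventually h1, tendsto_fst.eventually (hp.and h.start)] with q hq hq' hr
      have := hq hr.1.le le_rfl hr.1.ne'
      rwa [hq'.2, hq'.1] at this
    rcases ht.2.eq_or_lt with rfl | hte
    · obtain ⟨hut, hy0, hD⟩ := he.resolve_left (not_not.2 h0)
      have h1 := h.eventually_guard_ne hf.isSubmanifold ht (hxM ht) hut (hft _ ht) hΦ hD
      have h2 : Tendsto (fun q : ℝ × ℝ => (q.1, q.2, σ q.1)) (𝓝[>] 0 ×ˢ 𝓝 t)
          (𝓝[>] 0 ×ˢ 𝓝 t ×ˢ 𝓝 t) :=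
        tendsto_fst.prodMk (tendsto_snd.prodMk (hσ.comp tendsto_fst))
      filter_upwards [h2.eventually h1, tendsto_fst.eventually hy0] with q hq hq' hr
      have := hq hr.1.le (hr.1.trans hr.2).le hr.2.ne
      rwa [hq'] at this
    · exact absurd h0 (hmid t ⟨hbt, hte⟩)
  obtain ⟨A, hA, V, hV, hAV⟩ := mem_prod_iff.1 (isCompact_Icc.mem_prod_nhdsSet_of_forall hloc)
  obtain ⟨δ, hδ, hδV⟩ := exists_Icc_subset_of_mem_nhdsSet_Icc hbe hV
  filter_upwards [hA, hs.eventually (Ioi_mem_nhds (show b - δ < b by linarith)),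
    hσ.eventually (Iio_mem_nhds (show e < e + δ by linarith))] with ε hεA h1 h2 r hr
  have hεr : (ε, r) ∈ A ×ˢ V :=
    ⟨hεA, hδV ⟨(lt_trans h1 hr.1).le, (lt_trans hr.2 h2).le⟩⟩
  exact hAV hεr hr

/-- Perturbed trajectories reach a transversal guard, at a nearby time. -/
theorem exists_exit_time (h : IsPerturbedFlow M f u x Ψ b e s p η y)
    (hf : IsControlField M U f) (hu : IsPiecewiseContinuousInto U u) (hbe : b < e)
    (hxM : MapsTo x (Icc b e) M) (hs : Tendsto s (𝓝[>] 0) (𝓝 b)) (hue : ContinuousAt u e)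
    (hΦ : ContDiffOn ℝ 1 Φ M) (h0 : Φ (x e) = 0)
    (hD : fderivWithin ℝ Φ M (x e) (f (x e) (u e)) ≠ 0) :
    ∃ σ : ℝ → ℝ, (fun ε => σ ε - e) =O[𝓝[>] 0] (fun ε => ε) ∧
      ∀ᶠ ε in 𝓝[>] (0 : ℝ), Φ (y ε (σ ε)) = 0 := by
  set D := fderivWithin ℝ Φ M (x e) (f (x e) (u e)) with hDdef
  have heI : e ∈ Icc b e := ⟨hbe.le, le_rfl⟩
  have hε0 : Tendsto (fun ε : ℝ => ε) (𝓝[>] 0) (𝓝 0) := nhdsWithin_le_nhds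
  have hse : ∀ᶠ ε in 𝓝[>] (0 : ℝ), s ε < (b + e) / 2 := hs.eventually (Iio_mem_nhds (by linarith))
  have hyO : (fun ε => y ε e - x e) =O[𝓝[>] 0] fun ε : ℝ => ε := by
    have h1 : (fun ε : ℝ => ε • Ψ e) =O[𝓝[>] 0] fun ε => ε := by
      refine IsBigO.of_bound ‖Ψ e‖ (Eventually.of_forall fun ε => ?_)
      rw [norm_smul, mul_comm]
    simpa using (h.variation e heI).isBigO.add h1
  have hyM : Tendsto (fun ε => y ε e) (𝓝[>] 0) (𝓝[M] (x e)) := by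
    refine tendsto_nhdsWithin_iff.2 ⟨?_, ?_⟩
    · simpa using (hyO.trans_tendsto hε0).add_const (x e)
    · filter_upwards [h.mapsTo, hse] with ε h1 h2
      exact h1 ⟨by linarith, by linarith [h.pos]⟩
  have hγ : (fun ε => Φ (y ε e)) =O[𝓝[>] 0] fun ε : ℝ => ε := by
    have h1 := ((hΦ.differentiableOn one_ne_zero _ (hxM heI)).hasFDerivWithinAt.isBigO_sub.comp_tendsto
      hyM).trans hyO
    refine h1.congr_left fun ε => ?_
    simp [h0]
  obtain ⟨c, hc, hγc⟩ := hγ.exists_pos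
  have hD' : 0 < |D| := abs_pos.2 hD
  -- The guard at time `e` is at most `c ε`. Over a time `m ε` it changes by at least `(|D| / 2) m ε
  -- = (c + |D| / 2) ε`, in opposite directions before and after `e`, so it changes sign.
  set m := 2 * c / |D| + 1 with hm
  have hm0 : 0 < m := by positivity
  have hDm : |D| / 2 * m = c + |D| / 2 := by rw [hm]; field_simp
  have hguard := (h.isLittleO_guard hf.isSubmanifold heI (hxM heI) hue
    (hf.tangent _ (hxM heI) _ (hu e).1) hΦ).bound (half_pos hD')
  rw [eventually_inf_principal] at hguard
  have hmε : Tendsto (fun ε : ℝ => m * ε) (𝓝[>] 0) (𝓝 0) := by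
    simpa using hε0.const_mul m
  have hplus := (tendsto_id.prodMk (Tendsto.prodMk
    (show Tendsto (fun ε : ℝ => e + m * ε) (𝓝[>] 0) (𝓝 e) by simpa using hmε.const_add e)
    (tendsto_const_nhds (x := e)))).eventually hguard
  have hminus := (tendsto_id.prodMk (Tendsto.prodMk
    (show Tendsto (fun ε : ℝ => e - m * ε) (𝓝[>] 0) (𝓝 e) by simpa using hmε.const_sub e)
    (tendsto_const_nhds (x := e)))).eventually hguard
  have hsmall : ∀ᶠ ε : ℝ in 𝓝[>] 0, m * ε < min η ((e - b) / 2) :=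
    hmε.eventually (Iio_mem_nhds (lt_min h.pos (by linarith)))
  have key : ∀ᶠ ε in 𝓝[>] (0 : ℝ), ∃ r, |r - e| ≤ m * ε ∧ Φ (y ε r) = 0 := by
    filter_upwards [hplus, hminus, hsmall, hse, h.mapsTo, h.isSol, hγc.bound,
      self_mem_nhdsWithin] with ε h1 h2 h3 h4 h5 h6 h7 hε
    have hε : 0 < ε := hε
    have h3a := h3.trans_le (min_le_left _ _)
    have h3b := h3.trans_le (min_le_right _ _)
    have hmε := mul_pos hm0 hε
    have h1' := h1 ⟨by simp only [id]; linarith, by simp only [id]; linarith⟩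
    have h2' := h2 ⟨by simp only [id]; linarith, by simp only [id]; linarith⟩
    simp only [id, add_sub_cancel_left, sub_sub_cancel_left, Real.norm_eq_abs, abs_neg,
      abs_of_pos hmε] at h1' h2'
    rw [Real.norm_eq_abs, Real.norm_of_nonneg hε.le] at h7
    rw [← mul_assoc, hDm] at h1' h2'
    have hcont : ContinuousOn (fun r => Φ (y ε r)) (Icc (e - m * ε) (e + m * ε)) := by
      have hsub : Icc (e - m * ε) (e + m * ε) ⊆ Icc (s ε) (e + η) :=
        Icc_subset_Icc (by linarith) (by linarith)
      exact hΦ.continuousOn.comp (h6.continuousOn.mono hsub) (h5.mono_left hsub)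
    have hz : (0 : ℝ) ∈ (fun r => Φ (y ε r)) '' Icc (e - m * ε) (e + m * ε) := by
      obtain ⟨h7a, h7b⟩ := abs_le.1 h7
      obtain ⟨h1a, h1b⟩ := abs_le.1 h1'
      obtain ⟨h2a, h2b⟩ := abs_le.1 h2'
      have hle : e - m * ε ≤ e + m * ε := by linarith
      have hmD : m * ε * (|D| / 2) = (c + |D| / 2) * ε := by rw [← hDm]; ring
      have hDε : 0 < |D| * ε := mul_pos hD' hε
      rcases lt_or_gt_of_ne hD with hneg | hpos
      · rw [abs_of_neg hneg] at *
        exact intermediate_value_Icc' hle hcont ⟨by nlinarith, by nlinarith⟩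
      · rw [abs_of_pos hpos] at *
        exact intermediate_value_Icc hle hcont ⟨by nlinarith, by nlinarith⟩
    obtain ⟨r, hr, hr0⟩ := hz
    exact ⟨r, abs_le.2 ⟨by linarith [hr.1], by linarith [hr.2]⟩, hr0⟩
  have hch : ∀ ε, ∃ r, (∃ r, |r - e| ≤ m * ε ∧ Φ (y ε r) = 0) → |r - e| ≤ m * ε ∧ Φ (y ε r) = 0 :=
    fun ε => by
      by_cases hex : ∃ r, |r - e| ≤ m * ε ∧ Φ (y ε r) = 0
      · exact ⟨hex.choose, fun _ => hex.choose_spec⟩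
      · exact ⟨0, fun h => absurd h hex⟩
  choose σ hσ using hch
  refine ⟨σ, IsBigO.of_bound m ?_, key.mono fun ε hε => (hσ ε hε).2⟩
  filter_upwards [key, self_mem_nhdsWithin] with ε hε hpos
  rw [Real.norm_eq_abs, Real.norm_of_nonneg (le_of_lt hpos)]
  exact (hσ ε hε).1

end IsPerturbedFlow

end Guard

/-! ### Operations on hybrid trajectories and their uniqueness -/

namespace HybridSystem

variable {Q : Type*} {H : HybridSystem Q}

theorem isControlField (q : Q) : IsControlField (H.M q) (H.U q) (H.f q) :=
  ⟨H.isSubmanifold q, H.f_tangent q, H.f_continuous q, H.f_differentiable q⟩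

section Control

variable {u : H.Control} {q₀ q : Q} {w : H.ControlSpace q₀} {τ a ε t : ℝ}

theorem perturbedControl_of_notMem (ht : t ∉ Icc (τ - ε * a) τ) :
    H.perturbedControl u q₀ w τ a ε q t = u q t := by
  classical
  unfold perturbedControl
  rcases eq_or_ne q q₀ with rfl | hq
  · rw [Function.update_self, if_neg ht]
  · rw [Function.update_of_ne hq]

theorem perturbedControl_of_mem (ht : t ∈ Icc (τ - ε * a) τ) :
    H.perturbedControl u q₀ w τ a ε q₀ t = w := by
  classical
  unfold perturbedControl
  rw [Function.update_self, if_pos ht]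

theorem IsAdmissible.perturbedControl (hu : H.IsAdmissible u) (hw : w ∈ H.U q₀) :
    H.IsAdmissible (H.perturbedControl u q₀ w τ a ε) := by
  classical
  intro q
  unfold HybridSystem.perturbedControl
  rcases eq_or_ne q q₀ with rfl | hq
  · rw [Function.update_self]
    exact (hu q).ite_mem_Icc hw _ _
  · rw [Function.update_of_ne hq]
    exact hu q

end Control

namespace IsTrajectory

variable {u v : H.Control} {t₀ t_f T T' : ℝ} {loc : ℕ → Q} {r i j : ℕ}
  {x₀ : H.StateSpace (loc 0)} {X Y : H.Trajectory loc}

theorem isSol (hX : H.IsTrajectory u t₀ t_f loc r x₀ X) (hi : i ≤ r) :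
    IsSol (H.f (loc i)) (u (loc i)) (X.state i) (X.time i) (X.time (i + 1)) :=
  ⟨hX.continuousOn i hi, hX.hasDerivAt i hi⟩

theorem time_lt_of_lt (hX : H.IsTrajectory u t₀ t_f loc r x₀ X) (hij : i < j) (hj : j ≤ r + 1) :
    X.time i < X.time j := by
  induction j, hij using Nat.le_induction with
  | base => exact hX.time_lt i (by omega)
  | succ j hij ih => exact (ih (by omega)).trans (hX.time_lt j (by omega))

theorem time_le_of_le (hX : H.IsTrajectory u t₀ t_f loc r x₀ X) (hij : i ≤ j) (hj : j ≤ r + 1) :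
    X.time i ≤ X.time j := by
  rcases hij.eq_or_lt with rfl | h
  · rfl
  · exact (hX.time_lt_of_lt h hj).le

/-- A trajectory can be stopped, and the controls changed at later times. -/
theorem truncate (hX : H.IsTrajectory u t₀ t_f loc r x₀ X) {k : ℕ} (hk : k ≤ r)
    (hT : T ∈ Ioo (X.time k) (X.time (k + 1))) (huv : ∀ q, EqOn (u q) (v q) (Iio T)) :
    H.IsTrajectory v t₀ T loc k x₀ ⟨Function.update X.time (k + 1) T, X.state⟩ := by
  have htime : ∀ i ≤ k, Function.update X.time (k + 1) T i = X.time i := fun i hi =>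
    Function.update_of_ne (by omega) _ _
  have hle : ∀ i ≤ k, Function.update X.time (k + 1) T (i + 1) ≤ X.time (i + 1) := fun i hi => by
    rcases hi.eq_or_lt with rfl | h
    · rw [Function.update_self]; exact hT.2.le
    · rw [htime _ h]
  have hleT : ∀ i ≤ k, Function.update X.time (k + 1) T (i + 1) ≤ T := fun i hi => by
    rcases hi.eq_or_lt with rfl | h
    · rw [Function.update_self]
    · rw [htime _ h]; exact (hX.time_le_of_le h (by omega)).trans hT.1.le
  have hsol : ∀ i ≤ k, IsSol (H.f (loc i)) (v (loc i)) (X.state i) (X.time i)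
      (Function.update X.time (k + 1) T (i + 1)) := fun i hi =>
    ((hX.isSol (hi.trans hk)).mono le_rfl (hle i hi)).congr_signal fun t ht =>
      huv _ (ht.2.trans_le (hleT i hi))
  constructor
  · exact (htime 0 (Nat.zero_le _)).trans hX.time_zero
  · exact Function.update_self ..
  · intro i hi
    dsimp only
    rw [htime i hi]
    rcases hi.eq_or_lt with rfl | h
    · rw [Function.update_self]; exact hT.1
    · rw [htime _ h]; exact hX.time_lt i (by omega)
  · exact hX.init
  · intro i hi t ht
    dsimp only at ht ⊢
    rw [htime i hi] at ht
    exact hX.mem i (hi.trans hk) t ⟨ht.1, ht.2.trans (hle i hi)⟩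
  · intro i hi
    dsimp only
    rw [htime i hi]
    exact (hsol i hi).continuousOn
  · intro i hi t ht
    dsimp only at ht ⊢
    rw [htime i hi] at ht
    exact (hsol i hi).hasDerivAt t ht
  · intro i hi t ht
    dsimp only at ht ⊢
    rw [htime i hi] at ht
    exact hX.guard_ne_zero i (hi.trans hk) t ⟨ht.1, ht.2.trans_le (hle i hi)⟩
  · exact fun i hi => hX.edge i (hi.trans_le hk)
  · intro i hi
    dsimp only
    rw [htime _ hi]
    exact hX.guard_eq_zero i (hi.trans_le hk)
  · intro i hi
    dsimp only
    rw [htime _ hi]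
    exact hX.reset i (hi.trans_le hk)

/-- The last segment of a trajectory can be prolonged by a solution of its equation. -/
theorem prolong (hX : H.IsTrajectory u t₀ T loc r x₀ X) (hu : H.IsAdmissible u) (hTT' : T < T')
    {y : ℝ → H.StateSpace (loc r)} (hy : IsSol (H.f (loc r)) (u (loc r)) y T T')
    (hyM : MapsTo y (Icc T T') (H.M (loc r))) (hyT : y T = X.state r T)
    (hyΦ : ∀ t ∈ Ico T T', ∀ q, H.Edge (loc r) q → H.Φ (loc r) q (y t) ≠ 0) :
    H.IsTrajectory u t₀ T' loc r x₀ ⟨Function.update X.time (r + 1) T',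
      Function.update X.state r fun t => if t ≤ T then X.state r t else y t⟩ := by
  have htime : ∀ i ≤ r, Function.update X.time (r + 1) T' i = X.time i := fun i hi =>
    Function.update_of_ne (by omega) _ _
  have hstate : ∀ i, i ≠ r → Function.update X.state r
      (fun t => if t ≤ T then X.state r t else y t) i = X.state i := fun i hi =>
    Function.update_of_ne hi _ _
  have hstate' : ∀ i, ∀ t ≤ T, Function.update X.state r
      (fun t => if t ≤ T then X.state r t else y t) i t = X.state i t := fun i t ht => by
    rcases eq_or_ne i r with rfl | h
    · rw [Function.update_self, if_pos ht]
    · rw [hstate i h]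
  have hleT : ∀ i ≤ r + 1, X.time i ≤ T := fun i hi =>
    hX.time_last ▸ hX.time_le_of_le hi le_rfl
  have hrT : X.time r < T := hX.time_last ▸ hX.time_lt r le_rfl
  have hsol : IsSol (H.f (loc r)) (u (loc r)) (X.state r) (X.time r) T :=
    hX.time_last ▸ hX.isSol le_rfl
  have hmem : MapsTo (X.state r) (Icc (X.time r) T) (H.M (loc r)) :=
    hX.time_last ▸ hX.mem r le_rfl
  have hglue := hsol.glue hy hrT hTT' hyT.symm ((hu (loc r)).piecewiseContinuousOn _ _)
    (H.f_continuous _) hmem hyM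
  constructor
  · exact (htime 0 (Nat.zero_le _)).trans hX.time_zero
  · exact Function.update_self ..
  · intro i hi
    dsimp only
    rw [htime i hi]
    rcases hi.eq_or_lt with rfl | h
    · rw [Function.update_self]; exact hrT.trans hTT'
    · rw [htime _ h]; exact hX.time_lt i (by omega)
  · dsimp only
    rw [hstate' 0 _ (hX.time_zero ▸ hleT 0 (by omega))]
    exact hX.init
  · intro i hi t ht
    dsimp only at ht ⊢
    rw [htime i hi] at ht
    rcases hi.eq_or_lt with rfl | h
    · simp only [Function.update_self] at ht ⊢
      split_ifs with h
      · exact hmem ⟨ht.1, h⟩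
      · exact hyM ⟨(not_le.1 h).le, ht.2⟩
    · simp only [hstate i h.ne]
      exact hX.mem i hi t (by rwa [htime _ h] at ht)
  · intro i hi
    dsimp only
    rw [htime i hi]
    rcases hi.eq_or_lt with rfl | h
    · simp only [Function.update_self]
      exact hglue.continuousOn
    · rw [hstate i h.ne, htime _ h]
      exact hX.continuousOn i hi
  · intro i hi t ht
    dsimp only at ht ⊢
    rw [htime i hi] at ht
    rcases hi.eq_or_lt with rfl | h
    · simp only [Function.update_self] at ht ⊢
      exact hglue.hasDerivAt t ht
    · simp only [hstate i h.ne]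
      exact hX.hasDerivAt i hi t (by rwa [htime _ h] at ht)
  · intro i hi t ht
    dsimp only at ht ⊢
    rw [htime i hi] at ht
    rcases hi.eq_or_lt with rfl | h
    · simp only [Function.update_self] at ht ⊢
      split_ifs with h
      -- The former end point `T` becomes an interior time, so the guards must not vanish there;
      -- this is why `hyΦ` includes `T`.
      · rcases h.eq_or_lt with rfl | h
        · rw [← hyT]
          exact hyΦ t ⟨le_rfl, hTT'⟩
        · exact hX.guard_ne_zero i le_rfl t ⟨ht.1, by rwa [hX.time_last]⟩
      · exact hyΦ t ⟨(not_le.1 h).le, ht.2⟩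
    · simp only [hstate i h.ne]
      exact hX.guard_ne_zero i hi t (by rwa [htime _ h] at ht)
  · exact hX.edge
  · intro i hi
    dsimp only
    rw [htime _ hi, hstate i hi.ne]
    exact hX.guard_eq_zero i hi
  · intro i hi
    dsimp only
    rw [htime _ hi, hstate i hi.ne, hstate' _ _ (hleT _ (by omega))]
    exact hX.reset i hi

/-- A segment can be appended to a trajectory that ends on a guard. -/
theorem append (hX : H.IsTrajectory u t₀ T loc r x₀ X) (hTT' : T < T')
    (hE : H.Edge (loc r) (loc (r + 1))) (hΦ : H.Φ (loc r) (loc (r + 1)) (X.state r T) = 0)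
    {y : ℝ → H.StateSpace (loc (r + 1))}
    (hy : IsSol (H.f (loc (r + 1))) (u (loc (r + 1))) y T T')
    (hyM : MapsTo y (Icc T T') (H.M (loc (r + 1))))
    (hyT : y T = H.Ω (loc r) (loc (r + 1)) (X.state r T))
    (hyΦ : ∀ t ∈ Ioo T T', ∀ q, H.Edge (loc (r + 1)) q → H.Φ (loc (r + 1)) q (y t) ≠ 0) :
    H.IsTrajectory u t₀ T' loc (r + 1) x₀ ⟨Function.update X.time (r + 1 + 1) T',
      Function.update X.state (r + 1) y⟩ := by
  have htime : ∀ i ≤ r + 1, Function.update X.time (r + 1 + 1) T' i = X.time i := fun i hi =>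
    Function.update_of_ne (by omega) _ _
  have hstate : ∀ i ≤ r, Function.update X.state (r + 1) y i = X.state i := fun i hi =>
    Function.update_of_ne (by omega) _ _
  have hcases : ∀ i ≤ r + 1, i ≤ r ∨ i = r + 1 := fun i hi => by omega
  constructor
  · exact (htime 0 (Nat.zero_le _)).trans hX.time_zero
  · exact Function.update_self ..
  · intro i hi
    dsimp only
    rw [htime i hi]
    rcases hcases i hi with h | rfl
    · rw [htime _ (by omega)]; exact hX.time_lt i h
    · rw [Function.update_self, hX.time_last]; exact hTT'
  · dsimp only
    rw [hstate 0 (Nat.zero_le _)]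
    exact hX.init
  · intro i hi t ht
    dsimp only at ht ⊢
    rw [htime i hi] at ht
    rcases hcases i hi with h | rfl
    · simp only [hstate i h]
      exact hX.mem i h t (by rwa [htime _ (by omega)] at ht)
    · simp only [Function.update_self, hX.time_last] at ht ⊢
      exact hyM ht
  · intro i hi
    dsimp only
    rw [htime i hi]
    rcases hcases i hi with h | rfl
    · rw [hstate i h, htime _ (by omega)]
      exact hX.continuousOn i h
    · simp only [Function.update_self, hX.time_last]
      exact hy.continuousOn
  · intro i hi t ht
    dsimp only at ht ⊢
    rw [htime i hi] at ht
    rcases hcases i hi with h | rfl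
    · simp only [hstate i h]
      exact hX.hasDerivAt i h t (by rwa [htime _ (by omega)] at ht)
    · simp only [Function.update_self, hX.time_last] at ht ⊢
      exact hy.hasDerivAt t ht
  · intro i hi t ht
    dsimp only at ht ⊢
    rw [htime i hi] at ht
    rcases hcases i hi with h | rfl
    · simp only [hstate i h]
      exact hX.guard_ne_zero i h t (by rwa [htime _ (by omega)] at ht)
    · simp only [Function.update_self, hX.time_last] at ht ⊢
      exact hyΦ t ht
  · intro i hi
    rcases (Nat.lt_succ_iff.1 hi).eq_or_lt with rfl | h
    · exact hE
    · exact hX.edge i h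
  · intro i hi
    dsimp only
    rw [htime _ hi, hstate i (by omega)]
    rcases (Nat.lt_succ_iff.1 hi).eq_or_lt with rfl | h
    · rw [hX.time_last]; exact hΦ
    · exact hX.guard_eq_zero i h
  · intro i hi
    dsimp only
    rw [htime _ hi, hstate i (by omega)]
    rcases (Nat.lt_succ_iff.1 hi).eq_or_lt with rfl | h
    · rw [Function.update_self, hX.time_last]; exact hyT
    · rw [hstate _ h]
      exact hX.reset i h

theorem eqOn_of_le (hu : H.IsAdmissible u) (hX : H.IsTrajectory u t₀ t_f loc r x₀ X)
    (hY : H.IsTrajectory u t₀ t_f loc r x₀ Y) (hi : i ≤ r) (ht : X.time i = Y.time i)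
    (hs : X.state i (X.time i) = Y.state i (X.time i)) (hT : T ≤ X.time (i + 1))
    (hT' : T ≤ Y.time (i + 1)) : EqOn (X.state i) (Y.state i) (Icc (X.time i) T) :=
  (isControlField (loc i)).eqOn_of_isSol (hu (loc i)) ((hX.isSol hi).mono le_rfl hT)
    ((hY.isSol hi).mono ht.symm.le hT')
    (fun t h => hX.mem i hi t ⟨h.1, h.2.trans hT⟩)
    (fun t h => hY.mem i hi t ⟨ht ▸ h.1, h.2.trans hT'⟩) hs

/-- If the segment of `Y` lasted longer, it would agree with that of `X` up to the transition of
`X`, and a guard would vanish inside it. The last segments both end at `t_f`. -/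
theorem time_le_time (hu : H.IsAdmissible u) (hX : H.IsTrajectory u t₀ t_f loc r x₀ X)
    (hY : H.IsTrajectory u t₀ t_f loc r x₀ Y) (hi : i ≤ r) (ht : X.time i = Y.time i)
    (hs : X.state i (X.time i) = Y.state i (X.time i)) :
    Y.time (i + 1) ≤ X.time (i + 1) := by
  rcases hi.eq_or_lt with rfl | hir
  · rw [hX.time_last, hY.time_last]
  · by_contra! hlt
    have h1 := eqOn_of_le hu hX hY hi ht hs le_rfl hlt.le ⟨(hX.time_lt i hi).le, le_rfl⟩
    refine hY.guard_ne_zero i hi (X.time (i + 1)) ⟨ht ▸ hX.time_lt i hi, hlt⟩ _ (hX.edge i hir) ?_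
    rw [← h1]
    exact hX.guard_eq_zero i hir

/-- The trajectory with given control, initial state and location sequence is unique. -/
theorem unique (hu : H.IsAdmissible u) (hX : H.IsTrajectory u t₀ t_f loc r x₀ X)
    (hY : H.IsTrajectory u t₀ t_f loc r x₀ Y) (hi : i ≤ r) :
    X.time i = Y.time i ∧ X.time (i + 1) = Y.time (i + 1) ∧
      EqOn (X.state i) (Y.state i) (Icc (X.time i) (X.time (i + 1))) := by
  have step : ∀ i ≤ r, X.time i = Y.time i → X.state i (X.time i) = Y.state i (X.time i) →
      X.time i = Y.time i ∧ X.time (i + 1) = Y.time (i + 1) ∧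
        EqOn (X.state i) (Y.state i) (Icc (X.time i) (X.time (i + 1))) := fun i hi ht hs => by
    have h1 := le_antisymm (time_le_time hu hY hX hi ht.symm (ht ▸ hs.symm))
      (time_le_time hu hX hY hi ht hs)
    exact ⟨ht, h1, eqOn_of_le hu hX hY hi ht hs le_rfl h1.le⟩
  induction i with
  | zero =>
    refine step 0 hi (by rw [hX.time_zero, hY.time_zero]) ?_
    rw [hX.time_zero, hX.init, hY.init]
  | succ i ih =>
    obtain ⟨-, h2, h3⟩ := ih (by omega)
    refine step (i + 1) hi h2 ?_
    rw [hX.reset i hi, h2, hY.reset i hi, ← h2, h3 ⟨(hX.time_lt i (by omega)).le, le_rfl⟩]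

end IsTrajectory

end HybridSystem

/-! ### Variational equations and perturbation of a single segment -/

namespace HybridSystem

variable {Q : Type*} {H : HybridSystem Q} {u : H.Control} {t₀ t_f : ℝ} {loc : ℕ → Q} {r : ℕ}
  {x₀ : H.StateSpace (loc 0)} {X : H.Trajectory loc} {k i : ℕ} {τ a b : ℝ}
  {w : H.ControlSpace (loc k)} {Ψ : (i : ℕ) → ℝ → H.StateSpace (loc i)}

theorem variationalReset_apply (ξ : H.StateSpace (loc i)) :
    H.variationalReset u X i ξ =
      H.resetDifferential (loc i) (loc (i + 1)) (H.stateBefore X i)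
        (ξ - ((H.guardGradient (loc i) (loc (i + 1)) (H.stateBefore X i) (H.fieldBefore u X i))⁻¹
          * H.guardGradient (loc i) (loc (i + 1)) (H.stateBefore X i) ξ) • H.fieldBefore u X i)
      + ((H.guardGradient (loc i) (loc (i + 1)) (H.stateBefore X i) (H.fieldBefore u X i))⁻¹
          * H.guardGradient (loc i) (loc (i + 1)) (H.stateBefore X i) ξ)
        • H.fieldAfter u X i := by
  simp [variationalReset, mul_smul]

namespace IsTrajectory

theorem stateBefore_mem (hX : H.IsTrajectory u t₀ t_f loc r x₀ X) (hi : i ≤ r) :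
    H.stateBefore X i ∈ H.M (loc i) :=
  hX.mem i hi _ ⟨(hX.time_lt i hi).le, le_rfl⟩

theorem stateAfter_mem (hX : H.IsTrajectory u t₀ t_f loc r x₀ X) (hi : i < r) :
    H.stateAfter X i ∈ H.M (loc (i + 1)) :=
  hX.mem (i + 1) hi _ ⟨le_rfl, (hX.time_lt (i + 1) hi).le⟩

/-- Both vector fields are tangent, the tangent cones are linear subspaces, and `DΩ` maps one into
the other because `Ω` maps manifold into manifold. -/
theorem variationalReset_mem (hX : H.IsTrajectory u t₀ t_f loc r x₀ X) (hu : H.IsAdmissible u)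
    (hi : i < r) {ξ : H.StateSpace (loc i)}
    (hξ : ξ ∈ tangentConeAt ℝ (H.M (loc i)) (H.stateBefore X i)) :
    H.variationalReset u X i ξ ∈ tangentConeAt ℝ (H.M (loc (i + 1))) (H.stateAfter X i) := by
  have hm := hX.stateBefore_mem hi.le
  have hp := hX.stateAfter_mem hi
  obtain ⟨T, hT⟩ := (H.isSubmanifold (loc i)).exists_submodule_eq_tangentConeAt hm
  obtain ⟨T', hT'⟩ := (H.isSubmanifold (loc (i + 1))).exists_submodule_eq_tangentConeAt hp
  have hfm : H.fieldBefore u X i ∈ T := by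
    rw [← SetLike.mem_coe, hT]
    exact H.f_tangent _ _ hm _ (hu _ _).1
  have hfp : H.fieldAfter u X i ∈ T' := by
    rw [← SetLike.mem_coe, hT']
    exact H.f_tangent _ _ hp _ (hu _ _).1
  have hD : MapsTo (H.resetDifferential (loc i) (loc (i + 1)) (H.stateBefore X i)) T T' := by
    have h1 := (((H.Ω_contDiffOn _ _ (hX.edge i hi)).differentiableOn one_ne_zero _
      hm).hasFDerivWithinAt).mapsTo_tangent_cone
    rw [hT, hT']
    have h2 : H.stateAfter X i = H.Ω (loc i) (loc (i + 1)) (H.stateBefore X i) := hX.reset i hi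
    rw [h2]
    exact h1.mono_right (tangentConeAt_mono (H.Ω_mapsTo _ _ (hX.edge i hi)).image_subset)
  rw [← hT] at hξ
  rw [← hT', variationalReset_apply]
  exact T'.add_mem (hD (T.sub_mem hξ (T.smul_mem _ hfm))) (T'.smul_mem _ hfp)

theorem max_time_eq (hX : H.IsTrajectory u t₀ t_f loc r x₀ X) (hτ : τ < X.time (k + 1))
    (hki : k < i) (hi : i ≤ r) : max τ (X.time i) = X.time i :=
  max_eq_right (hτ.le.trans (hX.time_le_of_le hki (hi.trans (Nat.le_succ r))))

theorem needle_mem (hX : H.IsTrajectory u t₀ t_f loc r x₀ X) (hu : H.IsAdmissible u) (hk : k ≤ r)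
    (hτ : τ ∈ Ioo (X.time k) (X.time (k + 1))) (hw : w ∈ H.U (loc k)) :
    a • (H.f (loc k) (X.state k τ) w - H.f (loc k) (X.state k τ) (u (loc k) τ))
      ∈ tangentConeAt ℝ (H.M (loc k)) (X.state k τ) := by
  have hm := hX.mem k hk τ ⟨hτ.1.le, hτ.2.le⟩
  obtain ⟨T, hT⟩ := (H.isSubmanifold (loc k)).exists_submodule_eq_tangentConeAt hm
  have h : ∀ c ∈ H.U (loc k), H.f (loc k) (X.state k τ) c ∈ T := fun c hc => by
    rw [← SetLike.mem_coe, hT]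
    exact H.f_tangent _ _ hm _ hc
  rw [← hT]
  exact T.smul_mem _ (T.sub_mem (h w hw) (h _ (hu _ _).1))

theorem exists_isVariation (hX : H.IsTrajectory u t₀ t_f loc r x₀ X) (hu : H.IsAdmissible u)
    (hk : k ≤ r) (hτ : τ ∈ Ioo (X.time k) (X.time (k + 1))) (hτu : ContinuousAt (u (loc k)) τ)
    (hw : w ∈ H.U (loc k)) (hreg : ∀ i, k ≤ i → i < r → H.IsRegularTransition u X i) :
    ∃ Ψ : (i : ℕ) → ℝ → H.StateSpace (loc i), H.IsVariation u X r k w τ a Ψ := by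
  -- Induction on the number of the last segment: each step solves the linear equation on one more
  -- segment, from the reset of the preceding final value.
  suffices ∀ j, k ≤ j → j ≤ r → ∃ Ψ : (i : ℕ) → ℝ → H.StateSpace (loc i),
      H.IsVariation u X j k w τ a Ψ from this r hk le_rfl
  intro j hkj
  induction j, hkj using Nat.le_induction with
  | base =>
    intro _
    obtain ⟨ψ, h1, h2, h3, h4⟩ := (isControlField (loc k)).exists_variation (hu (loc k)) hτ.2 hτu
      ((hX.isSol hk).mono hτ.1.le le_rfl)
      (fun t ht => hX.mem k hk t ⟨hτ.1.le.trans ht.1, ht.2⟩)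
      (hX.needle_mem (a := a) hu hk hτ hw)
    have hb : max τ (X.time k) = τ := max_eq_left hτ.1.le
    refine ⟨Function.update (fun _ _ => 0) k ψ, ?_, ?_, ?_, ?_, ?_⟩
    · rw [Function.update_self, h1]
    · intro i hi hi'
      obtain rfl := le_antisymm hi' hi
      rw [Function.update_self, hb]
      exact h3
    · intro i hi hi'
      obtain rfl := le_antisymm hi' hi
      rw [Function.update_self, hb]
      exact h2
    · intro i hi hi'
      obtain rfl := le_antisymm hi' hi
      rw [Function.update_self, hb]
      exact h4
    · intro i hi hi'
      exact absurd hi' (not_lt.2 hi)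
  | succ j hkj ih =>
    intro hj
    obtain ⟨Ψ, hΨ⟩ := ih (Nat.le_of_succ_le hj)
    have hjr : j < r := hj
    have hb : max τ (X.time (j + 1)) = X.time (j + 1) :=
      hX.max_time_eq hτ.2 (Nat.lt_succ_of_le hkj) hj
    have hlt : max τ (X.time j) < X.time (j + 1) := max_lt
      (hτ.2.trans_le (hX.time_le_of_le (Nat.succ_le_succ hkj) (Nat.succ_le_succ hjr.le)))
      (hX.time_lt j hjr.le)
    obtain ⟨ψ, h1, h2, h3, h4⟩ := (isControlField (loc (j + 1))).exists_variation
      (hu (loc (j + 1))) (hX.time_lt (j + 1) hj) (hreg j hkj hjr).continuousAt_after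
      (hX.isSol hj) (hX.mem (j + 1) hj)
      (hX.variationalReset_mem hu hjr (hΨ.tangent j hkj le_rfl _ ⟨hlt.le, le_rfl⟩))
    have hself : Function.update Ψ (j + 1) ψ (j + 1) = ψ := Function.update_self ..
    have hne : ∀ i ≤ j, Function.update Ψ (j + 1) ψ i = Ψ i := fun i hi =>
      Function.update_of_ne (Nat.lt_succ_of_le hi).ne _ _
    refine ⟨Function.update Ψ (j + 1) ψ, ?_, ?_, ?_, ?_, ?_⟩
    · rw [hne k hkj, hΨ.init]
    · intro i hi hi'
      rcases Nat.le_succ_iff.1 hi' with h | rfl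
      · rw [hne i h]
        exact hΨ.tangent i hi h
      · rw [hself, hb]
        exact h3
    · intro i hi hi'
      rcases Nat.le_succ_iff.1 hi' with h | rfl
      · rw [hne i h]
        exact hΨ.continuousOn i hi h
      · rw [hself, hb]
        exact h2
    · intro i hi hi'
      rcases Nat.le_succ_iff.1 hi' with h | rfl
      · rw [hne i h]
        exact hΨ.hasDerivAt i hi h
      · rw [hself, hb]
        exact h4
    · intro i hi hi'
      rcases (Nat.lt_succ_iff.1 hi').lt_or_eq with h | rfl
      · rw [hne i h.le, hne (i + 1) h]
        exact hΨ.reset i hi h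
      · rw [hself, hne i le_rfl]
        exact h1

end IsTrajectory

/-- Initial data, at the times `s ε` near `b`, of perturbations of the segment `i` of a
trajectory with first-order variation `Ψ i b`.  A guard that vanishes at the nominal state vanishes
on the perturbed initial states, and is left at nonzero speed. -/
structure IsEntry (H : HybridSystem Q) (u : H.Control) (X : H.Trajectory loc)
    (Ψ : (i : ℕ) → ℝ → H.StateSpace (loc i)) (i : ℕ) (b : ℝ) (s : ℝ → ℝ)
    (p : ℝ → H.StateSpace (loc i)) : Prop where
  time : (fun ε => s ε - b) =O[𝓝[>] 0] fun ε => ε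
  state : (fun ε => p ε - X.state i b - (s ε - b) • H.f (loc i) (X.state i b) (u (loc i) b)
    - ε • Ψ i b) =o[𝓝[>] 0] fun ε => ε
  mem : ∀ᶠ ε in 𝓝[>] (0 : ℝ), p ε ∈ H.M (loc i)
  guard : ∀ q, H.Edge (loc i) q → H.Φ (loc i) q (X.state i b) ≠ 0 ∨
    ((∀ᶠ ε in 𝓝[>] (0 : ℝ), H.Φ (loc i) q (p ε) = 0) ∧
      H.guardGradient (loc i) q (X.state i b) (H.f (loc i) (X.state i b) (u (loc i) b)) ≠ 0)

theorem IsEntry.congr {s : ℝ → ℝ} {p p' : ℝ → H.StateSpace (loc i)} (h : H.IsEntry u X Ψ i b s p)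
    (hp : p =ᶠ[𝓝[>] 0] p') : H.IsEntry u X Ψ i b s p' where
  time := h.time
  state := h.state.congr' (hp.mono fun ε hε => by simp only [hε]) EventuallyEq.rfl
  mem := (h.mem.and hp).mono fun ε hε => hε.2 ▸ hε.1
  guard q hq := (h.guard q hq).imp_right fun h' =>
    ⟨(h'.1.and hp).mono fun ε hε => hε.2 ▸ hε.1, h'.2⟩

/-- Perturbations `y ε` of the segment `i` of a trajectory, from the time `s ε` to the time `σ ε`,
with first-order variation `Ψ i`. -/
structure IsPerturbedSegment (H : HybridSystem Q) (u : H.Control) (X : H.Trajectory loc)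
    (Ψ : (i : ℕ) → ℝ → H.StateSpace (loc i)) (i : ℕ) (b : ℝ) (s : ℝ → ℝ)
    (p : ℝ → H.StateSpace (loc i)) (σ : ℝ → ℝ) (y : ℝ → ℝ → H.StateSpace (loc i)) : Prop where
  tendsto : Tendsto σ (𝓝[>] 0) (𝓝 (X.time (i + 1)))
  lt : ∀ᶠ ε in 𝓝[>] (0 : ℝ), s ε < σ ε
  start : ∀ᶠ ε in 𝓝[>] (0 : ℝ), y ε (s ε) = p ε
  isSol : ∀ᶠ ε in 𝓝[>] (0 : ℝ), IsSol (H.f (loc i)) (u (loc i)) (y ε) (s ε) (σ ε)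
  mapsTo : ∀ᶠ ε in 𝓝[>] (0 : ℝ), MapsTo (y ε) (Icc (s ε) (σ ε)) (H.M (loc i))
  guard : ∀ᶠ ε in 𝓝[>] (0 : ℝ), ∀ t ∈ Ioo (s ε) (σ ε), ∀ q, H.Edge (loc i) q →
    H.Φ (loc i) q (y ε t) ≠ 0
  variation : ∀ t ∈ Icc b (X.time (i + 1)),
    (fun ε => y ε t - X.state i t - ε • Ψ i t) =o[𝓝[>] 0] fun ε => ε

theorem IsTrajectory.isPerturbedSegment [Finite Q] (hX : H.IsTrajectory u t₀ t_f loc r x₀ X)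
    (hu : H.IsAdmissible u) (hi : i ≤ r) (hb : b ∈ Ico (X.time i) (X.time (i + 1)))
    (hub : ContinuousAt (u (loc i)) b) {s σ : ℝ → ℝ} {p : ℝ → H.StateSpace (loc i)}
    (hs : H.IsEntry u X Ψ i b s p) {η : ℝ} {y : ℝ → ℝ → H.StateSpace (loc i)}
    (hy : IsPerturbedFlow (H.M (loc i)) (H.f (loc i)) (u (loc i)) (X.state i) (Ψ i) b
      (X.time (i + 1)) s p η y)
    (hσ : Tendsto σ (𝓝[>] 0) (𝓝 (X.time (i + 1))))
    (he : ∀ q, H.Edge (loc i) q → H.Φ (loc i) q (H.stateBefore X i) ≠ 0 ∨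
      (ContinuousAt (u (loc i)) (X.time (i + 1)) ∧
        (∀ᶠ ε in 𝓝[>] (0 : ℝ), H.Φ (loc i) q (y ε (σ ε)) = 0) ∧
        H.guardGradient (loc i) q (H.stateBefore X i) (H.fieldBefore u X i) ≠ 0)) :
    H.IsPerturbedSegment u X Ψ i b s p σ y := by
  have hε0 : Tendsto (fun ε : ℝ => ε) (𝓝[>] 0) (𝓝 0) := nhdsWithin_le_nhds
  have hsb : Tendsto s (𝓝[>] 0) (𝓝 b) := by
    simpa using (hs.time.trans_tendsto hε0).add_const b
  have hση : ∀ᶠ ε in 𝓝[>] (0 : ℝ), σ ε ≤ X.time (i + 1) + η :=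
    (hσ.eventually (Iio_mem_nhds (lt_add_of_pos_right _ hy.pos))).mono fun _ h => le_of_lt h
  refine ⟨hσ, hsb.eventually_lt hσ hb.2, hy.start, ?_, ?_, ?_, hy.variation⟩
  · filter_upwards [hy.isSol, hση] with ε h1 h2 using h1.mono le_rfl h2
  · filter_upwards [hy.mapsTo, hση] with ε h1 h2 t ht using h1 ⟨ht.1, ht.2.trans h2⟩
  · have h : ∀ q, ∀ᶠ ε in 𝓝[>] (0 : ℝ), H.Edge (loc i) q → ∀ t ∈ Ioo (s ε) (σ ε),
        H.Φ (loc i) q (y ε t) ≠ 0 := fun q => by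
      by_cases hq : H.Edge (loc i) q
      · refine (hy.eventually_forall_guard_ne_zero (isControlField (loc i)) (hu (loc i)) hb.2.le
          (fun t ht => hX.mem i hi t ⟨hb.1.trans ht.1, ht.2⟩) hub hsb hσ (H.Φ_contDiffOn _ _ hq)
          (fun t ht => hX.guard_ne_zero i hi t ⟨hb.1.trans_lt ht.1, ht.2⟩ q hq)
          (hs.guard q hq) (he q hq)).mono fun ε hε _ => hε
      · exact Eventually.of_forall fun ε h => absurd h hq
    filter_upwards [eventually_all.2 h] with ε hε t ht q hq using hε q hq t ht

/-- Perturbations of a segment reach the guard, and enter the next segment. -/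
theorem IsTrajectory.exists_isPerturbedSegment [Finite Q]
    (hX : H.IsTrajectory u t₀ t_f loc r x₀ X) (hu : H.IsAdmissible u) (hk : k ≤ r)
    (hτ : τ ∈ Ioo (X.time k) (X.time (k + 1)))
    (hreg : ∀ i, k ≤ i → i < r → H.IsRegularTransition u X i)
    (hfinal : ∀ q, H.Edge (loc r) q → H.Φ (loc r) q (X.state r t_f) ≠ 0)
    (hΨ : H.IsVariation u X r k w τ a Ψ) (hki : k ≤ i) (hi : i ≤ r)
    (hb : b = max τ (X.time i)) (hub : ContinuousAt (u (loc i)) b)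
    {s : ℝ → ℝ} {p : ℝ → H.StateSpace (loc i)} (hs : H.IsEntry u X Ψ i b s p) :
    ∃ σ y, H.IsPerturbedSegment u X Ψ i b s p σ y ∧
      (i < r → (∀ᶠ ε in 𝓝[>] (0 : ℝ), H.Φ (loc i) (loc (i + 1)) (y ε (σ ε)) = 0) ∧
        H.IsEntry u X Ψ (i + 1) (X.time (i + 1)) σ
          fun ε => H.Ω (loc i) (loc (i + 1)) (y ε (σ ε))) ∧
      (i = r → ∀ ε, σ ε = X.time (i + 1)) := by
  have hbI : b ∈ Ico (X.time i) (X.time (i + 1)) := by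
    refine ⟨hb ▸ le_max_right _ _, hb ▸ max_lt (hτ.2.trans_le ?_) (hX.time_lt i hi)⟩
    exact hX.time_le_of_le (Nat.succ_le_succ hki) (Nat.succ_le_succ hi)
  have hε0 : Tendsto (fun ε : ℝ => ε) (𝓝[>] 0) (𝓝 0) := nhdsWithin_le_nhds
  have hsb : Tendsto s (𝓝[>] 0) (𝓝 b) := by
    simpa using (hs.time.trans_tendsto hε0).add_const b
  have hXM : MapsTo (X.state i) (Icc b (X.time (i + 1))) (H.M (loc i)) := fun t ht =>
    hX.mem i hi t ⟨hbI.1.trans ht.1, ht.2⟩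
  obtain ⟨η, y, hy⟩ := (isControlField (loc i)).exists_isPerturbedFlow (hu (loc i)) hbI.2.le hub
    ((hX.isSol hi).mono hbI.1 le_rfl) hXM (hb ▸ hΨ.continuousOn i hki hi)
    (hb ▸ hΨ.tangent i hki hi) (hb ▸ hΨ.hasDerivAt i hki hi) hs.time hs.state hs.mem
  rcases hi.lt_or_eq with hir | rfl
  · have hr := hreg i hki hir
    have hE := hX.edge i hir
    obtain ⟨σ, hσ, hσ0⟩ := hy.exists_exit_time (isControlField (loc i)) (hu (loc i)) hbI.2 hXM hsb
      hr.continuousAt_before (H.Φ_contDiffOn _ _ hE) (hX.guard_eq_zero i hir) hr.transversal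
    have hσe : Tendsto σ (𝓝[>] 0) (𝓝 (X.time (i + 1))) := by
      simpa using (hσ.trans_tendsto hε0).add_const (X.time (i + 1))
    -- `σ ε` was chosen as some zero of the guard near the nominal exit; that it ends the segment,
    -- no guard vanishing earlier, is established here.
    have hseg := hX.isPerturbedSegment hu hi hbI hub hs hy hσe fun q hq => by
      rcases eq_or_ne q (loc (i + 1)) with rfl | hne
      · exact .inr ⟨hr.continuousAt_before, hσ0, hr.transversal⟩
      · exact .inl (hr.single q hq hne)
    have hyM : ∀ᶠ ε in 𝓝[>] (0 : ℝ), y ε (σ ε) ∈ H.M (loc i) := by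
      filter_upwards [hseg.mapsTo, hseg.lt] with ε h1 h2 using h1 ⟨h2.le, le_rfl⟩
    have hyσ : Tendsto (fun ε => y ε (σ ε)) (𝓝[>] 0) (𝓝[H.M (loc i)] (H.stateBefore X i)) :=
      tendsto_nhdsWithin_iff.2 ⟨(hy.tendsto _ ⟨hbI.2.le, le_rfl⟩).comp
        (tendsto_id.prodMk hσe), hyM⟩
    refine ⟨σ, y, hseg, fun _ => ⟨hσ0, hσ, ?_, ?_, ?_⟩, fun h => absurd h hir.ne⟩
    · have h := hy.isLittleO_reset hbI.2 hXM hsb hr.continuousAt_before (H.Φ_contDiffOn _ _ hE)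
        (hX.guard_eq_zero i hir) hr.transversal hσ hσ0 (H.Ω_contDiffOn _ _ hE)
        (H.fieldAfter u X i)
      rw [hΨ.reset i hki hir, variationalReset_apply, hX.reset i hir]
      have h2 : H.f (loc (i + 1)) (H.Ω (loc i) (loc (i + 1)) (X.state i (X.time (i + 1))))
          (u (loc (i + 1)) (X.time (i + 1))) = H.fieldAfter u X i := by
        rw [← hX.reset i hir]; rfl
      rw [h2]
      exact h
    · exact hyM.mono fun ε hε => H.Ω_mapsTo _ _ hE hε
    · intro q hq
      -- The state before the reset is a zero of the old guard close to the nominal one, so a new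
      -- guard of the second kind vanishes exactly on the reset state.
      refine (hr.after q hq).imp_right fun h => ⟨?_, h.2⟩
      filter_upwards [hyσ.eventually h.1, hσ0] with ε h1 h2 using h1 h2
  -- The last segment ends at the fixed time `t_f`, where no guard is active.
  · refine ⟨fun _ => X.time (i + 1), y, hX.isPerturbedSegment hu le_rfl hbI hub hs hy
      tendsto_const_nhds fun q hq => .inl ?_, fun h => absurd h (lt_irrefl _), fun _ _ => rfl⟩
    have := hfinal q hq
    rwa [← hX.time_last] at this

end HybridSystem

/-! ### The needle and the assembled perturbed trajectories -/

namespace HybridSystem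

variable {Q : Type*} {H : HybridSystem Q} {u : H.Control} {t₀ t_f : ℝ} {loc : ℕ → Q} {r : ℕ}
  {x₀ : H.StateSpace (loc 0)} {X : H.Trajectory loc} {k i j : ℕ} {τ a b : ℝ}
  {w : H.ControlSpace (loc k)} {Ψ : (i : ℕ) → ℝ → H.StateSpace (loc i)}

namespace IsTrajectory

/-- The solutions during a needle perturbation of the control. -/
theorem exists_needle [Finite Q] (hX : H.IsTrajectory u t₀ t_f loc r x₀ X) (hu : H.IsAdmissible u)
    (hk : k ≤ r) (hτ : τ ∈ Ioo (X.time k) (X.time (k + 1))) (hτu : ContinuousAt (u (loc k)) τ)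
    (hw : w ∈ H.U (loc k)) (ha : 0 < a) :
    ∃ y : ℝ → ℝ → H.StateSpace (loc k),
      (∀ᶠ ε in 𝓝[>] (0 : ℝ), y ε (τ - ε * a) = X.state k (τ - ε * a)) ∧
      (∀ᶠ ε in 𝓝[>] (0 : ℝ), IsSol (H.f (loc k)) (fun _ => w) (y ε) (τ - ε * a) τ) ∧
      (∀ᶠ ε in 𝓝[>] (0 : ℝ), MapsTo (y ε) (Icc (τ - ε * a) τ) (H.M (loc k))) ∧
      (∀ᶠ ε in 𝓝[>] (0 : ℝ), ∀ t ∈ Icc (τ - ε * a) τ, ∀ q, H.Edge (loc k) q →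
        H.Φ (loc k) q (y ε t) ≠ 0) ∧
      (fun ε => y ε τ - X.state k τ - ε • a •
        (H.f (loc k) (X.state k τ) w - H.f (loc k) (X.state k τ) (u (loc k) τ)))
        =o[𝓝[>] 0] fun ε => ε := by
  have hm := hX.mem k hk τ ⟨hτ.1.le, hτ.2.le⟩
  have hf := isControlField (H := H) (loc k)
  have hwc := isPiecewiseContinuousInto_const hw
  have hε0 : Tendsto (fun ε : ℝ => ε) (𝓝[>] 0) (𝓝 0) := nhdsWithin_le_nhds
  have hs0 : Tendsto (fun ε => τ - ε * a) (𝓝[>] 0) (𝓝 τ) := by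
    simpa using (hε0.mul_const a).const_sub τ
  obtain ⟨e, hτe, z, hzτ, hz, hzM⟩ := hf.exists_isSol hwc hm τ
  obtain ⟨ψ, h1, h2, h3, h4⟩ := hf.exists_variation hwc hτe continuousAt_const hz hzM
    (hzτ ▸ hX.needle_mem (a := a) hu hk hτ hw)
  have hs : (fun ε => τ - ε * a - τ) =O[𝓝[>] 0] fun ε : ℝ => ε := by
    refine IsBigO.of_bound a (Eventually.of_forall fun ε => ?_)
    rw [sub_sub_cancel_left, norm_neg, norm_mul, mul_comm, Real.norm_of_nonneg ha.le]
  have hd := (hX.hasDerivAt k hk τ hτ hτu).isLittleO.comp_tendsto hs0 |>.trans_isBigO hs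
  have hI : ∀ᶠ ε in 𝓝[>] (0 : ℝ), τ - ε * a ∈ Ioo (X.time k) (X.time (k + 1)) :=
    hs0.eventually (Ioo_mem_nhds hτ.1 hτ.2)
  -- The reference solution is `z`, which leaves the nominal state at `τ` with control `w`. The
  -- perturbed ones branch off at `τ - ε a`; by differentiability of the nominal state at `τ`, their
  -- entry has variation `a (f(x, w) - f(x, u))`. Only their part up to `τ` is used.
  obtain ⟨η, y, hy⟩ := hf.exists_isPerturbedFlow hwc hτe.le continuousAt_const hz hzM h2 h3 h4
    (s := fun ε => τ - ε * a) (p := fun ε => X.state k (τ - ε * a)) hs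
    (by
      refine hd.congr_left fun ε => ?_
      simp only [Function.comp_apply, h1, hzτ]
      module)
    (hI.mono fun ε hε => hX.mem k hk _ (Ioo_subset_Icc_self hε))
  have hτη : τ ≤ e + η := by linarith [hy.pos]
  have hτI : τ ∈ Icc τ e := ⟨le_rfl, hτe.le⟩
  refine ⟨y, hy.start, ?_, ?_, ?_, ?_⟩
  · exact hy.isSol.mono fun ε hε => hε.mono le_rfl hτη
  · exact hy.mapsTo.mono fun ε hε t ht => hε ⟨ht.1, ht.2.trans hτη⟩
  · have h : ∀ q, ∀ᶠ ε in 𝓝[>] (0 : ℝ), H.Edge (loc k) q → ∀ t ∈ Icc (τ - ε * a) τ,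
        H.Φ (loc k) q (y ε t) ≠ 0 := fun q => by
      by_cases hq : H.Edge (loc k) q
      · obtain ⟨A, hA, B, hB, hAB⟩ := eventually_prod_iff.1 (hy.eventually_guard_ne_zero hτI
          (hzM hτI) (H.Φ_contDiffOn _ _ hq).continuousOn
          (by rw [hzτ]; exact hX.guard_ne_zero k hk τ hτ q hq))
        obtain ⟨δ, hδ, hB⟩ := Metric.eventually_nhds_iff.1 hB
        filter_upwards [hA, hs0.eventually (Metric.ball_mem_nhds τ hδ)] with ε hε hεδ _ t ht
        refine hAB hε (hB ?_) ht.1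
        refine lt_of_le_of_lt ?_ hεδ
        rw [Real.dist_eq, Real.dist_eq, abs_sub_comm, abs_sub_comm (τ - ε * a),
          abs_of_nonneg (sub_nonneg.2 ht.2), abs_of_nonneg (sub_nonneg.2 (ht.1.trans ht.2))]
        linarith [ht.1]
      · exact Eventually.of_forall fun ε h => absurd h hq
    filter_upwards [eventually_all.2 h] with ε hε t ht q hq using hε q hq t ht
  · have := hy.variation τ hτI
    rwa [h1, hzτ] at this

end IsTrajectory

/-- Trajectories `Y ε` through the first `j + 1` locations of the trajectory `X`, under the
perturbed controls, with first-order variation `Ψ`. -/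
structure IsPerturbedFamily (H : HybridSystem Q) (u : H.Control) (t₀ : ℝ)
    (x₀ : H.StateSpace (loc 0)) (X : H.Trajectory loc) (k : ℕ) (w : H.ControlSpace (loc k))
    (τ a : ℝ) (Ψ : (i : ℕ) → ℝ → H.StateSpace (loc i)) (j : ℕ) (Y : ℝ → H.Trajectory loc) :
    Prop where
  isTrajectory : ∀ᶠ ε in 𝓝[>] (0 : ℝ),
    H.IsTrajectory (H.perturbedControl u (loc k) w τ a ε) t₀ ((Y ε).time (j + 1)) loc j x₀ (Y ε)
  time_eq : ∀ ε, (Y ε).time k = X.time k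
  tendsto : ∀ i, k ≤ i → i ≤ j →
    Tendsto (fun ε => (Y ε).time (i + 1)) (𝓝[>] 0) (𝓝 (X.time (i + 1)))
  variation : ∀ i, k ≤ i → i ≤ j → ∀ t ∈ Icc (max τ (X.time i)) (X.time (i + 1)),
    (fun ε => (Y ε).state i t - X.state i t - ε • Ψ i t) =o[𝓝[>] 0] fun ε => ε

theorem IsTrajectory.exists_isPerturbedFamily_start [Finite Q]
    (hX : H.IsTrajectory u t₀ t_f loc r x₀ X) (hu : H.IsAdmissible u)
    (hk : k ≤ r) (hτ : τ ∈ Ioo (X.time k) (X.time (k + 1))) (hτu : ContinuousAt (u (loc k)) τ)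
    (hw : w ∈ H.U (loc k)) (ha : 0 < a)
    (hreg : ∀ i, k ≤ i → i < r → H.IsRegularTransition u X i)
    (hfinal : ∀ q, H.Edge (loc r) q → H.Φ (loc r) q (X.state r t_f) ≠ 0)
    (hΨ : H.IsVariation u X r k w τ a Ψ) :
    ∃ Y, H.IsPerturbedFamily u t₀ x₀ X k w τ a Ψ k Y ∧
      (k < r → (∀ᶠ ε in 𝓝[>] (0 : ℝ),
          H.Φ (loc k) (loc (k + 1)) ((Y ε).state k ((Y ε).time (k + 1))) = 0) ∧
        H.IsEntry u X Ψ (k + 1) (X.time (k + 1)) (fun ε => (Y ε).time (k + 1))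
          fun ε => H.Ω (loc k) (loc (k + 1)) ((Y ε).state k ((Y ε).time (k + 1)))) ∧
      (k = r → ∀ ε, (Y ε).time (k + 1) = X.time (k + 1)) := by
  obtain ⟨z, hz1, hz2, hz3, hz4, hz5⟩ := hX.exists_needle hu hk hτ hτu hw ha
  have hpos : ∀ᶠ ε in 𝓝[>] (0 : ℝ), 0 < ε := self_mem_nhdsWithin
  have hmax : max τ (X.time k) = τ := max_eq_left hτ.1.le
  have hε0 : Tendsto (fun ε : ℝ => ε) (𝓝[>] 0) (𝓝 0) := nhdsWithin_le_nhds
  have hs0 : Tendsto (fun ε => τ - ε * a) (𝓝[>] 0) (𝓝 τ) := by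
    simpa using (hε0.mul_const a).const_sub τ
  have hentry : H.IsEntry u X Ψ k τ (fun _ => τ) fun ε => z ε τ := by
    refine ⟨by simpa using isBigO_zero _ _, ?_, ?_, fun q hq => .inl ?_⟩
    · rw [hΨ.init]
      simpa using hz5
    · filter_upwards [hz3, hpos] with ε h1 h2
      exact h1 ⟨by nlinarith, le_rfl⟩
    · exact hX.guard_ne_zero k hk τ hτ q hq
  obtain ⟨σ, y, hy, hy1, hy2⟩ := hX.exists_isPerturbedSegment hu hk hτ hreg hfinal hΨ le_rfl hk
    hmax.symm hτu hentry
  set v : ℝ → H.Control := fun ε => H.perturbedControl u (loc k) w τ a ε with hv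
  -- Three pieces of segment `k`: nominal up to `τ - ε a`, needle up to `τ`, then the perturbed flow
  -- under the nominal control.
  set g : ℝ → ℝ → H.StateSpace (loc k) := fun ε t => if t ≤ τ then
    (if t ≤ τ - ε * a then X.state k t else z ε t) else y ε t with hg
  have hgy : ∀ᶠ ε in 𝓝[>] (0 : ℝ), ∀ t, τ ≤ t → g ε t = y ε t := by
    filter_upwards [hpos, hy.start] with ε h0 h1 t ht
    rcases ht.eq_or_lt with rfl | ht
    · simp only [hg, le_refl, if_true]
      rw [if_neg (not_le.2 (by nlinarith)), h1]
    · simp only [hg, if_neg (not_le.2 ht)]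
  have hgσ : ∀ᶠ ε in 𝓝[>] (0 : ℝ), g ε (σ ε) = y ε (σ ε) := by
    filter_upwards [hgy, hy.lt] with ε h1 h2 using h1 _ h2.le
  refine ⟨fun ε => ⟨Function.update X.time (k + 1) (σ ε), Function.update X.state k (g ε)⟩,
    ⟨?_, ?_, ?_, ?_⟩, ?_, ?_⟩
  · filter_upwards [hpos, hz1, hz2, hz3, hz4, hy.start, hy.isSol, hy.mapsTo, hy.guard, hy.lt,
      hs0.eventually (Ioo_mem_nhds hτ.1 hτ.2)] with ε h0 h1 h2 h3 h4 h5 h6 h7 h8 h9 h10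
    have hlt : τ - ε * a < τ := by nlinarith
    have hvad : H.IsAdmissible (v ε) := hu.perturbedControl hw
    have t1 := hX.truncate (v := v ε) hk h10 fun q t ht =>
      (perturbedControl_of_notMem fun h => not_lt.2 h.1 ht).symm
    have t2 := t1.prolong hvad hlt
      (h2.congr_signal fun t ht => (perturbedControl_of_mem ⟨ht.1.le, ht.2.le⟩).symm)
      h3 h1 fun t ht => h4 t ⟨ht.1, ht.2.le⟩
    have h11 : y ε τ = Function.update X.state k
        (fun t => if t ≤ τ - ε * a then X.state k t else z ε t) k τ := by
      rw [Function.update_self, if_neg (not_le.2 hlt), h5]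
    have t3 := t2.prolong hvad h9
      (h6.congr_signal fun t ht => (perturbedControl_of_notMem fun h => not_lt.2 h.2 ht.1).symm)
      h7 h11 fun t ht q hq => by
        rcases ht.1.eq_or_lt with rfl | h
        · rw [h5]
          exact h4 τ ⟨hlt.le, le_rfl⟩ q hq
        · exact h8 t ⟨h, ht.2⟩ q hq
    simp only [Function.update_idem, Function.update_self] at t3 ⊢
    exact t3
  · intro ε
    exact Function.update_of_ne (Nat.lt_succ_self k).ne _ _
  · intro i hi hi'
    obtain rfl := le_antisymm hi' hi
    simpa only [Function.update_self] using hy.tendsto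
  · intro i hi hi' t ht
    obtain rfl := le_antisymm hi' hi
    rw [hmax] at ht
    simp only [Function.update_self]
    refine (hy.variation t ht).congr' ?_ EventuallyEq.rfl
    filter_upwards [hgy] with ε hε
    rw [hε t ht.1]
  · intro hkr
    simp only [Function.update_self]
    obtain ⟨h1, h2⟩ := hy1 hkr
    refine ⟨?_, h2.congr ?_⟩
    · filter_upwards [h1, hgσ] with ε h3 h4
      rw [h4, h3]
    · filter_upwards [hgσ] with ε h4
      rw [h4]
  · simpa only [Function.update_self] using hy2

theorem IsPerturbedFamily.append {Y : ℝ → H.Trajectory loc}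
    (hY : H.IsPerturbedFamily u t₀ x₀ X k w τ a Ψ j Y) (hkj : k ≤ j)
    (hmax : max τ (X.time (j + 1)) = X.time (j + 1)) (hτ : τ < X.time (j + 1))
    (hE : H.Edge (loc j) (loc (j + 1)))
    (hΦ : ∀ᶠ ε in 𝓝[>] (0 : ℝ),
      H.Φ (loc j) (loc (j + 1)) ((Y ε).state j ((Y ε).time (j + 1))) = 0)
    {σ : ℝ → ℝ} {y : ℝ → ℝ → H.StateSpace (loc (j + 1))}
    (hy : H.IsPerturbedSegment u X Ψ (j + 1) (X.time (j + 1)) (fun ε => (Y ε).time (j + 1))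
      (fun ε => H.Ω (loc j) (loc (j + 1)) ((Y ε).state j ((Y ε).time (j + 1)))) σ y) :
    H.IsPerturbedFamily u t₀ x₀ X k w τ a Ψ (j + 1) fun ε =>
      ⟨Function.update (Y ε).time (j + 1 + 1) (σ ε),
        Function.update (Y ε).state (j + 1) (y ε)⟩ := by
  refine ⟨?_, ?_, ?_, ?_⟩
  · filter_upwards [hY.isTrajectory, hΦ, hy.lt, hy.start, hy.isSol, hy.mapsTo, hy.guard,
      (hY.tendsto j hkj le_rfl).eventually (Ioi_mem_nhds hτ)] with ε h1 h2 h3 h4 h5 h6 h7 h8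
    -- For small `ε` the new segment starts after `τ`, where the perturbed control is the nominal
    -- one, even if the location of the needle is visited again.
    have t1 := h1.append h3 hE h2 (h5.congr_signal fun t ht =>
      (perturbedControl_of_notMem fun h => not_lt.2 h.2 (lt_trans h8 ht.1)).symm) h6 h4 h7
    simpa only [Function.update_self] using t1
  · intro ε
    dsimp only
    rw [Function.update_of_ne (by omega)]
    exact hY.time_eq ε
  · intro i hi hi'
    rcases Nat.le_succ_iff.1 hi' with h | rfl
    · have : ∀ ε, Function.update (Y ε).time (j + 1 + 1) (σ ε) (i + 1) = (Y ε).time (i + 1) :=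
        fun ε => Function.update_of_ne (by omega) _ _
      simp only [this]
      exact hY.tendsto i hi h
    · simpa only [Function.update_self] using hy.tendsto
  · intro i hi hi' t ht
    rcases Nat.le_succ_iff.1 hi' with h | rfl
    · have : ∀ ε, Function.update (Y ε).state (j + 1) (y ε) i = (Y ε).state i :=
        fun ε => Function.update_of_ne (by omega) _ _
      simp only [this]
      exact hY.variation i hi h t ht
    · rw [hmax] at ht
      simpa only [Function.update_self] using hy.variation t ht

theorem IsTrajectory.exists_isPerturbedFamily [Finite Q]
    (hX : H.IsTrajectory u t₀ t_f loc r x₀ X) (hu : H.IsAdmissible u)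
    (hk : k ≤ r) (hτ : τ ∈ Ioo (X.time k) (X.time (k + 1))) (hτu : ContinuousAt (u (loc k)) τ)
    (hw : w ∈ H.U (loc k)) (ha : 0 < a)
    (hreg : ∀ i, k ≤ i → i < r → H.IsRegularTransition u X i)
    (hfinal : ∀ q, H.Edge (loc r) q → H.Φ (loc r) q (X.state r t_f) ≠ 0)
    (hΨ : H.IsVariation u X r k w τ a Ψ) :
    ∃ Y, H.IsPerturbedFamily u t₀ x₀ X k w τ a Ψ r Y ∧ ∀ ε, (Y ε).time (r + 1) = t_f := by
  -- The induction also carries the entry into the next segment, or, for `j = r`, the exact final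
  -- time.
  suffices ∀ j, k ≤ j → j ≤ r → ∃ Y, H.IsPerturbedFamily u t₀ x₀ X k w τ a Ψ j Y ∧
      (j < r → (∀ᶠ ε in 𝓝[>] (0 : ℝ),
          H.Φ (loc j) (loc (j + 1)) ((Y ε).state j ((Y ε).time (j + 1))) = 0) ∧
        H.IsEntry u X Ψ (j + 1) (X.time (j + 1)) (fun ε => (Y ε).time (j + 1))
          fun ε => H.Ω (loc j) (loc (j + 1)) ((Y ε).state j ((Y ε).time (j + 1)))) ∧
      (j = r → ∀ ε, (Y ε).time (j + 1) = X.time (j + 1)) by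
    obtain ⟨Y, hY, -, h⟩ := this r hk le_rfl
    exact ⟨Y, hY, fun ε => (h rfl ε).trans hX.time_last⟩
  intro j hkj
  induction j, hkj using Nat.le_induction with
  | base => exact fun _ =>
      hX.exists_isPerturbedFamily_start hu hk hτ hτu hw ha hreg hfinal hΨ
  | succ j hkj ih =>
    intro hj
    have hjr : j < r := hj
    obtain ⟨Y, hY, h1, -⟩ := ih hjr.le
    obtain ⟨hΦ, hentry⟩ := h1 hjr
    have hmax := hX.max_time_eq hτ.2 (Nat.lt_succ_of_le hkj) hj
    have hτj : τ < X.time (j + 1) := hτ.2.trans_le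
      (hX.time_le_of_le (Nat.succ_le_succ hkj) (Nat.succ_le_succ hjr.le))
    obtain ⟨σ, y, hy, hy1, hy2⟩ := hX.exists_isPerturbedSegment hu hk hτ hreg hfinal hΨ
      (Nat.le_succ_of_le hkj) hj hmax.symm (hreg j hkj hjr).continuousAt_after hentry
    refine ⟨_, hY.append hkj hmax hτj (hX.edge j hjr) hΦ hy, ?_, ?_⟩
    · simpa only [Function.update_self] using hy1
    · simpa only [Function.update_self] using hy2

/-- At each of the times considered, the perturbed trajectories are in the same segment. -/
theorem IsPerturbedFamily.eventually_mem_Icc {Y : ℝ → H.Trajectory loc}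
    (hY : H.IsPerturbedFamily u t₀ x₀ X k w τ a Ψ r Y) (hX : H.IsTrajectory u t₀ t_f loc r x₀ X)
    (hτ : τ ∈ Ioo (X.time k) (X.time (k + 1))) (hYr : ∀ ε, (Y ε).time (r + 1) = t_f)
    (hki : k ≤ i) (hi : i ≤ r) {t : ℝ} (ht : t ∈ H.variationTimes X r k τ i) :
    ∀ᶠ ε in 𝓝[>] (0 : ℝ), t ∈ Icc ((Y ε).time i) ((Y ε).time (i + 1)) := by
  obtain ⟨h1, h2⟩ := ht
  have hl : ∀ᶠ ε in 𝓝[>] (0 : ℝ), (Y ε).time i ≤ t := by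
    split_ifs at h1 with h
    · subst h
      exact Eventually.of_forall fun ε => (hY.time_eq ε).le.trans (hτ.1.le.trans h1)
    · obtain ⟨j, rfl⟩ := Nat.exists_eq_add_of_lt (lt_of_le_of_ne hki (Ne.symm h))
      exact ((hY.tendsto (k + j) (Nat.le_add_right _ _) (by omega)).eventually
        (Iio_mem_nhds h1)).mono fun _ h => le_of_lt h
  have hr : ∀ᶠ ε in 𝓝[>] (0 : ℝ), t ≤ (Y ε).time (i + 1) := by
    split_ifs at h2 with h
    · subst h
      exact Eventually.of_forall fun ε => by rw [hYr, ← hX.time_last]; exact h2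
    · exact ((hY.tendsto i hki hi).eventually (Ioi_mem_nhds h2)).mono fun _ h => le_of_lt h
  exact hl.and hr

theorem IsTrajectory.mem_Icc_of_mem_variationTimes (hX : H.IsTrajectory u t₀ t_f loc r x₀ X)
    (hτ : τ ∈ Ioo (X.time k) (X.time (k + 1))) (hki : k ≤ i) (hi : i ≤ r) {t : ℝ}
    (ht : t ∈ H.variationTimes X r k τ i) : t ∈ Icc (max τ (X.time i)) (X.time (i + 1)) := by
  obtain ⟨h1, h2⟩ := ht
  constructor
  · split_ifs at h1 with h
    · subst h
      exact max_le h1 (hτ.1.le.trans h1)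
    · rw [hX.max_time_eq hτ.2 (lt_of_le_of_ne hki (Ne.symm h)) hi]
      exact h1.le
  · split_ifs at h2
    exacts [h2, h2.le]

end HybridSystem

/-- Uniqueness of `Ψ` is contained in the last clause: the expansion determines `Ψ i t` at all times
considered, and continuity determines it at the ends of the segments. -/
theorem proposition1 {Q : Type*} [Finite Q] (H : HybridSystem Q)
    (u : H.Control) (hu : H.IsAdmissible u) (t₀ t_f : ℝ)
    (loc : ℕ → Q) (r : ℕ) (x₀ : H.StateSpace (loc 0))
    -- the nominal trajectory
    (X : H.Trajectory loc) (hX : H.IsTrajectory u t₀ t_f loc r x₀ X)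
    -- the needle perturbation, in segment `k`
    (k : ℕ) (hk : k ≤ r) (τ : ℝ) (hτ : τ ∈ Ioo (X.time k) (X.time (k + 1)))
    (hτu : ContinuousAt (u (loc k)) τ)
    (w : H.ControlSpace (loc k)) (hw : w ∈ H.U (loc k)) (a : ℝ) (ha : 0 < a)
    -- the transitions after the perturbation are regular, and `t_f` is not a transition time
    (hreg : ∀ i, k ≤ i → i < r → H.IsRegularTransition u X i)
    (hfinal : ∀ q, H.Edge (loc r) q → H.Φ (loc r) q (X.state r t_f) ≠ 0) :
    -- for small `ε > 0` there is a perturbed trajectory through the same locations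
    (∀ᶠ ε : ℝ in 𝓝[>] 0, ∃ Y : H.Trajectory loc,
      H.IsTrajectory (H.perturbedControl u (loc k) w τ a ε) t₀ t_f loc r x₀ Y) ∧
    -- the variational equations have a solution
    (∃ Ψ : (i : ℕ) → ℝ → H.StateSpace (loc i), H.IsVariation u X r k w τ a Ψ) ∧
    -- their solution is the first-order variation of the perturbed trajectories
    ∀ Ψ : (i : ℕ) → ℝ → H.StateSpace (loc i), H.IsVariation u X r k w τ a Ψ →
      ∀ Y : ℝ → H.Trajectory loc,
        (∀ᶠ ε : ℝ in 𝓝[>] 0,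
          H.IsTrajectory (H.perturbedControl u (loc k) w τ a ε) t₀ t_f loc r x₀ (Y ε)) →
        ∀ i, k ≤ i → i ≤ r → ∀ t ∈ H.variationTimes X r k τ i,
          (∀ᶠ ε : ℝ in 𝓝[>] 0, t ∈ Icc ((Y ε).time i) ((Y ε).time (i + 1))) ∧
          (fun ε : ℝ => (Y ε).state i t - X.state i t - ε • Ψ i t)
            =o[𝓝[>] 0] (fun ε : ℝ => ε) := by
  obtain ⟨Ψ₀, hΨ₀⟩ := hX.exists_isVariation (a := a) hu hk hτ hτu hw hreg
  refine ⟨?_, ⟨Ψ₀, hΨ₀⟩, ?_⟩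
  · obtain ⟨Y, hY, hYr⟩ := hX.exists_isPerturbedFamily hu hk hτ hτu hw ha hreg hfinal hΨ₀
    exact hY.isTrajectory.mono fun ε hε => ⟨Y ε, hYr ε ▸ hε⟩
  · intro Ψ hΨ Z hZ i hki hi t ht
    -- The family is built from the given `Ψ`, so its expansion holds by construction; uniqueness of
    -- trajectories transfers it to the arbitrary family `Z`.
    obtain ⟨Y, hY, hYr⟩ := hX.exists_isPerturbedFamily hu hk hτ hτu hw ha hreg hfinal hΨ
    have hmem := hY.eventually_mem_Icc hX hτ hYr hki hi ht
    have huniq : ∀ᶠ ε in 𝓝[>] (0 : ℝ), (Y ε).time i = (Z ε).time i ∧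
        (Y ε).time (i + 1) = (Z ε).time (i + 1) ∧
        EqOn ((Y ε).state i) ((Z ε).state i) (Icc ((Y ε).time i) ((Y ε).time (i + 1))) := by
      filter_upwards [hY.isTrajectory, hZ] with ε h1 h2
      rw [hYr ε] at h1
      exact h1.unique (hu.perturbedControl hw) h2 hi
    constructor
    · filter_upwards [hmem, huniq] with ε h1 h2
      rwa [← h2.1, ← h2.2.1]
    · refine (hY.variation i hki hi t (hX.mem_Icc_of_mem_variationTimes hτ hki hi ht)).congr' ?_
        EventuallyEq.rfl
      filter_upwards [hmem, huniq] with ε h1 h2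
      rw [h2.2.2 h1]
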